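/- Let $N\ge 3$ and $m\ge 1$ be integers, let $p>1$ be real, let $B^N\subset\mathbb R^N$ be the open unit ball centred at the origin, and set $$\alpha_p:=\max\Big\{0,\tfrac{p(N-2)-(N+2)}{2}\Big\}.$$ For $\alpha>\alpha_p$ consider the Hénon problem $$-\Delta u=|x|^{\alpha}|u|^{p-1}u\ \text{ in } B^N,\qquad u=0\ \text{ on } \partial B^N,\qquad (P_\alpha)$$ and the energy $$\varphi_\alpha(u):=\frac12\int_{B^N}|\nabla u|^2\,dx-\frac1{p+1}\int_{B^N}|x|^\alpha|u|^{p+1}\,dx .$$ A nodal set of $u$ is a connected component of $\{x\in B^N: u(x)\neq 0\}$. For every $\alpha>\alpha_p$, $(P_\alpha)$ has a radial solution $u_\alpha\in C^2(\overline{B^N})$ with $u_\alpha(0)>0$ and exactly $m$ nodal sets, and the energy level $C_{\alpha,m}:=\varphi_\alpha(u_\alpha)$ is well defined, that is, it is the same for all such solutions. There are constants $C_1,C_2>0$, depending only on $p$, $N$ and $m$, such that $$C_1\Big(\frac{\alpha+N}{N}\Big)^{\frac{p+3}{p-1}}\le C_{\alpha,m}\le C_2\Big(\frac{\alpha+N}{N}\Big)^{\frac{p+3}{p-1}}\qquad\text{for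 all }\alpha>\alpha_p .$$ Moreover, the function $\alpha\mapsto C_{\alpha,m}$ is strictly increasing on $(\alpha_p,\infty)$. -/

import Mathlib

/-- The threshold `α_p = max {0, (p (N - 2) - (N + 2)) / 2}`. -/
noncomputable def henonThreshold (N : ℕ) (p : ℝ) : ℝ :=
  max 0 ((p * ((N : ℝ) - 2) - ((N : ℝ) + 2)) / 2)

/-- The number of nodal sets of `u`: connected components of the set of points of the open unit
ball where `u` does not vanish (`Nat.card` gives `0` if there are infinitely many). -/
noncomputable def nodalCount (N : ℕ) (u : EuclideanSpace ℝ (Fin N) → ℝ) : ℕ :=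
  Nat.card (ConnectedComponents
    {x : EuclideanSpace ℝ (Fin N) // x ∈ Metric.ball (0 : EuclideanSpace ℝ (Fin N)) 1 ∧ u x ≠ 0})

/-- `u` is (on the closed unit ball) a radial classical solution, positive at the origin and with
exactly `m` nodal sets, of `-Δ u = |x|^α |u|^(p-1) u` in the open unit ball, `u = 0` on its
boundary. Values of `u` off the closed ball are irrelevant. -/
structure IsRadialNodalSolution (N : ℕ) (p α : ℝ) (m : ℕ)
    (u : EuclideanSpace ℝ (Fin N) → ℝ) : Prop where
  contDiffOn : ContDiffOn ℝ 2 u (Metric.closedBall 0 1)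
  radial : ∀ x ∈ Metric.closedBall (0 : EuclideanSpace ℝ (Fin N)) 1,
    ∀ y ∈ Metric.closedBall (0 : EuclideanSpace ℝ (Fin N)) 1, ‖x‖ = ‖y‖ → u x = u y
  equation : ∀ x ∈ Metric.ball (0 : EuclideanSpace ℝ (Fin N)) 1,
    -(Laplacian.laplacian u x) = ‖x‖ ^ α * |u x| ^ (p - 1) * u x
  boundary : ∀ x ∈ Metric.sphere (0 : EuclideanSpace ℝ (Fin N)) 1, u x = 0
  pos_zero : 0 < u 0
  nodal : nodalCount N u = m

/-- The energy `φ_α(u) = (1/2) ∫_B |∇u|² - (1/(p+1)) ∫_B |x|^α |u|^(p+1)`, `B` the open unit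
ball. -/
noncomputable def henonEnergy (N : ℕ) (p α : ℝ) (u : EuclideanSpace ℝ (Fin N) → ℝ) : ℝ :=
  (1 / 2) * (∫ x in Metric.ball (0 : EuclideanSpace ℝ (Fin N)) 1, ‖gradient u x‖ ^ 2)
    - (1 / (p + 1)) *
      (∫ x in Metric.ball (0 : EuclideanSpace ℝ (Fin N)) 1, ‖x‖ ^ α * |u x| ^ (p + 1))

open Classical in
/-- The level `C_{α,m} = φ_α(u_α)`, where `u_α` is the radial solution with exactly `m` nodal sets
and positive at the origin (and `0` if there is no such solution). -/
noncomputable def henonLevel (N : ℕ) (p : ℝ) (m : ℕ) (α : ℝ) : ℝ :=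
  if h : ∃ u : EuclideanSpace ℝ (Fin N) → ℝ, IsRadialNodalSolution N p α m u then
    henonEnergy N p α h.choose
  else 0

/-!
Write `f(v) = |v|^(p-1) v`. For a radial function `u(x) = U(|x|)` the Hénon equation reads
`U'' + (N-1)/r U' + r^α f(U) = 0`. With `k = (2+α)/2` and `M = 2 + (N-2)/k`, so that
`k M = N + α`, the substitution `U(r) = (k z)^(2/(p-1)) V(z r^k)` removes the weight:
`V'' + (M-1)/s V' + f(V) = 0`, `V(0) = 1`, `V'(0) = 0`, in the real dimension `M > 2`. The
condition `α > α_p` is exactly subcriticality in this dimension, `M (p-1) < 2 (p+1)`; the limit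
`α → ∞` corresponds to the harmless value `M = 2`.

*Existence and uniqueness.* The initial value problem has a global solution for every `M ≥ 1`
(`exists_isEmden`, a fixed point argument), which is Lipschitz in `M` by a Grönwall estimate that
ignores the singular damping term because of its sign (`damped_gronwall`, `IsEmden.sub_le`).
Below the critical dimension the solution has infinitely many zeros: a solution that keeps its sign
decays so fast that it contradicts the monotonicity of the Pohozaev function
(`not_eventually_pos`). The zeros are enumerated by a strictly increasing Prüfer angle
(`emdenV_eq_zero_iff`), which also counts nodal sets (`nodalCount_eq`), and the `m`-th zero is a
locally Lipschitz function of `M` (`emdenZero_isBigO`). Placing the `m`-th zero at radius `1`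
gives a solution with `m` nodal sets, and every solution arises in this way
(`IsRadialNodalSolution.eq_nodalProfile`); hence the level is well defined.

*Bounds.* Testing the equation with its solution shows that the level is a positive constant times
the mass `∫₀¹ r^(N-1+α) |U|^(p+1)` (`henonLevel_eq`). Since `|V| ≤ 1` everywhere and `V ≥ 1/2` on
`[0,1]`, the mass is comparable to `k^((p+3)/(p-1))` up to a power of the `m`-th zero. The lower
bound does not see that power. In the upper bound it is controlled by compactness as long as `M`
stays away from the critical dimension, and near `α_p` monotonicity takes over.

*Monotonicity.* For a fixed function the energy increases with `α`, and solutions are critical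
points, so changing the solution along with `α` costs only a quadratic error. Green's identity for
the solutions `u`, `v` belonging to `β`, `α` makes this exact: the energy difference is the integral
of a trapezoidal error, of size `O(|u - v|²) = O((β-α)²)`, plus a term that is at least linear in
`β - α` (`energy_density_sub_ge`, `henonMass_sub_ge`). So the level increases strictly through every
`α`, which suffices (`strictMonoOn_of_eventually`).
-/

open Set Filter Topology MeasureTheory Asymptotics

/-! ### The power nonlinearity -/

/-- The odd power `x ↦ |x|^(p-1) x`. -/
noncomputable def signedPow (p x : ℝ) : ℝ := |x| ^ (p - 1) * x

lemma signedPow_neg (p x : ℝ) : signedPow p (-x) = -signedPow p x := by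
  simp [signedPow]

lemma signedPow_mul_self {p : ℝ} (hp : 1 < p) (x : ℝ) : signedPow p x * x = |x| ^ (p + 1) := by
  rcases eq_or_ne x 0 with rfl | hx
  · simp [signedPow, Real.zero_rpow (show p + 1 ≠ 0 by linarith)]
  · have h : 0 < |x| := abs_pos.2 hx
    rw [show p + 1 = (p - 1) + 2 by ring, Real.rpow_add h, Real.rpow_two, sq_abs, signedPow]
    ring

lemma signedPow_zero (p : ℝ) : signedPow p 0 = 0 := by simp [signedPow]

lemma signedPow_of_pos {p x : ℝ} (hx : 0 < x) : signedPow p x = x ^ p := by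
  rw [signedPow, abs_of_pos hx]
  nth_rw 2 [← Real.rpow_one x]
  rw [← Real.rpow_add hx]; congr 1; ring

lemma signedPow_smul {p c : ℝ} (hc : 0 < c) (x : ℝ) :
    signedPow p (c * x) = c ^ p * signedPow p x := by
  rw [← signedPow_of_pos hc]
  simp only [signedPow, abs_mul]
  rw [Real.mul_rpow (abs_nonneg _) (abs_nonneg _)]
  ring

lemma abs_signedPow {p : ℝ} (hp : 1 < p) (x : ℝ) : |signedPow p x| = |x| ^ p := by
  rcases eq_or_ne x 0 with rfl | hx
  · simp [signedPow, Real.zero_rpow (show p ≠ 0 by linarith)]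
  · have h : 0 < |x| := abs_pos.2 hx
    rw [signedPow, abs_mul, abs_of_nonneg (Real.rpow_nonneg h.le _)]
    nth_rw 2 [← Real.rpow_one |x|]
    rw [← Real.rpow_add h]; congr 1; ring

lemma hasDerivAt_signedPow {p : ℝ} (hp : 1 < p) (x : ℝ) :
    HasDerivAt (signedPow p) (p * |x| ^ (p - 1)) x := by
  have hpos : ∀ x : ℝ, 0 < x → HasDerivAt (signedPow p) (p * |x| ^ (p - 1)) x := by
    intro x hx
    have h := Real.hasDerivAt_rpow_const (x := x) (p := p) (Or.inl hx.ne')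
    rw [abs_of_pos hx]
    refine h.congr_of_eventuallyEq ?_
    filter_upwards [lt_mem_nhds hx] with y hy using signedPow_of_pos hy
  rcases lt_trichotomy x 0 with hx | rfl | hx
  · have h := (hpos (-x) (by linarith)).scomp x (hasDerivAt_neg x)
    have h2 : HasDerivAt (fun y => -signedPow p (-y)) _ x := h.neg
    simp only [abs_neg, smul_eq_mul, signedPow_neg, neg_neg] at h2
    exact h2.congr_deriv (by ring)
  · rw [abs_zero, Real.zero_rpow (by linarith), mul_zero]
    rw [hasDerivAt_iff_tendsto_slope_zero]
    have : Tendsto (fun t : ℝ => |t| ^ (p - 1)) (𝓝[≠] 0) (𝓝 0) := by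
      have hc : Continuous fun t : ℝ => |t| ^ (p - 1) :=
        continuous_abs.rpow_const fun _ => Or.inr (by linarith)
      have := hc.tendsto 0
      simp only [abs_zero, Real.zero_rpow (show p - 1 ≠ 0 by linarith)] at this
      exact this.mono_left nhdsWithin_le_nhds
    refine this.congr' ?_
    filter_upwards [self_mem_nhdsWithin] with t ht
    have ht : t ≠ 0 := ht
    rw [zero_add, signedPow_zero, sub_zero, smul_eq_mul, signedPow]
    field_simp
  · exact hpos x hx

lemma continuous_signedPow {p : ℝ} (hp : 1 < p) : Continuous (signedPow p) :=
  continuous_iff_continuousAt.2 fun x => (hasDerivAt_signedPow hp x).continuousAt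

lemma signedPow_monotone {p : ℝ} (hp : 1 < p) : Monotone (signedPow p) :=
  monotone_of_hasDerivAt_nonneg (hasDerivAt_signedPow hp) fun x => by
    have : 0 ≤ |x| ^ (p - 1) := Real.rpow_nonneg (abs_nonneg _) _
    simp only [Pi.zero_apply]
    nlinarith

lemma signedPow_lipschitz {p B x y : ℝ} (hp : 1 < p) (hx : |x| ≤ B) (hy : |y| ≤ B) :
    |signedPow p x - signedPow p y| ≤ p * B ^ (p - 1) * |x - y| := by
  have h := (convex_Icc (-B) B).norm_image_sub_le_of_norm_hasDerivWithin_le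
    (f := signedPow p) (f' := fun x => p * |x| ^ (p - 1)) (C := p * B ^ (p - 1)) (x := y) (y := x)
    (fun z _ => (hasDerivAt_signedPow hp z).hasDerivWithinAt) ?_ (abs_le.1 hy) (abs_le.1 hx)
  · simpa using h
  · intro z hz
    have h1 : |z| ^ (p - 1) ≤ B ^ (p - 1) :=
      Real.rpow_le_rpow (abs_nonneg _) (abs_le.2 hz) (by linarith)
    have h0 : 0 ≤ |z| ^ (p - 1) := Real.rpow_nonneg (abs_nonneg _) _
    rw [Real.norm_eq_abs, abs_of_nonneg (by nlinarith)]
    nlinarith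

/-- The primitive `|x|^(p+1) / (p+1)` of the odd power. -/
noncomputable def powPrim (p x : ℝ) : ℝ := |x| ^ (p + 1) / (p + 1)

lemma powPrim_nonneg {p : ℝ} (hp : 1 < p) (x : ℝ) : 0 ≤ powPrim p x :=
  div_nonneg (Real.rpow_nonneg (abs_nonneg _) _) (by linarith)

lemma powPrim_pos {p x : ℝ} (hp : 1 < p) (hx : x ≠ 0) : 0 < powPrim p x :=
  div_pos (Real.rpow_pos_of_pos (abs_pos.2 hx) _) (by linarith)

lemma hasDerivAt_powPrim {p : ℝ} (hp : 1 < p) (x : ℝ) :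
    HasDerivAt (powPrim p) (signedPow p x) x := by
  have h := (hasDerivAt_abs_rpow x (show 1 < p + 1 by linarith)).div_const (p + 1)
  refine h.congr_deriv ?_
  rw [signedPow, show p + 1 - 2 = p - 1 by ring]
  have : p + 1 ≠ 0 := by linarith
  field_simp

lemma signedPow_mul_self_eq {p : ℝ} (hp : 1 < p) (x : ℝ) :
    signedPow p x * x = (p + 1) * powPrim p x := by
  have : p + 1 ≠ 0 := by linarith
  rw [signedPow_mul_self hp, powPrim]; field_simp

lemma continuous_powPrim {p : ℝ} (hp : 1 < p) : Continuous (powPrim p) :=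
  continuous_iff_continuousAt.2 fun x => (hasDerivAt_powPrim hp x).continuousAt

/-- Error of the trapezoidal rule for `∫_y^x |t|^(p-1) t dt`: it is quadratically small. -/
lemma trapezoid_error {p B x y : ℝ} (hp : 1 < p) (hx : |x| ≤ B) (hy : |y| ≤ B) :
    |(signedPow p x + signedPow p y) / 2 * (x - y) - (powPrim p x - powPrim p y)|
      ≤ p * B ^ (p - 1) * (x - y) ^ 2 := by
  wlog hxy : y < x generalizing x y
  · rcases eq_or_lt_of_le (not_lt.1 hxy) with rfl | h
    · simp
    · have := this hy hx h
      rw [← abs_neg, show (x - y) ^ 2 = (y - x) ^ 2 by ring]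
      convert this using 2
      ring
  obtain ⟨c, hc, h⟩ := exists_hasDerivAt_eq_slope (powPrim p) (signedPow p) hxy
    (continuous_powPrim hp).continuousOn fun z _ => hasDerivAt_powPrim hp z
  have hd : 0 < x - y := by linarith
  rw [eq_div_iff hd.ne'] at h
  rw [← h]
  have m1 := signedPow_monotone hp hc.1.le
  have m2 := signedPow_monotone hp hc.2.le
  have l := signedPow_lipschitz hp hx hy
  rw [abs_of_nonneg (by linarith), abs_of_pos hd] at l
  rw [← sub_mul, abs_mul, abs_of_pos hd]
  have : |(signedPow p x + signedPow p y) / 2 - signedPow p c| ≤ p * B ^ (p - 1) * (x - y) := by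
    rw [abs_le]; constructor <;> linarith
  nlinarith

/-! ### Grönwall estimates on an interval starting at a singular point -/

lemma gronwall_of_zero {y y' : ℝ → ℝ} {K c S : ℝ} (hK : 0 ≤ K) (hc : 0 ≤ c)
    (hy : ContinuousOn y (Icc 0 S)) (hd : ∀ s ∈ Ioo 0 S, HasDerivAt y (y' s) s)
    (hle : ∀ s ∈ Ioo 0 S, y' s ≤ K * y s + c) (h0 : y 0 ≤ 0) :
    ∀ s ∈ Icc 0 S, y s ≤ c * s * Real.exp (K * s) := by
  intro s hs
  have key : AntitoneOn (fun s => Real.exp (-(K * s)) * y s - c * s) (Icc 0 S) := by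
    refine antitoneOn_of_deriv_nonpos (convex_Icc _ _) (by fun_prop) ?_ ?_
    all_goals
      rw [interior_Icc]
      intro s hs
      have h1 : HasDerivAt (fun s => Real.exp (-(K * s)) * y s - c * s)
          (Real.exp (-(K * s)) * (-(K * 1)) * y s + Real.exp (-(K * s)) * y' s - c * 1) s :=
        (((((hasDerivAt_id' s).const_mul K).neg).exp).mul (hd s hs)).sub
          ((hasDerivAt_id' s).const_mul c)
    · exact h1.differentiableAt.differentiableWithinAt
    · rw [h1.deriv]
      have e0 := Real.exp_pos (-(K * s))
      have e1 : Real.exp (-(K * s)) ≤ 1 := Real.exp_le_one_iff.2 (by nlinarith [hs.1])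
      nlinarith [mul_le_mul_of_nonneg_left (hle s hs) e0.le]
  have h := key (left_mem_Icc.2 (hs.1.trans hs.2)) hs hs.1
  simp only [mul_zero, neg_zero, Real.exp_zero, one_mul, sub_zero] at h
  have e : Real.exp (-(K * s)) * Real.exp (K * s) = 1 := by rw [← Real.exp_add]; simp
  have h2 : Real.exp (-(K * s)) * y s ≤ c * s := by linarith
  calc y s = Real.exp (-(K * s)) * y s * Real.exp (K * s) := by
        rw [mul_right_comm, e, one_mul]
    _ ≤ _ := mul_le_mul_of_nonneg_right h2 (Real.exp_pos _).le

/-- Grönwall for `D'' + a D' = e` with a damping coefficient `a ≥ 0` that may blow up at `0`: the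
damping term only helps, so zero initial data and `|e| ≤ L |D| + ε` force `D`, `D'` to be
`O(ε)`. -/
lemma damped_gronwall {D D1 a e : ℝ → ℝ} {L ε S : ℝ} (hL : 0 ≤ L)
    (hD : ContinuousOn D (Icc 0 S)) (hD1 : ContinuousOn D1 (Icc 0 S))
    (dD : ∀ s ∈ Ioo 0 S, HasDerivAt D (D1 s) s)
    (dD1 : ∀ s ∈ Ioo 0 S, HasDerivAt D1 (-(a s) * D1 s + e s) s)
    (ha : ∀ s ∈ Ioo 0 S, 0 ≤ a s) (he : ∀ s ∈ Ioo 0 S, |e s| ≤ L * |D s| + ε)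
    (h0 : D 0 = 0) (h1 : D1 0 = 0) :
    ∀ s ∈ Icc 0 S, D s ^ 2 + D1 s ^ 2 ≤ ε ^ 2 * s * Real.exp ((L + 2) * s) := by
  refine gronwall_of_zero (y' := fun s => 2 * D s * D1 s + 2 * D1 s * (-(a s) * D1 s + e s))
    (by linarith) (sq_nonneg _) (by fun_prop) ?_ ?_ (by simp [h0, h1])
  · intro s hs
    exact (((dD s hs).pow 2).add ((dD1 s hs).pow 2)).congr_deriv (by norm_num)
  · intro s hs
    have q1 : D1 s * e s ≤ |D1 s| * (L * |D s| + ε) := by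
      calc D1 s * e s ≤ |D1 s * e s| := le_abs_self _
        _ = |D1 s| * |e s| := abs_mul _ _
        _ ≤ _ := mul_le_mul_of_nonneg_left (he s hs) (abs_nonneg _)
    have q2 : 0 ≤ a s * D1 s ^ 2 := mul_nonneg (ha s hs) (sq_nonneg _)
    have q3 : 2 * (|D1 s| * |D s|) ≤ D s ^ 2 + D1 s ^ 2 := by
      nlinarith [sq_nonneg (|D1 s| - |D s|), sq_abs (D1 s), sq_abs (D s)]
    have q4 : 2 * (|D1 s| * ε) ≤ D1 s ^ 2 + ε ^ 2 := by
      nlinarith [sq_nonneg (|D1 s| - ε), sq_abs (D1 s)]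
    have q5 : 2 * D s * D1 s ≤ D s ^ 2 + D1 s ^ 2 := by nlinarith [sq_nonneg (D s - D1 s)]
    nlinarith [mul_le_mul_of_nonneg_left q3 hL, sq_nonneg (D s)]

/-! ### The radial initial value problem in a real dimension -/

/-- `V`, with derivative `G`, solves `V'' + (M-1)/s V' + f(V) = 0` on `(0,∞)` with `V(0) = 1` and
`V'(0) = 0`. The dimension `M` is a real number. -/
structure IsEmden (f : ℝ → ℝ) (M : ℝ) (V G : ℝ → ℝ) : Prop where
  V_zero : V 0 = 1
  G_zero : G 0 = 0
  contV : ContinuousOn V (Ici 0)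
  contG : ContinuousOn G (Ici 0)
  derivV : ∀ s, 0 < s → HasDerivAt V (G s) s
  derivG : ∀ s, 0 < s → HasDerivAt G (-((M - 1) / s) * G s - f (V s)) s

/-- `σ^(1-M) ∫_0^σ τ^(M-1) w(τ) dτ`, written without a singularity at `σ = 0`. -/
noncomputable def radialAvg (M : ℝ) (w : ℝ → ℝ) (σ : ℝ) : ℝ :=
  σ * ∫ t in (0 : ℝ)..1, t ^ (M - 1) * w (σ * t)

lemma continuous_radialAvg {M : ℝ} (hM : 1 ≤ M) {w : ℝ → ℝ} (hw : Continuous w) :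
    Continuous (radialAvg M w) := by
  have h1 : Continuous fun q : ℝ × ℝ => q.2 ^ (M - 1) * w (q.1 * q.2) :=
    (continuous_snd.rpow_const fun _ => Or.inr (by linarith)).mul (by fun_prop)
  exact continuous_id.mul
    (intervalIntegral.continuous_parametric_intervalIntegral_of_continuous'
      (f := fun σ t => t ^ (M - 1) * w (σ * t)) h1 0 1)

lemma radialAvg_sub {M : ℝ} (hM : 1 ≤ M) {w v : ℝ → ℝ} (hw : Continuous w) (hv : Continuous v)
    (σ : ℝ) : radialAvg M w σ - radialAvg M v σ = radialAvg M (fun t => w t - v t) σ := by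
  have h : Continuous fun t : ℝ => t ^ (M - 1) :=
    continuous_id.rpow_const fun _ => Or.inr (by linarith)
  rw [radialAvg, radialAvg, radialAvg, ← mul_sub, ← intervalIntegral.integral_sub]
  · simp only [mul_sub]
  · exact (h.mul (by fun_prop)).intervalIntegrable _ _
  · exact (h.mul (by fun_prop)).intervalIntegrable _ _

lemma radialAvg_eq {M σ : ℝ} (hσ : 0 < σ) (w : ℝ → ℝ) :
    radialAvg M w σ = σ ^ (1 - M) * ∫ τ in (0 : ℝ)..σ, τ ^ (M - 1) * w τ := by
  have h := intervalIntegral.mul_integral_comp_mul_left (a := 0) (b := 1)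
    (f := fun τ => (τ / σ) ^ (M - 1) * w τ) σ
  simp only [mul_zero, mul_one, mul_div_cancel_left₀ _ hσ.ne'] at h
  rw [radialAvg, h, ← intervalIntegral.integral_const_mul]
  refine intervalIntegral.integral_congr fun τ hτ => ?_
  rw [uIcc_of_le hσ.le] at hτ
  rw [Real.div_rpow hτ.1 hσ.le, show 1 - M = -(M - 1) by ring, Real.rpow_neg hσ.le]
  field_simp

lemma hasDerivAt_radialAvg {M σ : ℝ} (hM : 1 ≤ M) (hσ : 0 < σ) {w : ℝ → ℝ} (hw : Continuous w) :
    HasDerivAt (radialAvg M w) (-((M - 1) / σ) * radialAvg M w σ + w σ) σ := by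
  have hc : Continuous fun t : ℝ => t ^ (M - 1) * w t :=
    (continuous_id.rpow_const fun _ => Or.inr (by linarith)).mul hw
  have h1 := (Real.hasDerivAt_rpow_const (x := σ) (p := 1 - M) (Or.inl hσ.ne')).mul
    (intervalIntegral.integral_hasDerivAt_right (hc.intervalIntegrable 0 σ)
      hc.stronglyMeasurable.stronglyMeasurableAtFilter hc.continuousAt)
  have h2 : radialAvg M w =ᶠ[𝓝 σ]
      fun σ => σ ^ (1 - M) * ∫ τ in (0 : ℝ)..σ, τ ^ (M - 1) * w τ := by
    filter_upwards [lt_mem_nhds hσ] with x hx using radialAvg_eq hx w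
  refine (HasDerivAt.congr_of_eventuallyEq h1 h2).congr_deriv ?_
  rw [radialAvg_eq hσ, Real.rpow_sub_one hσ.ne', ← mul_assoc (σ ^ (1 - M)) (σ ^ (M - 1)),
    ← Real.rpow_add hσ]
  simp only [sub_add_sub_cancel', sub_self, Real.rpow_zero]
  ring_nf

lemma abs_radialAvg_le {M σ C : ℝ} (hM : 1 ≤ M) (hσ : 0 ≤ σ) {w : ℝ → ℝ}
    (h : ∀ τ ∈ Icc 0 σ, |w τ| ≤ C) : |radialAvg M w σ| ≤ σ * C := by
  rw [radialAvg, abs_mul, abs_of_nonneg hσ]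
  refine mul_le_mul_of_nonneg_left ?_ hσ
  have hC : 0 ≤ C := (abs_nonneg _).trans (h 0 ⟨le_rfl, hσ⟩)
  have := intervalIntegral.norm_integral_le_of_norm_le_const (a := 0) (b := 1) (C := C)
    (f := fun t => t ^ (M - 1) * w (σ * t)) ?_
  · simpa using this
  · intro t ht
    rw [uIoc_of_le zero_le_one] at ht
    have h1 : t ^ (M - 1) ≤ 1 := Real.rpow_le_one ht.1.le ht.2 (by linarith)
    have h2 := h (σ * t) ⟨mul_nonneg hσ ht.1.le, mul_le_of_le_one_right hσ ht.2⟩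
    have h3 : 0 ≤ t ^ (M - 1) := Real.rpow_nonneg ht.1.le _
    rw [Real.norm_eq_abs, abs_mul, abs_of_nonneg h3]
    nlinarith [abs_nonneg (w (σ * t))]

lemma abs_integral_radialAvg_le {M K A s : ℝ} (hM : 1 ≤ M) (hK : 0 < K) (hA : 0 ≤ A) (hs : 0 ≤ s)
    {w : ℝ → ℝ} (h : ∀ τ, 0 ≤ τ → |w τ| ≤ A * Real.exp (K * τ ^ 2)) :
    |∫ σ in (0 : ℝ)..s, radialAvg M w σ| ≤ A / (2 * K) * Real.exp (K * s ^ 2) := by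
  have hd : ∀ σ : ℝ, HasDerivAt (fun σ => A / (2 * K) * Real.exp (K * σ ^ 2))
      (σ * (A * Real.exp (K * σ ^ 2))) σ := by
    intro σ
    refine (((((hasDerivAt_id' σ).pow 2).const_mul K).exp).const_mul (A / (2 * K))).congr_deriv ?_
    field_simp
    norm_num
    ring
  have hc : Continuous fun σ : ℝ => σ * (A * Real.exp (K * σ ^ 2)) := by fun_prop
  have h1 := intervalIntegral.norm_integral_le_of_norm_le hs (f := radialAvg M w)
    (g := fun σ => σ * (A * Real.exp (K * σ ^ 2))) (μ := volume)
    (ae_of_all _ fun σ hσ => abs_radialAvg_le hM hσ.1.le fun τ hτ => (h τ hτ.1).trans ?_)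
    (hc.intervalIntegrable _ _)
  · rw [intervalIntegral.integral_eq_sub_of_hasDerivAt (fun σ _ => hd σ)
      (hc.intervalIntegrable _ _)] at h1
    refine h1.trans ?_
    have : 0 ≤ A / (2 * K) * Real.exp (K * 0 ^ 2) := by positivity
    linarith
  · gcongr
    · exact hτ.1
    · exact hτ.2

/-- Global existence for the radial problem with a bounded, globally Lipschitz nonlinearity: the
integral operator contracts the sup norm weighted by `exp (-K s²)`. -/
lemma exists_isEmden_of_lipschitz {f : ℝ → ℝ} {L : ℝ} (hL : 0 < L) (hf : ∀ x, |f x| ≤ 1)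
    (hlip : ∀ x y, |f x - f y| ≤ L * |x - y|) {M : ℝ} (hM : 1 ≤ M) :
    ∃ V G, IsEmden f M V G := by
  have hfc : Continuous f := by
    have : LipschitzWith (Real.toNNReal L) f := LipschitzWith.of_dist_le_mul fun x y => by
      rw [Real.dist_eq, Real.dist_eq, Real.coe_toNNReal _ hL.le]; exact hlip x y
    exact this.continuous
  -- the unknown is `Y = exp (-L s²) V`
  let W : BoundedContinuousFunction ℝ ℝ → ℝ → ℝ := fun Y τ => f (Real.exp (L * τ ^ 2) * Y τ)
  have hW : ∀ Y, Continuous (W Y) := fun Y => hfc.comp (by fun_prop)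
  let Φ : BoundedContinuousFunction ℝ ℝ → ℝ → ℝ := fun Y s =>
    Real.exp (-(L * s ^ 2)) * (1 - ∫ σ in (0 : ℝ)..|s|, radialAvg M (W Y) σ)
  have hint : ∀ Y, Continuous fun s : ℝ => ∫ σ in (0 : ℝ)..s, radialAvg M (W Y) σ := fun Y =>
    intervalIntegral.continuous_primitive
      (fun a b => (continuous_radialAvg hM (hW Y)).intervalIntegrable a b) 0
  have hΦc : ∀ Y, Continuous (Φ Y) := fun Y => by
    have := (hint Y).comp continuous_abs
    simp only [Function.comp_def] at this
    fun_prop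
  have hexp : ∀ s : ℝ, Real.exp (-(L * s ^ 2)) * Real.exp (L * |s| ^ 2) = 1 := fun s => by
    rw [← Real.exp_add, sq_abs]; simp
  have hΦb : ∀ Y s, ‖Φ Y s‖ ≤ 1 + 1 / (2 * L) := by
    intro Y s
    have h1 := abs_integral_radialAvg_le (A := 1) hM hL zero_le_one (abs_nonneg s) (w := W Y)
      fun τ _ => (hf _).trans (by
        rw [one_mul]; exact Real.one_le_exp (by positivity))
    have h2 : Real.exp (-(L * s ^ 2)) ≤ 1 := Real.exp_le_one_iff.2 (by nlinarith [sq_nonneg s])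
    have h3 := Real.exp_pos (-(L * s ^ 2))
    have h4 : |1 - ∫ σ in (0 : ℝ)..|s|, radialAvg M (W Y) σ| ≤
        1 + 1 / (2 * L) * Real.exp (L * |s| ^ 2) := by
      rw [abs_le] at h1 ⊢
      constructor <;> linarith
    rw [Real.norm_eq_abs, abs_mul, abs_of_pos h3]
    calc _ ≤ Real.exp (-(L * s ^ 2)) * (1 + 1 / (2 * L) * Real.exp (L * |s| ^ 2)) :=
          mul_le_mul_of_nonneg_left h4 h3.le
      _ = Real.exp (-(L * s ^ 2)) + 1 / (2 * L) := by
          rw [mul_add, mul_left_comm, hexp]; ring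
      _ ≤ _ := by linarith
  let T : BoundedContinuousFunction ℝ ℝ → BoundedContinuousFunction ℝ ℝ := fun Y =>
    BoundedContinuousFunction.ofNormedAddCommGroup (Φ Y) (hΦc Y) _ (hΦb Y)
  have hT : ContractingWith (1 / 2) T := by
    refine ⟨by norm_num, LipschitzWith.of_dist_le_mul fun Y Z => ?_⟩
    refine (BoundedContinuousFunction.dist_le (by positivity)).2 fun s => ?_
    have e : Φ Y s - Φ Z s = -Real.exp (-(L * s ^ 2)) *
        ∫ σ in (0 : ℝ)..|s|, radialAvg M (fun t => W Y t - W Z t) σ := by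
      rw [← intervalIntegral.integral_congr fun σ _ => radialAvg_sub hM (hW Y) (hW Z) σ,
        intervalIntegral.integral_sub
          ((continuous_radialAvg hM (hW Y)).intervalIntegrable _ _)
          ((continuous_radialAvg hM (hW Z)).intervalIntegrable _ _)]
      simp only [Φ]
      ring
    have h1 := abs_integral_radialAvg_le (A := L * dist Y Z) hM hL (by positivity) (abs_nonneg s)
      (w := fun t => W Y t - W Z t) fun τ _ => by
        refine (hlip _ _).trans ?_
        rw [← mul_sub, abs_mul, abs_of_pos (Real.exp_pos _)]
        have := BoundedContinuousFunction.dist_coe_le_dist (f := Y) (g := Z) τ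
        rw [Real.dist_eq] at this
        have h3 := Real.exp_pos (L * τ ^ 2)
        calc L * (Real.exp (L * τ ^ 2) * |Y τ - Z τ|)
            ≤ L * (Real.exp (L * τ ^ 2) * dist Y Z) := by gcongr
          _ = _ := by ring
    have h3 := Real.exp_pos (-(L * s ^ 2))
    change dist (Φ Y s) (Φ Z s) ≤ _
    rw [Real.dist_eq, e, abs_mul, abs_neg, abs_of_pos h3]
    refine (mul_le_mul_of_nonneg_left h1 h3.le).trans (le_of_eq ?_)
    rw [mul_left_comm, hexp]
    push_cast
    field_simp
  obtain ⟨Y, hY⟩ : ∃ Y, T Y = Y := ⟨_, hT.fixedPoint_isFixedPt⟩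
  have hYs : ∀ s, Real.exp (L * s ^ 2) * Y s =
      1 - ∫ σ in (0 : ℝ)..|s|, radialAvg M (W Y) σ := by
    intro s
    have : Φ Y s = Y s := by
      conv_rhs => rw [← hY]
      rfl
    rw [← this]
    simp only [Φ]
    have e := hexp s
    rw [sq_abs] at e
    rw [← mul_assoc, mul_comm (Real.exp _), e, one_mul]
  refine ⟨fun s => Real.exp (L * s ^ 2) * Y s, fun s => -radialAvg M (W Y) s, ?_, ?_, ?_, ?_, ?_,
    ?_⟩
  · simp only [hYs]; simp
  · simp [radialAvg]
  · fun_prop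
  · exact (continuous_radialAvg hM (hW Y)).neg.continuousOn
  · intro s hs
    have h1 : HasDerivAt (fun s => 1 - ∫ σ in (0 : ℝ)..s, radialAvg M (W Y) σ)
        (-radialAvg M (W Y) s) s := by
      have hc := continuous_radialAvg hM (hW Y)
      exact (intervalIntegral.integral_hasDerivAt_right (hc.intervalIntegrable 0 s)
        hc.stronglyMeasurable.stronglyMeasurableAtFilter hc.continuousAt).const_sub 1
    refine h1.congr_of_eventuallyEq ?_
    filter_upwards [lt_mem_nhds hs] with x hx
    rw [hYs, abs_of_pos hx]
  · intro s hs
    exact (hasDerivAt_radialAvg hM hs (hW Y)).neg.congr_deriv (by simp only [W]; ring)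

lemma IsEmden.energy_antitone {f F : ℝ → ℝ} {M : ℝ} {V G : ℝ → ℝ} (h : IsEmden f M V G)
    (hM : 1 ≤ M) (hF : ∀ x, HasDerivAt F (f x) x) :
    AntitoneOn (fun s => G s ^ 2 / 2 + F (V s)) (Ici 0) := by
  have hFc : Continuous F := continuous_iff_continuousAt.2 fun x => (hF x).continuousAt
  refine antitoneOn_of_deriv_nonpos (convex_Ici 0)
    (((h.contG.pow 2).div_const 2).add (hFc.comp_continuousOn h.contV)) ?_ ?_
  all_goals
    rw [interior_Ici]
    intro s hs
    have hs : 0 < s := hs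
    have h1 : HasDerivAt (fun s => G s ^ 2 / 2 + F (V s)) (-((M - 1) / s) * G s ^ 2) s :=
      ((((h.derivG s hs).pow 2).div_const 2).add ((hF (V s)).comp s (h.derivV s hs))).congr_deriv
        (by norm_num; ring)
  · exact h1.differentiableAt.differentiableWithinAt
  · rw [h1.deriv]
    have : 0 ≤ (M - 1) / s := div_nonneg (by linarith) hs.le
    nlinarith [sq_nonneg (G s)]

lemma exists_isEmden {p M : ℝ} (hp : 1 < p) (hM : 1 ≤ M) :
    ∃ V G, IsEmden (signedPow p) M V G := by
  -- truncate the nonlinearity outside `[-1, 1]`, which the solution does not leave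
  let t : ℝ → ℝ := fun x => max (-1) (min 1 x)
  have ht : ∀ x, |t x| ≤ 1 := fun x => abs_le.2
    ⟨le_max_left _ _, max_le (by norm_num) (min_le_left _ _)⟩
  have ht' : ∀ x, |x| ≤ 1 → t x = x := fun x hx => by
    simp only [t]
    rw [min_eq_right (abs_le.1 hx).2, max_eq_right (abs_le.1 hx).1]
  have tl : ∀ x y, |t x - t y| ≤ |x - y| := fun x y => by
    have : LipschitzWith 1 t := (LipschitzWith.id.const_min 1).const_max (-1)
    simpa [Real.dist_eq] using this.dist_le_mul x y
  let f : ℝ → ℝ := fun x => signedPow p (t x)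
  have hlip : ∀ x y, |f x - f y| ≤ p * |x - y| := fun x y => by
    have := signedPow_lipschitz hp (ht x) (ht y)
    rw [Real.one_rpow, mul_one] at this
    exact this.trans (mul_le_mul_of_nonneg_left (tl x y) (by linarith))
  have hfc : Continuous f := (continuous_signedPow hp).comp (by fun_prop)
  have hf1 : ∀ x, |f x| ≤ 1 := fun x => by
    rw [abs_signedPow hp]; exact Real.rpow_le_one (abs_nonneg _) (ht x) (by linarith)
  obtain ⟨V, G, h⟩ := exists_isEmden_of_lipschitz (by linarith : 0 < p) hf1 hlip hM
  let F : ℝ → ℝ := fun x => ∫ y in (0 : ℝ)..x, f y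
  have hF : ∀ x, HasDerivAt F (f x) x := fun x =>
    intervalIntegral.integral_hasDerivAt_right (hfc.intervalIntegrable 0 x)
      hfc.stronglyMeasurable.stronglyMeasurableAtFilter hfc.continuousAt
  have hodd : ∀ x, f (-x) = -f x := fun x => by
    simp only [f]
    rw [← signedPow_neg]
    congr 1
    simp only [t, ← min_neg_neg, ← max_neg_neg, neg_neg]
    rcases le_total x 1 with h1 | h1 <;> simp [h1]
  have heven : ∀ x, F (-x) = F x := fun x => by
    have := intervalIntegral.integral_comp_neg (a := 0) (b := x) f
    simp only [hodd, neg_zero, intervalIntegral.integral_neg] at this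
    simp only [F]
    rw [intervalIntegral.integral_symm, ← this, neg_neg]
  have hgt : ∀ x, 1 < x → F 1 < F x := fun x hx => by
    refine strictMonoOn_of_deriv_pos (convex_Icc 1 x)
      (fun y _ => (hF y).continuousAt.continuousWithinAt) (fun y hy => ?_)
      (left_mem_Icc.2 hx.le) (right_mem_Icc.2 hx.le) hx
    rw [interior_Icc] at hy
    rw [(hF y).deriv]
    have : t y = 1 := by
      simp only [t]; rw [min_eq_left hy.1.le]; norm_num
    simp [f, this, signedPow]
  have hV : ∀ s, 0 ≤ s → |V s| ≤ 1 := fun s hs => by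
    have h1 := h.energy_antitone hM hF (self_mem_Ici) (mem_Ici.2 hs) hs
    simp only [h.V_zero, h.G_zero] at h1
    by_contra hlt
    have h2 := hgt _ (not_le.1 hlt)
    have h3 : F |V s| = F (V s) := by
      rcases abs_choice (V s) with h | h <;> rw [h]
      exact heven _
    nlinarith [sq_nonneg (G s)]
  refine ⟨V, G, h.V_zero, h.G_zero, h.contV, h.contG, h.derivV, fun s hs => ?_⟩
  have := h.derivG s hs
  simp only [f] at this
  rwa [ht' _ (hV s hs.le)] at this

/-! ### A priori bounds and dependence on the dimension -/

namespace IsEmden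

variable {p M : ℝ} {V G : ℝ → ℝ}

lemma energy_le (h : IsEmden (signedPow p) M V G) (hp : 1 < p) (hM : 1 ≤ M) {s : ℝ} (hs : 0 ≤ s) :
    G s ^ 2 / 2 + powPrim p (V s) ≤ 1 / (p + 1) := by
  have := h.energy_antitone hM (hasDerivAt_powPrim hp) self_mem_Ici (mem_Ici.2 hs) hs
  simpa [h.V_zero, h.G_zero, powPrim] using this

lemma abs_V_le (h : IsEmden (signedPow p) M V G) (hp : 1 < p) (hM : 1 ≤ M) {s : ℝ} (hs : 0 ≤ s) :
    |V s| ≤ 1 := by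
  have h1 := h.energy_le hp hM hs
  by_contra hlt
  have h2 : 1 < |V s| ^ (p + 1) := Real.one_lt_rpow (not_le.1 hlt) (by linarith)
  have h3 : 1 / (p + 1) < powPrim p (V s) := by rw [powPrim]; gcongr
  nlinarith [sq_nonneg (G s)]

lemma abs_G_le_one (h : IsEmden (signedPow p) M V G) (hp : 1 < p) (hM : 1 ≤ M) {s : ℝ}
    (hs : 0 ≤ s) : |G s| ≤ 1 := by
  have h1 := h.energy_le hp hM hs
  have h2 := powPrim_nonneg hp (V s)
  have h3 : 1 / (p + 1) ≤ 1 / 2 := by gcongr; linarith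
  exact abs_le_one_iff_mul_self_le_one.2 (by nlinarith)

lemma hasDerivAt_momentum (h : IsEmden (signedPow p) M V G) {s : ℝ} (hs : 0 < s) :
    HasDerivAt (fun s => s ^ (M - 1) * G s) (-(s ^ (M - 1) * signedPow p (V s))) s := by
  refine ((Real.hasDerivAt_rpow_const (p := M - 1) (Or.inl hs.ne')).mul
    (h.derivG s hs)).congr_deriv ?_
  rw [Real.rpow_sub_one hs.ne' (M - 1)]
  field_simp
  ring

lemma continuousOn_momentum (h : IsEmden (signedPow p) M V G) (hM : 1 ≤ M) :
    ContinuousOn (fun s => s ^ (M - 1) * G s) (Ici 0) :=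
  (continuousOn_id.rpow_const fun _ _ => Or.inr (by linarith)).mul h.contG

lemma abs_G_le (h : IsEmden (signedPow p) M V G) (hp : 1 < p) (hM : 1 ≤ M) {s : ℝ} (hs : 0 ≤ s) :
    |G s| ≤ s := by
  rcases hs.eq_or_lt with rfl | hs
  · simp [h.G_zero]
  obtain ⟨c, hc, e⟩ := exists_hasDerivAt_eq_slope (fun s => s ^ (M - 1) * G s)
    (fun s => -(s ^ (M - 1) * signedPow p (V s))) hs
    ((h.continuousOn_momentum hM).mono Icc_subset_Ici_self)
    fun x hx => h.hasDerivAt_momentum hx.1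
  have hs1 : 0 < s ^ (M - 1) := Real.rpow_pos_of_pos hs _
  rw [h.G_zero, mul_zero, sub_zero, sub_zero, eq_div_iff hs.ne'] at e
  have h1 : |c ^ (M - 1) * signedPow p (V c)| ≤ s ^ (M - 1) := by
    have hc0 : 0 ≤ c ^ (M - 1) := Real.rpow_nonneg hc.1.le _
    rw [abs_mul, abs_signedPow hp, abs_of_nonneg hc0]
    have h2 : c ^ (M - 1) ≤ s ^ (M - 1) := Real.rpow_le_rpow hc.1.le hc.2.le (by linarith)
    have h3 : |V c| ^ p ≤ 1 :=
      Real.rpow_le_one (abs_nonneg _) (h.abs_V_le hp hM hc.1.le) (by linarith)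
    have h4 : 0 ≤ |V c| ^ p := Real.rpow_nonneg (abs_nonneg _) _
    nlinarith
  have h2 : s ^ (M - 1) * |G s| ≤ s ^ (M - 1) * s := by
    rw [← abs_of_pos hs1, ← abs_mul, ← e, abs_mul, abs_neg, abs_of_pos hs1, abs_of_pos hs]
    gcongr
  exact le_of_mul_le_mul_left h2 hs1

lemma half_le_V (h : IsEmden (signedPow p) M V G) (hp : 1 < p) (hM : 1 ≤ M) {s : ℝ}
    (hs : s ∈ Icc (0 : ℝ) 1) : 1 / 2 ≤ V s := by
  rcases hs.1.eq_or_lt with h0 | h0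
  · rw [← h0, h.V_zero]; norm_num
  have hm : MonotoneOn (fun s => V s + s ^ 2 / 2) (Icc 0 s) := by
    refine monotoneOn_of_deriv_nonneg (convex_Icc _ _)
      ((h.contV.mono Icc_subset_Ici_self).add (by fun_prop)) ?_ ?_
    all_goals
      rw [interior_Icc]
      intro x hx
      have h1 : HasDerivAt (fun s => V s + s ^ 2 / 2) (G x + x) x :=
        ((h.derivV x hx.1).add (((hasDerivAt_id' x).pow 2).div_const 2)).congr_deriv (by norm_num)
    · exact h1.differentiableAt.differentiableWithinAt
    · rw [h1.deriv]
      linarith [(abs_le.1 (h.abs_G_le hp hM hx.1.le)).1]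
  have := hm (left_mem_Icc.2 h0.le) (right_mem_Icc.2 h0.le) h0.le
  simp only [h.V_zero] at this
  nlinarith [hs.2]

/-- The energy never vanishes: `s^(2M-2) (V'²/2 + F(V))` is nondecreasing. -/
lemma energy_pos (h : IsEmden (signedPow p) M V G) (hp : 1 < p) (hM : 1 ≤ M) {s : ℝ}
    (hs : 0 ≤ s) : 0 < G s ^ 2 / 2 + powPrim p (V s) := by
  rcases hs.eq_or_lt with rfl | hs
  · have := powPrim_pos hp (x := V 0) (by rw [h.V_zero]; norm_num)
    positivity
  have hm : MonotoneOn (fun s => (s ^ (M - 1) * G s) ^ 2 / 2 + (s ^ (M - 1)) ^ 2 * powPrim p (V s))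
      (Ioi 0) := by
    refine monotoneOn_of_deriv_nonneg (convex_Ioi _) ?_ ?_ ?_
    rotate_right 2
    all_goals try rw [interior_Ioi]
    all_goals
      intro x hx
      have hx : 0 < x := hx
      have h1 : HasDerivAt
          (fun s => (s ^ (M - 1) * G s) ^ 2 / 2 + (s ^ (M - 1)) ^ 2 * powPrim p (V s))
          (2 * (x ^ (M - 1) * ((M - 1) * x ^ (M - 1 - 1)) * powPrim p (V x))) x :=
        ((((h.hasDerivAt_momentum hx).pow 2).div_const 2).add
          (((Real.hasDerivAt_rpow_const (p := M - 1) (Or.inl hx.ne')).pow 2).mul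
            ((hasDerivAt_powPrim hp (V x)).comp x (h.derivV x hx)))).congr_deriv (by
              simp only [Function.comp_apply, Pi.pow_apply]; norm_num; ring)
    · exact h1.differentiableAt.differentiableWithinAt
    · rw [h1.deriv]
      have := powPrim_nonneg hp (V x)
      have : 0 ≤ M - 1 := by linarith
      positivity
    · exact h1.continuousAt.continuousWithinAt
  have hr : 0 < min s 1 := lt_min hs one_pos
  have h1 := hm hr hs (min_le_left s 1)
  have h2 : 0 < powPrim p (V (min s 1)) := powPrim_pos hp
    (by linarith [h.half_le_V hp hM ⟨hr.le, min_le_right s 1⟩] : (0 : ℝ) < _).ne'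
  have h3 : 0 < (min s 1) ^ (M - 1) := Real.rpow_pos_of_pos hr _
  have h4 : 0 < s ^ (M - 1) := Real.rpow_pos_of_pos hs _
  simp only at h1
  by_contra hneg
  have h5 : (s ^ (M - 1)) ^ 2 * (G s ^ 2 / 2 + powPrim p (V s)) ≤ 0 :=
    mul_nonpos_of_nonneg_of_nonpos (by positivity) (not_lt.1 hneg)
  have h6 : 0 < (min s 1 ^ (M - 1)) ^ 2 * powPrim p (V (min s 1)) := by positivity
  nlinarith [sq_nonneg (min s 1 ^ (M - 1) * G (min s 1))]

lemma G_ne_zero (h : IsEmden (signedPow p) M V G) (hp : 1 < p) (hM : 1 ≤ M) {s : ℝ}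
    (hs : 0 ≤ s) (h0 : V s = 0) : G s ≠ 0 := by
  intro h1
  have := h.energy_pos hp hM hs
  simp [h0, h1, powPrim, Real.zero_rpow (show p + 1 ≠ 0 by linarith)] at this

/-- Lipschitz dependence of the solution on the dimension. -/
lemma sub_le {M' : ℝ} {V' G' : ℝ → ℝ} (h : IsEmden (signedPow p) M V G)
    (h' : IsEmden (signedPow p) M' V' G') (hp : 1 < p) (hM : 1 ≤ M) (hM' : 1 ≤ M') {s : ℝ}
    (hs : 0 ≤ s) :
    |V' s - V s| ≤ |M' - M| * Real.exp ((p + 3) * s) ∧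
      |G' s - G s| ≤ |M' - M| * Real.exp ((p + 3) * s) := by
  have key := damped_gronwall (D := fun s => V' s - V s) (D1 := fun s => G' s - G s)
    (a := fun s => (M' - 1) / s)
    (e := fun s => -((M' - M) * (G s / s)) - (signedPow p (V' s) - signedPow p (V s)))
    (L := p) (ε := |M' - M|) (S := s) (by linarith)
    ((h'.contV.sub h.contV).mono Icc_subset_Ici_self)
    ((h'.contG.sub h.contG).mono Icc_subset_Ici_self)
    (fun x hx => (h'.derivV x hx.1).sub (h.derivV x hx.1))
    (fun x hx => ((h'.derivG x hx.1).sub (h.derivG x hx.1)).congr_deriv (by ring))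
    (fun x hx => div_nonneg (by linarith) hx.1.le) ?_ (by simp [h.V_zero, h'.V_zero])
    (by simp [h.G_zero, h'.G_zero]) s (right_mem_Icc.2 hs)
  · have e1 : s * Real.exp ((p + 2) * s) ≤ Real.exp ((p + 3) * s) ^ 2 := by
      have a1 : s ≤ Real.exp s := by linarith [Real.add_one_le_exp s]
      calc s * Real.exp ((p + 2) * s) ≤ Real.exp s * Real.exp ((p + 2) * s) := by gcongr
        _ = Real.exp ((p + 3) * s) := by rw [← Real.exp_add]; congr 1; ring
        _ ≤ _ := by
          have : 1 ≤ Real.exp ((p + 3) * s) := Real.one_le_exp (by nlinarith)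
          nlinarith
    have e2 : (V' s - V s) ^ 2 + (G' s - G s) ^ 2 ≤ (|M' - M| * Real.exp ((p + 3) * s)) ^ 2 := by
      rw [mul_pow]
      refine key.trans ?_
      rw [mul_assoc]
      gcongr
    have e3 : 0 ≤ |M' - M| * Real.exp ((p + 3) * s) := by positivity
    constructor
    · exact abs_le_of_sq_le_sq (by nlinarith [sq_nonneg (G' s - G s)]) e3
    · exact abs_le_of_sq_le_sq (by nlinarith [sq_nonneg (V' s - V s)]) e3
  · intro x hx
    have l := signedPow_lipschitz hp (h'.abs_V_le hp hM' hx.1.le) (h.abs_V_le hp hM hx.1.le)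
    rw [Real.one_rpow, mul_one] at l
    have g : |(M' - M) * (G x / x)| ≤ |M' - M| := by
      rw [abs_mul, abs_div, abs_of_pos hx.1]
      refine mul_le_of_le_one_right (abs_nonneg _) ?_
      rw [div_le_one hx.1]
      exact h.abs_G_le hp hM hx.1.le
    refine (abs_sub _ _).trans ?_
    rw [abs_neg]
    linarith

end IsEmden

/-- The solution of the radial initial value problem in dimension `M`. -/
noncomputable def emdenV (p M : ℝ) : ℝ → ℝ :=
  if h : 1 < p ∧ 1 ≤ M then (exists_isEmden h.1 h.2).choose else 0

/-- The derivative of `emdenV`. -/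
noncomputable def emdenG (p M : ℝ) : ℝ → ℝ :=
  if h : 1 < p ∧ 1 ≤ M then (exists_isEmden h.1 h.2).choose_spec.choose else 0

lemma isEmden_emdenV {p M : ℝ} (hp : 1 < p) (hM : 1 ≤ M) :
    IsEmden (signedPow p) M (emdenV p M) (emdenG p M) := by
  rw [emdenV, emdenG, dif_pos ⟨hp, hM⟩, dif_pos ⟨hp, hM⟩]
  exact (exists_isEmden hp hM).choose_spec.choose_spec

lemma continuousOn_of_lipschitz_left {Φ : ℝ → ℝ → ℝ} {A B : Set ℝ} {K : ℝ → ℝ}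
    (hK : Continuous K) (hc : ∀ M ∈ A, ContinuousOn (Φ M) B)
    (hl : ∀ M ∈ A, ∀ M' ∈ A, ∀ s ∈ B, |Φ M' s - Φ M s| ≤ |M' - M| * K s) :
    ContinuousOn (fun q : ℝ × ℝ => Φ q.1 q.2) (A ×ˢ B) := by
  rintro ⟨M, s⟩ ⟨hM, hs⟩
  have h1 : Tendsto (fun q : ℝ × ℝ => |q.1 - M| * K q.2) (𝓝[A ×ˢ B] (M, s)) (𝓝 0) := by
    have : Continuous fun q : ℝ × ℝ => |q.1 - M| * K q.2 := by fun_prop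
    have := this.tendsto (M, s)
    simp only [sub_self, abs_zero, zero_mul] at this
    exact this.mono_left nhdsWithin_le_nhds
  have h2 : Tendsto (fun q : ℝ × ℝ => Φ M q.2) (𝓝[A ×ˢ B] (M, s)) (𝓝 (Φ M s)) :=
    (hc M hM s hs).tendsto.comp
      (tendsto_nhdsWithin_iff.2 ⟨(continuous_snd.tendsto _).mono_left nhdsWithin_le_nhds,
        eventually_mem_nhdsWithin.mono fun q hq => hq.2⟩)
  have h3 : Tendsto (fun q : ℝ × ℝ => Φ q.1 q.2 - Φ M q.2) (𝓝[A ×ˢ B] (M, s)) (𝓝 0) := by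
    refine squeeze_zero_norm' ?_ h1
    filter_upwards [self_mem_nhdsWithin] with q hq
    exact hl M hM q.1 hq.1 q.2 hq.2
  have := h3.add h2
  simpa [ContinuousWithinAt] using this

lemma continuousOn_emdenV {p : ℝ} (hp : 1 < p) :
    ContinuousOn (fun q : ℝ × ℝ => emdenV p q.1 q.2) (Ici 1 ×ˢ Ici 0) :=
  continuousOn_of_lipschitz_left (K := fun s => Real.exp ((p + 3) * s)) (by fun_prop)
    (fun _ hM => (isEmden_emdenV hp hM).contV) fun _ hM _ hM' _ hs =>
      ((isEmden_emdenV hp hM).sub_le (isEmden_emdenV hp hM') hp hM hM' hs).1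

lemma continuousOn_emdenG {p : ℝ} (hp : 1 < p) :
    ContinuousOn (fun q : ℝ × ℝ => emdenG p q.1 q.2) (Ici 1 ×ˢ Ici 0) :=
  continuousOn_of_lipschitz_left (K := fun s => Real.exp ((p + 3) * s)) (by fun_prop)
    (fun _ hM => (isEmden_emdenV hp hM).contG) fun _ hM _ hM' _ hs =>
      ((isEmden_emdenV hp hM).sub_le (isEmden_emdenV hp hM') hp hM hM' hs).2

/-! ### The Prüfer angle -/

/-- The speed of the Prüfer angle of the solution in dimension `M`. -/
noncomputable def angleRate (p M s : ℝ) : ℝ :=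
  s ^ (M - 1) * (emdenG p M s ^ 2 + |emdenV p M s| ^ (p + 1)) /
    (emdenV p M s ^ 2 + (s ^ (M - 1) * emdenG p M s) ^ 2)

/-- The Prüfer angle `θ` of the solution `V` in dimension `M`, vanishing at `s = 0`: the vector
`(V, -s^(M-1) V')` is a multiple of `(cos θ, sin θ)`. For `M < 2` or `s < 0` the parameters are
replaced by `2` and `0`, so that the angle is jointly continuous on the whole plane. -/
noncomputable def pruferAngle (p M s : ℝ) : ℝ :=
  ∫ σ in (0 : ℝ)..s, angleRate p (max M 2) (max σ 0)

lemma prufer_radius_pos {p M s : ℝ} (hp : 1 < p) (hM : 1 ≤ M) (hs : 0 ≤ s) :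
    0 < emdenV p M s ^ 2 + (s ^ (M - 1) * emdenG p M s) ^ 2 := by
  have h := isEmden_emdenV hp hM
  by_cases hV : emdenV p M s = 0
  · have hG := h.G_ne_zero hp hM hs hV
    have hs0 : s ≠ 0 := by rintro rfl; simp [h.V_zero] at hV
    have : 0 < s ^ (M - 1) := Real.rpow_pos_of_pos (lt_of_le_of_ne hs hs0.symm) _
    positivity
  · positivity

lemma continuous_angleRate {p : ℝ} (hp : 1 < p) :
    Continuous fun q : ℝ × ℝ => angleRate p (max q.1 2) (max q.2 0) := by
  have hm : Continuous fun q : ℝ × ℝ => ((max q.1 2, max q.2 0) : ℝ × ℝ) := by fun_prop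
  have hmem : ∀ q : ℝ × ℝ, ((max q.1 2, max q.2 0) : ℝ × ℝ) ∈ Ici (1 : ℝ) ×ˢ Ici (0 : ℝ) :=
    fun q => ⟨mem_Ici.2 (le_trans (by norm_num) (le_max_right _ _)), mem_Ici.2 (le_max_right _ _)⟩
  have hV : Continuous fun q : ℝ × ℝ => emdenV p (max q.1 2) (max q.2 0) :=
    (continuousOn_emdenV hp).comp_continuous hm hmem
  have hG : Continuous fun q : ℝ × ℝ => emdenG p (max q.1 2) (max q.2 0) :=
    (continuousOn_emdenG hp).comp_continuous hm hmem
  have hr : Continuous fun q : ℝ × ℝ => (max q.2 0) ^ (max q.1 2 - 1) :=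
    Continuous.rpow (by fun_prop) (by fun_prop) fun q =>
      Or.inr (by linarith [le_max_right q.1 2])
  have hV' : Continuous fun q : ℝ × ℝ => |emdenV p (max q.1 2) (max q.2 0)| ^ (p + 1) :=
    hV.abs.rpow_const fun _ => Or.inr (by linarith)
  exact (hr.mul ((hG.pow 2).add hV')).div ((hV.pow 2).add ((hr.mul hG).pow 2)) fun q =>
    (prufer_radius_pos hp (hmem q).1 (hmem q).2).ne'

lemma continuous_pruferAngle {p : ℝ} (hp : 1 < p) :
    Continuous fun q : ℝ × ℝ => pruferAngle p q.1 q.2 := by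
  have h : Continuous fun x : (ℝ × ℝ) × ℝ => angleRate p (max x.1.1 2) (max x.2 0) :=
    (continuous_angleRate hp).comp (by fun_prop : Continuous fun x : (ℝ × ℝ) × ℝ => (x.1.1, x.2))
  exact intervalIntegral.continuous_parametric_intervalIntegral_of_continuous
    (f := fun (q : ℝ × ℝ) σ => angleRate p (max q.1 2) (max σ 0)) h continuous_snd

lemma pruferAngle_zero (p M : ℝ) : pruferAngle p M 0 = 0 := by simp [pruferAngle]

lemma hasDerivAt_pruferAngle {p M s : ℝ} (hp : 1 < p) (hM : 2 ≤ M) (hs : 0 ≤ s) :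
    HasDerivAt (pruferAngle p M) (angleRate p M s) s := by
  have hc : Continuous fun σ => angleRate p (max M 2) (max σ 0) :=
    (continuous_angleRate hp).comp (by fun_prop : Continuous fun σ : ℝ => (M, σ))
  have := intervalIntegral.integral_hasDerivAt_right (hc.intervalIntegrable 0 s)
    hc.stronglyMeasurable.stronglyMeasurableAtFilter hc.continuousAt
  exact this.congr_deriv (by rw [max_eq_left hM, max_eq_left hs])

lemma angleRate_pos {p M s : ℝ} (hp : 1 < p) (hM : 1 ≤ M) (hs : 0 < s) : 0 < angleRate p M s := by
  refine div_pos (mul_pos (Real.rpow_pos_of_pos hs _) ?_) (prufer_radius_pos hp hM hs.le)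
  have h := isEmden_emdenV hp hM
  by_cases hV : emdenV p M s = 0
  · have hG := h.G_ne_zero hp hM hs.le hV
    positivity
  · have := Real.rpow_pos_of_pos (abs_pos.2 hV) (p + 1)
    positivity

lemma strictMonoOn_pruferAngle {p M : ℝ} (hp : 1 < p) (hM : 2 ≤ M) :
    StrictMonoOn (pruferAngle p M) (Ici 0) := by
  refine strictMonoOn_of_deriv_pos (convex_Ici 0)
    (fun s hs => (hasDerivAt_pruferAngle hp hM hs).continuousAt.continuousWithinAt) fun s hs => ?_
  rw [interior_Ici] at hs
  have hs : 0 < s := hs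
  rw [(hasDerivAt_pruferAngle hp hM hs.le).deriv]
  exact angleRate_pos hp (by linarith) hs

lemma emdenV_eq_zero_iff {p M s : ℝ} (hp : 1 < p) (hM : 2 ≤ M) (hs : 0 ≤ s) :
    emdenV p M s = 0 ↔ Real.cos (pruferAngle p M s) = 0 := by
  have hM1 : 1 ≤ M := by linarith
  have h := isEmden_emdenV hp hM1
  set V := emdenV p M
  set G := emdenG p M
  set θ := pruferAngle p M
  -- the component of `(V, -P)` orthogonal to `(cos θ, sin θ)` vanishes
  have key : s ^ (M - 1) * G s * Real.cos (θ s) + V s * Real.sin (θ s) = 0 := by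
    rcases hs.eq_or_lt with h0 | h0
    · rw [← h0, h.G_zero, show θ 0 = 0 from pruferAngle_zero p M]; simp
    set P : ℝ → ℝ := fun s => s ^ (M - 1) * G s with hP
    have hPc : ContinuousOn P (Ici 0) := h.continuousOn_momentum hM1
    have hθ : ContinuousOn θ (Ici 0) := fun x hx =>
      (hasDerivAt_pruferAngle hp hM hx).continuousAt.continuousWithinAt
    have hR : ∀ x, 0 ≤ x → V x ^ 2 + P x ^ 2 ≠ 0 := fun x hx =>
      (prufer_radius_pos hp hM1 hx).ne'
    obtain ⟨c, -, e⟩ := exists_hasDerivAt_eq_slope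
      (fun x => (P x * Real.cos (θ x) + V x * Real.sin (θ x)) ^ 2 / (V x ^ 2 + P x ^ 2))
      (fun _ => 0) h0
      (((((hPc.mul (Real.continuous_cos.comp_continuousOn hθ)).add
        (h.contV.mul (Real.continuous_sin.comp_continuousOn hθ))).pow 2).div
        ((h.contV.pow 2).add (hPc.pow 2)) hR).mono Icc_subset_Ici_self) fun x hx => by
        have dP : HasDerivAt P (-(x ^ (M - 1) * signedPow p (V x))) x :=
          h.hasDerivAt_momentum hx.1
        have dV : HasDerivAt V (G x) x := h.derivV x hx.1
        have dθ : HasDerivAt θ (angleRate p M x) x := hasDerivAt_pruferAngle hp hM hx.1.le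
        have hRx := hR x hx.1.le
        have e1 : angleRate p M x * (V x ^ 2 + P x ^ 2) =
            x ^ (M - 1) * signedPow p (V x) * V x + P x * G x := by
          rw [angleRate, div_mul_cancel₀ _ hRx, ← signedPow_mul_self hp]
          simp only [hP]; ring
        have e2 : angleRate p M x = (x ^ (M - 1) * signedPow p (V x) * V x + P x * G x) /
            (V x ^ 2 + P x ^ 2) := by rw [← e1, mul_div_cancel_right₀ _ hRx]
        refine ((((dP.mul dθ.cos).add (dV.mul dθ.sin)).pow 2).div
          ((dV.pow 2).add (dP.pow 2)) hRx).congr_deriv ?_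
        rw [e2]
        simp only [Pi.add_apply, Pi.mul_apply, Pi.pow_apply]
        field_simp
        norm_num
        ring
    have e0 : P 0 * Real.cos (θ 0) + V 0 * Real.sin (θ 0) = 0 := by
      rw [show θ 0 = 0 from pruferAngle_zero p M]; simp [hP, h.G_zero]
    simp only [e0] at e
    rw [eq_div_iff (by linarith : s - 0 ≠ 0), zero_pow two_ne_zero, zero_div, sub_zero, zero_mul, sub_zero]
      at e
    have e3 : (P s * Real.cos (θ s) + V s * Real.sin (θ s)) ^ 2 / (V s ^ 2 + P s ^ 2) = 0 :=
      e.symm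
    rcases div_eq_zero_iff.1 e3 with h3 | h3
    · exact pow_eq_zero_iff two_ne_zero |>.1 h3
    · exact absurd h3 (hR s hs)
  constructor
  · intro hV
    have hs0 : s ≠ 0 := by rintro rfl; rw [h.V_zero] at hV; norm_num at hV
    rw [hV, zero_mul, add_zero] at key
    refine (mul_eq_zero.1 key).resolve_left (mul_ne_zero ?_ (h.G_ne_zero hp hM1 hs hV))
    exact (Real.rpow_pos_of_pos (lt_of_le_of_ne hs hs0.symm) _).ne'
  · intro hc
    rw [hc, mul_zero, zero_add] at key
    refine (mul_eq_zero.1 key).resolve_right fun hsin => ?_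
    have := Real.sin_sq_add_cos_sq (θ s)
    rw [hc, hsin] at this
    norm_num at this

/-! ### Oscillation below the critical dimension -/

/-- A positive solution on a half-line decays like `s^(-2/(p-1))`, too fast for the Pohozaev
function to stay bounded away from zero below the critical dimension. -/
lemma not_eventually_pos {p M s₀ c : ℝ} (hp : 1 < p) (hM : 2 ≤ M)
    (hMp : M * (p - 1) < 2 * (p + 1)) (hs₀ : 0 < s₀) (hc : 0 < c) {W D : ℝ → ℝ}
    (hW : ∀ s, s₀ < s → 0 < W s) (dW : ∀ s, s₀ < s → HasDerivAt W (D s) s)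
    (dP : ∀ s, s₀ < s → HasDerivAt (fun s => s ^ (M - 1) * D s) (-(s ^ (M - 1) * W s ^ p)) s)
    (hPoh : ∀ s, s₀ < s →
      c ≤ s ^ M * (D s ^ 2 / 2 + powPrim p (W s)) + (M - 2) / 2 * (s ^ (M - 1) * D s * W s)) :
    False := by
  have hMpos : 0 < M := by linarith
  have hpow : ∀ s q : ℝ, s₀ < s → 0 < s ^ q := fun s q hs =>
    Real.rpow_pos_of_pos (hs₀.trans hs) _
  have hPanti : AntitoneOn (fun s => s ^ (M - 1) * D s) (Ioi s₀) := by
    refine antitoneOn_of_deriv_nonpos (convex_Ioi _)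
      (fun s hs => (dP s hs).continuousAt.continuousWithinAt) ?_ ?_
    all_goals
      rw [interior_Ioi]; intro s hs
    · exact (dP s hs).differentiableAt.differentiableWithinAt
    · rw [(dP s hs).deriv]
      have := hpow s (M - 1) hs
      have := Real.rpow_nonneg (hW s hs).le p
      nlinarith [mul_nonneg (hpow s (M - 1) hs).le this]
  -- the solution eventually decreases
  obtain ⟨s₁, hs₁, hP₁⟩ : ∃ s₁, s₀ < s₁ ∧ s₁ ^ (M - 1) * D s₁ < 0 := by
    by_contra! hcon
    have hDn : ∀ s, s₀ < s → 0 ≤ D s := fun s hs =>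
      nonneg_of_mul_nonneg_right (hcon s hs) (hpow s _ hs)
    set a := s₀ + 1
    have ha : s₀ < a := by simp [a]
    have hWm : MonotoneOn W (Ioi s₀) := by
      refine monotoneOn_of_deriv_nonneg (convex_Ioi _)
        (fun s hs => (dW s hs).continuousAt.continuousWithinAt) ?_ ?_
      all_goals
        rw [interior_Ioi]; intro s hs
      · exact (dW s hs).differentiableAt.differentiableWithinAt
      · rw [(dW s hs).deriv]; exact hDn s hs
    set κ := a ^ (M - 1) * W a ^ p
    have hκ : 0 < κ := mul_pos (hpow a _ ha) (Real.rpow_pos_of_pos (hW a ha) _)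
    set b := a + (a ^ (M - 1) * D a + 1) / κ
    have hab : a < b := by
      have : 0 < (a ^ (M - 1) * D a + 1) / κ := div_pos (by linarith [hcon a ha]) hκ
      simp only [b]; linarith
    obtain ⟨x, hx, e⟩ := exists_hasDerivAt_eq_slope (fun s => s ^ (M - 1) * D s)
      (fun s => -(s ^ (M - 1) * W s ^ p)) hab
      (fun s hs => (dP s (ha.trans_le hs.1)).continuousAt.continuousWithinAt)
      fun s hs => dP s (ha.trans hs.1)
    rw [eq_div_iff (by linarith)] at e
    have hx1 : κ ≤ x ^ (M - 1) * W x ^ p := by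
      have h1 : a ^ (M - 1) ≤ x ^ (M - 1) :=
        Real.rpow_le_rpow (by linarith) hx.1.le (by linarith)
      have h2 : W a ^ p ≤ W x ^ p := Real.rpow_le_rpow (hW a ha).le
        (hWm ha (ha.trans hx.1) hx.1.le) (by linarith)
      exact mul_le_mul h1 h2 (Real.rpow_nonneg (hW a ha).le _) (hpow x _ (ha.trans hx.1)).le
    have hb : κ * (b - a) = a ^ (M - 1) * D a + 1 := by simp only [b]; field_simp; ring
    have := hcon b (ha.trans hab)
    have := mul_le_mul_of_nonneg_right hx1 (sub_nonneg.2 hab.le)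
    linarith
  have h01 : 0 < s₁ := hs₀.trans hs₁
  have hDneg : ∀ s, s₁ ≤ s → D s < 0 := fun s hs => by
    have h1 := hPanti hs₁ (hs₁.trans_le hs) hs
    simp only at h1
    by_contra hn
    have := mul_nonneg (hpow s (M - 1) (hs₁.trans_le hs)).le (not_lt.1 hn)
    linarith
  have hWanti : AntitoneOn W (Ici s₁) := by
    refine antitoneOn_of_deriv_nonpos (convex_Ici _)
      (fun s hs => (dW s (hs₁.trans_le hs)).continuousAt.continuousWithinAt) ?_ ?_
    all_goals
      rw [interior_Ici]; intro s hs
    · exact (dW s (hs₁.trans hs)).differentiableAt.differentiableWithinAt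
    · rw [(dW s (hs₁.trans hs)).deriv]; exact (hDneg s (le_of_lt hs)).le
  have hD2 : ∀ s, 2 * s₁ ≤ s → W s ^ p * s / (2 * M) ≤ -D s := fun s hs => by
    have hs1 : s₁ ≤ s := by linarith
    have hs0 : 0 < s := by linarith
    have hWp := Real.rpow_pos_of_pos (hW s (hs₁.trans_le hs1)) p
    have hanti : AntitoneOn (fun t => t ^ (M - 1) * D t + W s ^ p * (t ^ M / M)) (Icc s₁ s) := by
      have hd : ∀ t, s₁ ≤ t → HasDerivAt
          (fun t => t ^ (M - 1) * D t + W s ^ p * (t ^ M / M))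
          (-(t ^ (M - 1) * W t ^ p) + W s ^ p * t ^ (M - 1)) t := fun t ht =>
        ((dP t (hs₁.trans_le ht)).add
          (((Real.hasDerivAt_rpow_const (p := M)
            (Or.inl (by linarith : 0 < t).ne')).div_const M).const_mul (W s ^ p))).congr_deriv
          (by field_simp)
      refine antitoneOn_of_deriv_nonpos (convex_Icc _ _)
        (fun t ht => (hd t ht.1).continuousAt.continuousWithinAt) ?_ ?_
      all_goals
        rw [interior_Icc]; intro t ht
      · exact (hd t ht.1.le).differentiableAt.differentiableWithinAt
      · rw [(hd t ht.1.le).deriv]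
        have h1 : W s ^ p ≤ W t ^ p := Real.rpow_le_rpow (hW s (hs₁.trans_le hs1)).le
          (hWanti ht.1.le hs1 ht.2.le) (by linarith)
        have h2 := hpow t (M - 1) (hs₁.trans ht.1)
        nlinarith
    have h1 := hanti (left_mem_Icc.2 hs1) (right_mem_Icc.2 hs1) hs1
    simp only at h1
    have h2 : s₁ ^ M ≤ s ^ M / 2 := by
      have : (2 * s₁) ^ M ≤ s ^ M := Real.rpow_le_rpow (by linarith) hs (by linarith)
      rw [Real.mul_rpow (by norm_num) h01.le] at this
      have h3 : (2 : ℝ) ≤ 2 ^ M := by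
        nth_rw 1 [← Real.rpow_one 2]
        exact Real.rpow_le_rpow_of_exponent_le (by norm_num) (by linarith)
      nlinarith [Real.rpow_pos_of_pos h01 M]
    have h3 : s ^ M = s ^ (M - 1) * s := by
      rw [← Real.rpow_add_one hs0.ne']; congr 1; ring
    have h4 := hpow s (M - 1) (hs₁.trans_le hs1)
    have h5 : s ^ (M - 1) * (W s ^ p * s / (2 * M)) ≤ s ^ (M - 1) * (-D s) := by
      have h6 : W s ^ p * (s₁ ^ M / M) ≤ W s ^ p * (s ^ M / 2 / M) := by gcongr
      have h7 : s ^ (M - 1) * (W s ^ p * s / (2 * M)) = W s ^ p * (s ^ M / 2 / M) := by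
        rw [h3]; field_simp
      have h8 : W s ^ p * (s ^ M / M) = 2 * (W s ^ p * (s ^ M / 2 / M)) := by ring
      rw [h7]
      linarith
    exact le_of_mul_le_mul_left h5 h4
  set c₁ := (p - 1) * 3 / (16 * M) with hc₁
  have hc₁pos : 0 < c₁ := by
    have : 0 < p - 1 := by linarith
    positivity
  have hdecay : ∀ s, 4 * s₁ ≤ s → c₁ * s ^ 2 ≤ W s ^ (1 - p) := fun s hs => by
    have hd : ∀ t, 2 * s₁ ≤ t → HasDerivAt (fun t => W t ^ (1 - p) - (p - 1) / (4 * M) * t ^ 2)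
        (D t * (1 - p) * W t ^ (1 - p - 1) - (p - 1) / (4 * M) * (2 * t)) t := fun t ht =>
      (((dW t (by linarith)).rpow_const (Or.inl (hW t (by linarith)).ne')).sub
        (((hasDerivAt_id' t).pow 2).const_mul ((p - 1) / (4 * M)))).congr_deriv (by norm_num)
    have hmono : MonotoneOn (fun t => W t ^ (1 - p) - (p - 1) / (4 * M) * t ^ 2)
        (Ici (2 * s₁)) := by
      refine monotoneOn_of_deriv_nonneg (convex_Ici _)
        (fun t ht => (hd t ht).continuousAt.continuousWithinAt) ?_ ?_
      all_goals
        rw [interior_Ici]; intro t ht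
        have ht : 2 * s₁ < t := ht
      · exact (hd t ht.le).differentiableAt.differentiableWithinAt
      · rw [(hd t ht.le).deriv]
        have hWt := hW t (by linarith)
        have h1 := hD2 t ht.le
        have h2 : W t ^ p * W t ^ (1 - p - 1) = 1 := by
          rw [← Real.rpow_add hWt]; simp
        have h3 := Real.rpow_pos_of_pos hWt (1 - p - 1)
        have h4 := mul_le_mul_of_nonneg_right h1 h3.le
        have h5 : W t ^ p * t / (2 * M) * W t ^ (1 - p - 1) = t / (2 * M) := by
          rw [div_mul_eq_mul_div, mul_right_comm, h2, one_mul]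
        rw [h5] at h4
        have h6 : (p - 1) / (4 * M) * (2 * t) = (p - 1) * (t / (2 * M)) := by field_simp; ring
        rw [h6]
        nlinarith
    have h1 := hmono (mem_Ici.2 le_rfl) (mem_Ici.2 (by linarith : 2 * s₁ ≤ s))
      (by linarith : 2 * s₁ ≤ s)
    simp only at h1
    have h2 : 0 ≤ W (2 * s₁) ^ (1 - p) := Real.rpow_nonneg (hW _ (by linarith)).le _
    have h3 : c₁ * s ^ 2 = (p - 1) / (4 * M) * (3 / 4 * s ^ 2) := by rw [hc₁]; field_simp; ring
    have h4 : 0 < (p - 1) / (4 * M) := div_pos (by linarith) (by linarith)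
    have h5 : (p - 1) / (4 * M) * (3 / 4 * s ^ 2) ≤
        (p - 1) / (4 * M) * (s ^ 2 - (2 * s₁) ^ 2) := by
      refine mul_le_mul_of_nonneg_left ?_ h4.le
      nlinarith
    linarith
  set C := 2 ^ M * (1 / 2 + 1 / (c₁ * (p + 1))) * c₁ ^ (-(2 / (p - 1))) with hC
  have hbound : ∀ s, 4 * s₁ ≤ s → c ≤ C * s ^ (-(2 + 4 / (p - 1) - M)) := fun s hs => by
    have hs0 : 0 < s := by linarith
    have hp1 : 0 < p - 1 := by linarith
    have hWs := hW s (by linarith)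
    obtain ⟨ξ, hξ, e⟩ := exists_hasDerivAt_eq_slope W D (by linarith : s < 2 * s)
      (fun t ht => (dW t (by linarith [ht.1])).continuousAt.continuousWithinAt)
      fun t ht => dW t (by linarith [ht.1])
    have hξ1 := hPoh ξ (by linarith [hξ.1])
    have hDξ := hDneg ξ (by linarith [hξ.1])
    have hWξ := hW ξ (by linarith [hξ.1])
    have hWξs : W ξ ≤ W s := hWanti (mem_Ici.2 (by linarith)) (mem_Ici.2 (by linarith [hξ.1]))
      hξ.1.le
    have t1 : (M - 2) / 2 * (ξ ^ (M - 1) * D ξ * W ξ) ≤ 0 := by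
      have := hpow ξ (M - 1) (by linarith [hξ.1])
      have : ξ ^ (M - 1) * D ξ * W ξ ≤ 0 :=
        mul_nonpos_of_nonpos_of_nonneg (mul_nonpos_of_nonneg_of_nonpos this.le hDξ.le) hWξ.le
      exact mul_nonpos_of_nonneg_of_nonpos (by linarith) this
    have t2 : D ξ ^ 2 ≤ W s ^ 2 / s ^ 2 := by
      have h1 : W (2 * s) - W s = D ξ * s := by rw [e]; field_simp; ring
      have h2 := hW (2 * s) (by linarith)
      rw [le_div_iff₀ (by positivity), ← mul_pow]
      have h3 : D ξ * s < 0 := mul_neg_of_neg_of_pos hDξ hs0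
      nlinarith
    have hdec := hdecay s hs
    have t3 : powPrim p (W ξ) ≤ W s ^ 2 / s ^ 2 * (1 / (c₁ * (p + 1))) := by
      have h1 : W ξ ^ (p + 1) ≤ W s ^ (p + 1) := Real.rpow_le_rpow hWξ.le hWξs (by linarith)
      have h2 : W s ^ (p + 1) * W s ^ (1 - p) = W s ^ 2 := by
        rw [← Real.rpow_add hWs, ← Real.rpow_two]; congr 1; ring
      have h3 : W s ^ (p + 1) * (c₁ * s ^ 2) ≤ W s ^ 2 := by
        rw [← h2]; exact mul_le_mul_of_nonneg_left hdec (Real.rpow_nonneg hWs.le _)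
      rw [powPrim, abs_of_pos hWξ, div_mul_div_comm, mul_one, div_le_div_iff₀ (by linarith)
        (by positivity)]
      have h4 : W ξ ^ (p + 1) * (c₁ * s ^ 2) ≤ W s ^ 2 :=
        (mul_le_mul_of_nonneg_right h1 (by positivity)).trans h3
      nlinarith
    have t4 : W s ^ 2 ≤ c₁ ^ (-(2 / (p - 1))) * s ^ (-(4 / (p - 1))) := by
      have h1 := Real.rpow_le_rpow_of_nonpos (by positivity : 0 < c₁ * s ^ 2) hdec
        (by have : 0 < 2 / (p - 1) := by positivity
            linarith : -(2 / (p - 1)) ≤ 0)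
      rw [← Real.rpow_mul hWs.le, Real.mul_rpow hc₁pos.le (by positivity), ← Real.rpow_two s,
        ← Real.rpow_mul hs0.le] at h1
      convert h1 using 2
      · rw [← Real.rpow_two]; congr 1; field_simp; ring
      · congr 1; ring
    have t5 : ξ ^ M ≤ 2 ^ M * s ^ M := by
      rw [← Real.mul_rpow (by norm_num) hs0.le]
      exact Real.rpow_le_rpow (by linarith [hξ.1]) hξ.2.le hMpos.le
    have hξM := hpow ξ M (by linarith [hξ.1])
    calc c ≤ ξ ^ M * (D ξ ^ 2 / 2 + powPrim p (W ξ)) := by linarith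
      _ ≤ (2 ^ M * s ^ M) * (W s ^ 2 / s ^ 2 * (1 / 2 + 1 / (c₁ * (p + 1)))) := by
          refine mul_le_mul t5 ?_ ?_ (by positivity)
          · rw [mul_add]; linarith
          · have := powPrim_nonneg hp (W ξ)
            positivity
      _ ≤ (2 ^ M * s ^ M) * ((c₁ ^ (-(2 / (p - 1))) * s ^ (-(4 / (p - 1)))) / s ^ 2 *
            (1 / 2 + 1 / (c₁ * (p + 1)))) := by
          have : 0 < p + 1 := by linarith
          gcongr
      _ = C * (s ^ M * s ^ (-(4 / (p - 1))) / s ^ 2) := by rw [hC]; ring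
      _ = _ := by
          rw [← Real.rpow_add hs0, ← Real.rpow_two, ← Real.rpow_sub hs0]
          congr 2; ring
  have hη : 0 < 2 + 4 / (p - 1) - M := by
    have hp1 : 0 < p - 1 := by linarith
    have : M < 2 + 4 / (p - 1) := by
      rw [← sub_lt_iff_lt_add', lt_div_iff₀ hp1]; linarith
    linarith
  have hlim := (tendsto_rpow_neg_atTop hη).const_mul C
  rw [mul_zero] at hlim
  obtain ⟨s, h1, h2⟩ := ((hlim.eventually_lt_const hc).and (eventually_ge_atTop (4 * s₁))).exists
  exact absurd (hbound s h2) (not_le.2 h1)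

/-- The Pohozaev function is increasing below the critical dimension, hence bounded below by a
positive constant away from the origin. -/
lemma IsEmden.exists_pohozaev_ge {p M : ℝ} {V G : ℝ → ℝ} (h : IsEmden (signedPow p) M V G)
    (hp : 1 < p) (hM : 2 ≤ M) (hMp : M * (p - 1) < 2 * (p + 1)) :
    ∃ c > 0, ∀ s, 1 ≤ s →
      c ≤ s ^ M * (G s ^ 2 / 2 + powPrim p (V s)) + (M - 2) / 2 * (s ^ (M - 1) * G s * V s) := by
  have hM1 : 1 ≤ M := by linarith
  set Q : ℝ → ℝ := fun s =>
    s ^ M * (G s ^ 2 / 2 + powPrim p (V s)) + (M - 2) / 2 * (s ^ (M - 1) * G s * V s) with hQ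
  have hQc : ContinuousOn Q (Ici 0) :=
    ((continuousOn_id.rpow_const fun _ _ => Or.inr (by linarith)).mul
      (((h.contG.pow 2).div_const 2).add
        ((continuous_powPrim hp).comp_continuousOn h.contV))).add
      (((h.continuousOn_momentum hM1).mul h.contV).const_mul ((M - 2) / 2))
  have hd : ∀ s, 0 < s → HasDerivAt Q
      (s ^ (M - 1) * ((2 * (p + 1) - M * (p - 1)) / 2 * powPrim p (V s))) s := by
    intro s hs
    refine (((Real.hasDerivAt_rpow_const (p := M) (Or.inl hs.ne')).mul
      ((((h.derivG s hs).pow 2).div_const 2).add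
        ((hasDerivAt_powPrim hp (V s)).comp s (h.derivV s hs)))).add
      (((h.hasDerivAt_momentum hs).mul (h.derivV s hs)).const_mul
        ((M - 2) / 2))).congr_deriv ?_
    have e1 := signedPow_mul_self_eq hp (V s)
    have e2 : s ^ M = s ^ (M - 1) * s := by
      rw [← Real.rpow_add_one hs.ne']; congr 1; ring
    simp only [Pi.add_apply, Function.comp_apply, Pi.pow_apply, e2]
    field_simp
    norm_num
    linear_combination (-(M - 2)) * e1
  have hcoef : 0 < 2 * (p + 1) - M * (p - 1) := by linarith
  have hmono : MonotoneOn Q (Ici 0) := by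
    refine monotoneOn_of_deriv_nonneg (convex_Ici 0) hQc ?_ ?_
    all_goals
      rw [interior_Ici]; intro s hs
      have hs : 0 < s := hs
    · exact (hd s hs).differentiableAt.differentiableWithinAt
    · rw [(hd s hs).deriv]
      have := powPrim_nonneg hp (V s)
      positivity
  have hstrict : StrictMonoOn Q (Icc 0 1) := by
    refine strictMonoOn_of_deriv_pos (convex_Icc 0 1) (hQc.mono Icc_subset_Ici_self) ?_
    rw [interior_Icc]; intro s hs
    rw [(hd s hs.1).deriv]
    have : 0 < powPrim p (V s) := powPrim_pos hp
      (by linarith [h.half_le_V hp hM1 ⟨hs.1.le, hs.2.le⟩] : (0 : ℝ) < V s).ne'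
    have := Real.rpow_pos_of_pos hs.1 (M - 1)
    positivity
  refine ⟨Q 1, ?_, fun s hs => hmono (mem_Ici.2 zero_le_one) (mem_Ici.2 (by linarith)) hs⟩
  have h0 : Q 0 = 0 := by
    simp only [hQ, h.G_zero]
    rw [Real.zero_rpow (by linarith)]
    ring
  rw [← h0]
  exact hstrict (by simp) (by simp) one_pos

/-- Below the critical dimension the solution has arbitrarily large zeros. -/
lemma IsEmden.exists_zero_gt {p M : ℝ} {V G : ℝ → ℝ} (h : IsEmden (signedPow p) M V G)
    (hp : 1 < p) (hM : 2 ≤ M) (hMp : M * (p - 1) < 2 * (p + 1)) (B : ℝ) :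
    ∃ s, B < s ∧ 0 < s ∧ V s = 0 := by
  by_contra! hcon
  obtain ⟨c, hc, hpoh⟩ := h.exists_pohozaev_ge hp hM hMp
  set s₀ := max B 1
  have hs₀ : 1 ≤ s₀ := le_max_right _ _
  have hne : ∀ s ∈ Ioi s₀, V s ≠ 0 := fun s hs =>
    hcon s ((le_max_left _ _).trans_lt hs) (by linarith [mem_Ioi.1 hs])
  have hcont : ContinuousOn V (Ioi s₀) := h.contV.mono fun s hs =>
    mem_Ici.2 (by linarith [mem_Ioi.1 hs])
  have hsign : (∀ s ∈ Ioi s₀, 0 < V s) ∨ ∀ s ∈ Ioi s₀, V s < 0 := by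
    by_contra! hcon2
    obtain ⟨⟨a, ha, hVa⟩, b, hb, hVb⟩ := hcon2
    obtain ⟨x, hx, hVx⟩ := isPreconnected_Ioi.intermediate_value ha hb hcont ⟨hVa, hVb⟩
    exact hne x hx hVx
  rcases hsign with hpos | hneg
  · refine not_eventually_pos hp hM hMp (by linarith : 0 < s₀) hc (W := V) (D := G) hpos
      (fun s hs => h.derivV s (by linarith)) (fun s hs => ?_) fun s hs => hpoh s (by linarith)
    have := h.hasDerivAt_momentum (s := s) (by linarith)
    rwa [signedPow_of_pos (hpos s hs)] at this
  · refine not_eventually_pos hp hM hMp (by linarith : 0 < s₀) hc (W := fun s => -V s)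
      (D := fun s => -G s) (fun s hs => neg_pos.2 (hneg s hs))
      (fun s hs => (h.derivV s (by linarith)).neg) (fun s hs => ?_) fun s hs => ?_
    · have h1 := (h.hasDerivAt_momentum (s := s) (by linarith)).neg
      rw [← mul_neg, ← signedPow_neg, signedPow_of_pos (neg_pos.2 (hneg s hs))] at h1
      simpa [Pi.neg_def] using h1
    · have := hpoh s (by linarith)
      simpa [powPrim] using this

lemma exists_pruferAngle_gt {p M : ℝ} (hp : 1 < p) (hM : 2 ≤ M)
    (hMp : M * (p - 1) < 2 * (p + 1)) (n : ℕ) :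
    ∃ s, 0 < s ∧ Real.cos (pruferAngle p M s) = 0 ∧ n * Real.pi < pruferAngle p M s := by
  have h := isEmden_emdenV hp (by linarith : 1 ≤ M)
  have hmono := strictMonoOn_pruferAngle hp hM
  induction n with
  | zero =>
    obtain ⟨s, -, hs, hV⟩ := h.exists_zero_gt hp hM hMp 0
    refine ⟨s, hs, (emdenV_eq_zero_iff hp hM hs.le).1 hV, ?_⟩
    have := hmono self_mem_Ici (mem_Ici.2 hs.le) hs
    rw [pruferAngle_zero] at this
    simpa using this
  | succ n ih =>
    obtain ⟨s, hs, hcos, hgt⟩ := ih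
    obtain ⟨t, hst, ht, hV⟩ := h.exists_zero_gt hp hM hMp s
    have hcos' := (emdenV_eq_zero_iff hp hM ht.le).1 hV
    refine ⟨t, ht, hcos', ?_⟩
    have hlt := hmono (mem_Ici.2 hs.le) (mem_Ici.2 ht.le) hst
    obtain ⟨i, hi⟩ := Real.cos_eq_zero_iff.1 hcos
    obtain ⟨j, hj⟩ := Real.cos_eq_zero_iff.1 hcos'
    have hpi := Real.pi_pos
    have hij : i + 1 ≤ j := by
      by_contra hcon
      have h1 : (j : ℝ) ≤ i := by exact_mod_cast (by omega : j ≤ i)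
      rw [hi, hj] at hlt
      nlinarith
    have hij' : (i : ℝ) + 1 ≤ j := by exact_mod_cast hij
    rw [hj]
    rw [hi] at hgt
    push_cast
    nlinarith

/-- The target angle `(m - 1/2) π` of the `m`-th zero. -/
noncomputable def zeroAngle (m : ℕ) : ℝ := (m - 1 / 2) * Real.pi

lemma zeroAngle_pos {m : ℕ} (hm : 1 ≤ m) : 0 < zeroAngle m := by
  have : (1 : ℝ) ≤ m := by exact_mod_cast hm
  exact mul_pos (by linarith) Real.pi_pos

lemma cos_zeroAngle (m : ℕ) : Real.cos (zeroAngle m) = 0 := by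
  rw [Real.cos_eq_zero_iff]
  exact ⟨(m : ℤ) - 1, by rw [zeroAngle]; push_cast; ring⟩

lemma exists_pruferAngle_eq {p M : ℝ} (hp : 1 < p) (hM : 2 ≤ M)
    (hMp : M * (p - 1) < 2 * (p + 1)) {m : ℕ} (hm : 1 ≤ m) :
    ∃ s, 0 < s ∧ pruferAngle p M s = zeroAngle m := by
  obtain ⟨t, ht, -, hgt⟩ := exists_pruferAngle_gt hp hM hMp m
  have hc : ContinuousOn (pruferAngle p M) (Icc 0 t) :=
    ((continuous_pruferAngle hp).comp (by fun_prop : Continuous fun s : ℝ => (M, s))).continuousOn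
  have h0 := zeroAngle_pos hm
  obtain ⟨s, hs, e⟩ := intermediate_value_Icc ht.le hc (show zeroAngle m ∈ Icc _ _ from
    ⟨by rw [pruferAngle_zero]; exact h0.le, by
      refine le_trans ?_ hgt.le
      rw [zeroAngle]; nlinarith [Real.pi_pos]⟩)
  refine ⟨s, lt_of_le_of_ne hs.1 ?_, e⟩
  rintro rfl
  rw [pruferAngle_zero] at e
  exact h0.ne e

/-- The `m`-th positive zero of the solution in dimension `M` (and `1` if there is none). -/
noncomputable def emdenZero (p : ℝ) (m : ℕ) (M : ℝ) : ℝ :=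
  open Classical in
  if h : ∃ s, 0 < s ∧ pruferAngle p M s = zeroAngle m then h.choose else 1

lemma emdenZero_pos (p : ℝ) (m : ℕ) (M : ℝ) : 0 < emdenZero p m M := by
  rw [emdenZero]
  split_ifs with h
  · exact h.choose_spec.1
  · exact one_pos

lemma pruferAngle_emdenZero {p M : ℝ} (hp : 1 < p) (hM : 2 ≤ M)
    (hMp : M * (p - 1) < 2 * (p + 1)) {m : ℕ} (hm : 1 ≤ m) :
    pruferAngle p M (emdenZero p m M) = zeroAngle m := by
  have h := exists_pruferAngle_eq hp hM hMp hm
  rw [emdenZero, dif_pos h]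
  exact h.choose_spec.2

lemma emdenV_emdenZero {p M : ℝ} (hp : 1 < p) (hM : 2 ≤ M)
    (hMp : M * (p - 1) < 2 * (p + 1)) {m : ℕ} (hm : 1 ≤ m) :
    emdenV p M (emdenZero p m M) = 0 := by
  rw [emdenV_eq_zero_iff hp hM (emdenZero_pos p m M).le, pruferAngle_emdenZero hp hM hMp hm,
    cos_zeroAngle]

lemma one_le_emdenZero {p M : ℝ} (hp : 1 < p) (hM : 2 ≤ M)
    (hMp : M * (p - 1) < 2 * (p + 1)) {m : ℕ} (hm : 1 ≤ m) : 1 ≤ emdenZero p m M := by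
  by_contra hlt
  have := (isEmden_emdenV hp (by linarith : 1 ≤ M)).half_le_V hp (by linarith)
    ⟨(emdenZero_pos p m M).le, (not_le.1 hlt).le⟩
  rw [emdenV_emdenZero hp hM hMp hm] at this
  norm_num at this

lemma continuousOn_emdenZero {p : ℝ} (hp : 1 < p) {m : ℕ} (hm : 1 ≤ m) :
    ContinuousOn (emdenZero p m) {M | 2 ≤ M ∧ M * (p - 1) < 2 * (p + 1)} := by
  intro M hM
  set z := emdenZero p m M with hz
  have hz0 : 0 < z := emdenZero_pos p m M
  have hmono := strictMonoOn_pruferAngle hp hM.1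
  have hcont : ∀ s, Continuous fun M => pruferAngle p M s := fun s =>
    (continuous_pruferAngle hp).comp (by fun_prop : Continuous fun M : ℝ => (M, s))
  refine Metric.continuousWithinAt_iff'.2 fun ε hε => ?_
  set δ := min ε z with hδ
  have hδ0 : 0 < δ := lt_min hε hz0
  have hδz : δ ≤ z := min_le_right _ _
  have h1 : pruferAngle p M (z - δ) < zeroAngle m := by
    rw [← pruferAngle_emdenZero hp hM.1 hM.2 hm]
    exact hmono (mem_Ici.2 (by linarith)) (mem_Ici.2 hz0.le) (by linarith)
  have h2 : zeroAngle m < pruferAngle p M (z + δ) := by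
    rw [← pruferAngle_emdenZero hp hM.1 hM.2 hm]
    exact hmono (mem_Ici.2 hz0.le) (mem_Ici.2 (by linarith)) (by linarith)
  filter_upwards [mem_nhdsWithin_of_mem_nhds ((hcont _).continuousAt.eventually_lt_const h1),
    mem_nhdsWithin_of_mem_nhds ((hcont _).continuousAt.eventually_const_lt h2),
    self_mem_nhdsWithin] with M' h1' h2' hM'
  rw [← pruferAngle_emdenZero hp hM'.1 hM'.2 hm] at h1' h2'
  have hmono' := strictMonoOn_pruferAngle hp hM'.1
  have hz' : 0 ≤ emdenZero p m M' := (emdenZero_pos p m M').le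
  have a1 := (hmono'.lt_iff_lt (mem_Ici.2 (by linarith : 0 ≤ z - δ)) (mem_Ici.2 hz')).1 h1'
  have a2 := (hmono'.lt_iff_lt (mem_Ici.2 hz') (mem_Ici.2 (by linarith : 0 ≤ z + δ))).1 h2'
  rw [Real.dist_eq, abs_lt]
  have : δ ≤ ε := min_le_left _ _
  constructor <;> linarith

/-- The `m`-th zero is Lipschitz in the dimension, because it is a transversal zero. -/
lemma emdenZero_isBigO {p M : ℝ} (hp : 1 < p) (hM : 2 < M)
    (hMp : M * (p - 1) < 2 * (p + 1)) {m : ℕ} (hm : 1 ≤ m) :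
    (fun M' => emdenZero p m M' - emdenZero p m M) =O[𝓝 M] fun M' => M' - M := by
  have hM1 : 1 ≤ M := by linarith
  have h := isEmden_emdenV hp hM1
  set z := emdenZero p m M with hz
  have hz0 : 0 < z := emdenZero_pos p m M
  have hVz := emdenV_emdenZero hp hM.le hMp hm
  have hG := h.G_ne_zero hp hM1 hz0.le hVz
  have hnear : ∀ᶠ M' in 𝓝 M, 2 ≤ M' ∧ M' * (p - 1) < 2 * (p + 1) :=
    ((lt_mem_nhds hM).mono fun _ h => le_of_lt h).and
      ((by fun_prop : Continuous fun M' : ℝ => M' * (p - 1)).continuousAt.eventually_lt_const hMp)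
  have hcont : Tendsto (emdenZero p m) (𝓝 M) (𝓝 z) :=
    (continuousOn_emdenZero hp hm).continuousAt hnear
  have h1 : (fun M' => emdenZero p m M' - z) =O[𝓝 M] fun M' =>
      emdenV p M (emdenZero p m M') := by
    have := ((h.derivV z hz0).isTheta_sub hG).2.comp_tendsto
      (hcont.prodMk (tendsto_const_pure (b := z)))
    simpa [Function.comp_def, hVz, hz] using this
  refine h1.trans (Asymptotics.IsBigO.of_bound (Real.exp ((p + 3) * (z + 1))) ?_)
  filter_upwards [hnear, hcont.eventually_lt_const (lt_add_one z)] with M' hM' hlt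
  have hz' := emdenZero_pos p m M'
  have hsub := (h.sub_le (isEmden_emdenV hp (by linarith [hM'.1] : 1 ≤ M')) hp hM1
    (by linarith [hM'.1]) hz'.le).1
  rw [emdenV_emdenZero hp hM'.1 hM'.2 hm, zero_sub, abs_neg] at hsub
  rw [Real.norm_eq_abs, Real.norm_eq_abs, mul_comm]
  refine hsub.trans ?_
  gcongr

/-! ### Calculus of radial functions -/

section Radial

variable {E : Type*} [NormedAddCommGroup E] [InnerProductSpace ℝ E]

variable (E) in
/-- The real inner product as a bilinear (rather than sesquilinear) bounded map. -/
noncomputable def realInner : E →L[ℝ] E →L[ℝ] ℝ := innerSL ℝ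

lemma realInner_apply (x y : E) : realInner E x y = inner ℝ x y := rfl

lemma norm_realInner_apply (x : E) : ‖realInner E x‖ = ‖x‖ := innerSL_apply_norm ℝ x

lemma norm_realInner_le : ‖realInner E‖ ≤ 1 :=
  ContinuousLinearMap.opNorm_le_bound _ zero_le_one fun x => by
    rw [norm_realInner_apply, one_mul]

lemma hasFDerivAt_comp_norm {U : ℝ → ℝ} {a : ℝ} {x : E} (hx : x ≠ 0)
    (hU : HasDerivAt U a ‖x‖) :
    HasFDerivAt (fun y : E => U ‖y‖) ((a / ‖x‖) • realInner E x) x := by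
  have hn : ‖x‖ ≠ 0 := norm_ne_zero_iff.2 hx
  have h1 : HasFDerivAt (fun y : E => ‖y‖) ((1 / ‖x‖) • realInner E x) x := by
    have := (hasStrictFDerivAt_norm_sq x).hasFDerivAt.sqrt (by positivity)
    simp only [Real.sqrt_sq (norm_nonneg _)] at this
    refine this.congr_fderiv ?_
    ext v
    simp [realInner_apply]
    field_simp
  refine (hU.comp_hasFDerivAt x h1).congr_fderiv ?_
  ext v
  simp
  ring

lemma hasFDerivAt_smul_realInner {g : ℝ → ℝ} {b : ℝ} {x : E} (hx : x ≠ 0)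
    (hg : HasDerivAt g b ‖x‖) :
    HasFDerivAt (fun y : E => g ‖y‖ • realInner E y)
      (g ‖x‖ • (realInner E) +
        ((b / ‖x‖) • realInner E x).smulRight (realInner E x)) x := by
  exact (hasFDerivAt_comp_norm hx hg).smul (realInner E).hasFDerivAt

lemma fderiv_comp_norm_eventuallyEq {u : E → ℝ} {U U1 : ℝ → ℝ} {x : E} (hx : x ≠ 0)
    (hu : u =ᶠ[𝓝 x] fun y => U ‖y‖) (hU : ∀ᶠ r in 𝓝 ‖x‖, HasDerivAt U (U1 r) r) :
    fderiv ℝ u =ᶠ[𝓝 x] fun y => (U1 ‖y‖ / ‖y‖) • realInner E y := by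
  filter_upwards [hu.eventually_nhds, continuous_norm.continuousAt.eventually hU,
    isOpen_ne.mem_nhds hx] with y h1 h2 h3
  exact ((hasFDerivAt_comp_norm h3 h2).congr_of_eventuallyEq h1).fderiv

lemma hasFDerivAt_fderiv_comp_norm {u : E → ℝ} {U U1 : ℝ → ℝ} {a : ℝ} {x : E} (hx : x ≠ 0)
    (hu : u =ᶠ[𝓝 x] fun y => U ‖y‖) (hU : ∀ᶠ r in 𝓝 ‖x‖, HasDerivAt U (U1 r) r)
    (hU1 : HasDerivAt U1 a ‖x‖) :
    HasFDerivAt (fderiv ℝ u)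
      ((U1 ‖x‖ / ‖x‖) • (realInner E) +
        (((a - U1 ‖x‖ / ‖x‖) / ‖x‖ ^ 2) • realInner E x).smulRight (realInner E x)) x := by
  have hn : ‖x‖ ≠ 0 := norm_ne_zero_iff.2 hx
  refine (HasFDerivAt.congr_of_eventuallyEq (hasFDerivAt_smul_realInner hx
    (hU1.div (hasDerivAt_id' _) hn)) (fderiv_comp_norm_eventuallyEq hx hu hU)).congr_fderiv ?_
  congr 3
  field_simp

/-- The Laplacian of a radial function: `Δu = U'' + (N-1)/r U'`. -/
lemma laplacian_comp_norm [FiniteDimensional ℝ E] {u : E → ℝ} {U U1 : ℝ → ℝ} {a : ℝ} {x : E}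
    (hx : x ≠ 0) (hu : u =ᶠ[𝓝 x] fun y => U ‖y‖) (hU : ∀ᶠ r in 𝓝 ‖x‖, HasDerivAt U (U1 r) r)
    (hU1 : HasDerivAt U1 a ‖x‖) :
    Laplacian.laplacian u x = a + ((Module.finrank ℝ E : ℝ) - 1) / ‖x‖ * U1 ‖x‖ := by
  have hn : ‖x‖ ≠ 0 := norm_ne_zero_iff.2 hx
  have hsum := (stdOrthonormalBasis ℝ E).sum_sq_inner_left x
  have h1 : ∀ i, ‖stdOrthonormalBasis ℝ E i‖ = 1 := (stdOrthonormalBasis ℝ E).orthonormal.1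
  rw [InnerProductSpace.laplacian_eq_iteratedFDeriv_stdOrthonormalBasis]
  simp only [iteratedFDeriv_two_apply, (hasFDerivAt_fderiv_comp_norm hx hu hU hU1).fderiv]
  simp only [Matrix.cons_val_zero, Matrix.cons_val_one, add_apply,
    smul_apply, ContinuousLinearMap.smulRight_apply, realInner_apply,
    smul_eq_mul, real_inner_self_eq_norm_sq, h1, Finset.sum_add_distrib, mul_assoc,
    ← Finset.mul_sum, ← sq, hsum]
  simp
  field_simp
  ring

/-- A radial profile whose first two derivatives vanish suitably at `0` defines a `C²` function. -/
lemma contDiff_comp_norm {U U1 U2 : ℝ → ℝ} (hc : ContinuousWithinAt U (Ici 0) 0)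
    (hU : ∀ r, 0 < r → HasDerivAt U (U1 r) r) (hU1 : ∀ r, 0 < r → HasDerivAt U1 (U2 r) r)
    (hU2 : ContinuousOn U2 (Ioi 0)) (h1 : Tendsto (fun r => U1 r / r) (𝓝[>] 0) (𝓝 0))
    (h2 : Tendsto U2 (𝓝[>] 0) (𝓝 0)) :
    ContDiff ℝ 2 (fun y : E => U ‖y‖) ∧ fderiv ℝ (fderiv ℝ fun y : E => U ‖y‖) 0 = 0 := by
  set u : E → ℝ := fun y => U ‖y‖ with hu
  have hnpos : ∀ {y : E}, y ≠ 0 → 0 < ‖y‖ := fun h => norm_pos_iff.2 h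
  have hevU : ∀ {y : E}, y ≠ 0 → ∀ᶠ r in 𝓝 ‖y‖, HasDerivAt U (U1 r) r := fun h =>
    (lt_mem_nhds (hnpos h)).mono hU
  have hnorm : Tendsto (fun y : E => ‖y‖) (𝓝[≠] 0) (𝓝[>] 0) := tendsto_norm_nhdsNE_zero
  -- the differential at the origin
  have hd0 : HasFDerivAt u (0 : E →L[ℝ] ℝ) 0 := by
    have hder : HasDerivWithinAt U 0 (Ici 0) 0 := by
      refine hasDerivWithinAt_Ici_of_tendsto_deriv (s := Ioi 0)
        (fun r hr => (hU r hr).differentiableAt.differentiableWithinAt)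
        (hc.mono Ioi_subset_Ici_self) self_mem_nhdsWithin ?_
      have h3 : Tendsto (fun r => U1 r / r * r) (𝓝[>] 0) (𝓝 (0 * 0)) :=
        h1.mul (tendsto_id.mono_left nhdsWithin_le_nhds)
      rw [zero_mul] at h3
      refine h3.congr' ?_
      filter_upwards [self_mem_nhdsWithin] with r hr
      have hr : 0 < r := hr
      rw [(hU r hr).deriv, div_mul_cancel₀ _ hr.ne']
    rw [hasDerivWithinAt_iff_isLittleO] at hder
    have ht : Tendsto (fun y : E => ‖y‖) (𝓝 0) (𝓝[≥] 0) := by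
      refine tendsto_nhdsWithin_iff.2 ⟨?_, Eventually.of_forall fun y => norm_nonneg y⟩
      simpa using (continuous_norm (E := E)).tendsto 0
    refine .of_isLittleO ?_
    have h4 : (fun y : E => U ‖y‖ - U 0) =o[𝓝 0] fun y : E => ‖y‖ := by
      simpa [Function.comp_def] using hder.comp_tendsto ht
    simpa [hu] using h4.of_norm_right
  have hdiff : ∀ y, y ≠ 0 → HasFDerivAt u ((U1 ‖y‖ / ‖y‖) • realInner E y) y := fun y hy =>
    hasFDerivAt_comp_norm hy (hU _ (hnpos hy))
  -- the second differential
  have hdd : ∀ y, y ≠ 0 → HasFDerivAt (fderiv ℝ u)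
      ((U1 ‖y‖ / ‖y‖) • (realInner E) +
        (((U2 ‖y‖ - U1 ‖y‖ / ‖y‖) / ‖y‖ ^ 2) • realInner E y).smulRight (realInner E y)) y :=
    fun y hy => hasFDerivAt_fderiv_comp_norm hy EventuallyEq.rfl (hevU hy) (hU1 _ (hnpos hy))
  have hdd0 : HasFDerivAt (fderiv ℝ u) (0 : E →L[ℝ] E →L[ℝ] ℝ) 0 := by
    refine .of_isLittleO ?_
    simp only [hd0.fderiv, sub_zero, zero_apply]
    refine Asymptotics.isLittleO_iff.2 fun c hc0 => ?_
    have h3 : ∀ᶠ y : E in 𝓝[≠] 0, ‖U1 ‖y‖ / ‖y‖‖ < c := by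
      have := (h1.comp hnorm).norm
      rw [norm_zero] at this
      exact this.eventually_lt_const hc0
    rw [eventually_nhdsWithin_iff] at h3
    filter_upwards [h3] with y hy
    rcases eq_or_ne y 0 with rfl | hy0
    · simp [hd0.fderiv]
    · rw [(hdiff y hy0).fderiv, norm_smul, norm_realInner_apply]
      exact mul_le_mul_of_nonneg_right (hy hy0).le (norm_nonneg _)
  refine ⟨?_, hdd0.fderiv⟩
  have hdiff1 : Differentiable ℝ u := fun y => by
    rcases eq_or_ne y 0 with rfl | hy
    · exact hd0.differentiableAt
    · exact (hdiff y hy).differentiableAt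
  have hdiff2 : Differentiable ℝ (fderiv ℝ u) := fun y => by
    rcases eq_or_ne y 0 with rfl | hy
    · exact hdd0.differentiableAt
    · exact (hdd y hy).differentiableAt
  rw [show (2 : WithTop ℕ∞) = 1 + 1 by norm_num, contDiff_succ_iff_fderiv]
  refine ⟨hdiff1, by simp, contDiff_one_iff_fderiv.2 ⟨hdiff2, continuous_iff_continuousAt.2 fun y => ?_⟩⟩
  rcases eq_or_ne y 0 with rfl | hy
  · rw [continuousAt_iff_punctured_nhds, hdd0.fderiv]
    have h3 : Tendsto (fun y : E => ‖U1 ‖y‖ / ‖y‖‖ + ‖U2 ‖y‖ - U1 ‖y‖ / ‖y‖‖) (𝓝[≠] 0) (𝓝 0) := by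
      have := (h1.comp hnorm).norm.add ((h2.comp hnorm).sub (h1.comp hnorm)).norm
      simpa using this
    refine squeeze_zero_norm' ?_ h3
    filter_upwards [self_mem_nhdsWithin] with y hy
    have hy : y ≠ 0 := hy
    have hn := hnpos hy
    rw [(hdd y hy).fderiv]
    refine (norm_add_le _ _).trans (add_le_add ?_ ?_)
    · rw [norm_smul]
      refine mul_le_of_le_one_right (norm_nonneg _) ?_
      exact norm_realInner_le
    · rw [ContinuousLinearMap.norm_smulRight_apply, norm_smul, norm_realInner_apply, norm_div,
        norm_pow, norm_norm]
      refine le_of_eq ?_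
      field_simp
  · have hev : fderiv ℝ (fderiv ℝ u) =ᶠ[𝓝 y] fun y =>
        ((U1 ‖y‖ / ‖y‖) • (realInner E) +
        (((U2 ‖y‖ - U1 ‖y‖ / ‖y‖) / ‖y‖ ^ 2) • realInner E y).smulRight (realInner E y)) := by
      filter_upwards [isOpen_ne.mem_nhds hy] with x hx using (hdd x hx).fderiv
    refine ContinuousAt.congr ?_ hev.symm
    have c1 : ContinuousAt (fun y : E => U1 ‖y‖) y :=
      ContinuousAt.comp (g := U1) (hU1 _ (hnpos hy)).continuousAt continuous_norm.continuousAt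
    have c2 : ContinuousAt (fun y : E => U2 ‖y‖) y :=
      ContinuousAt.comp (g := U2) (hU2.continuousAt (Ioi_mem_nhds (hnpos hy)))
        continuous_norm.continuousAt
    have c3 : ContinuousAt (fun y : E => U1 ‖y‖ / ‖y‖) y :=
      c1.div continuous_norm.continuousAt (hnpos hy).ne'
    have c4 : ContinuousAt (fun y : E => realInner E y) y := (realInner E).continuous.continuousAt
    have c5 : ContinuousAt (fun y : E => (U2 ‖y‖ - U1 ‖y‖ / ‖y‖) / ‖y‖ ^ 2) y :=
      (c2.sub c3).div (continuous_norm.pow 2).continuousAt (pow_ne_zero 2 (hnpos hy).ne')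
    have c6 : Continuous fun q : (E →L[ℝ] ℝ) × (E →L[ℝ] ℝ) => q.1.smulRight q.2 :=
      isBoundedBilinearMap_smulRight.continuous
    exact (c3.smul continuousAt_const).add
      (ContinuousAt.comp (g := fun q : (E →L[ℝ] ℝ) × (E →L[ℝ] ℝ) => q.1.smulRight q.2)
        c6.continuousAt ((c5.smul c4).prodMk c4))

end Radial

/-! ### Counting nodal sets -/

lemma nat_card_connectedComponents_eq {X : Type*} [TopologicalSpace X] {m : ℕ} (j : X → Fin m)
    (hc : Continuous j) (hs : Function.Surjective j) (hf : ∀ i, IsPreconnected (j ⁻¹' {i})) :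
    Nat.card (ConnectedComponents X) = m := by
  have hbij : Function.Bijective hc.connectedComponentsLift := by
    constructor
    · intro a b hab
      obtain ⟨x, rfl⟩ := ConnectedComponents.surjective_coe a
      obtain ⟨y, rfl⟩ := ConnectedComponents.surjective_coe b
      rw [hc.connectedComponentsLift_apply_coe, hc.connectedComponentsLift_apply_coe] at hab
      rw [ConnectedComponents.coe_eq_coe']
      exact (hf (j y)).subset_connectedComponent rfl hab
    · intro i
      obtain ⟨x, rfl⟩ := hs i
      exact ⟨x, hc.connectedComponentsLift_apply_coe x⟩
  rw [Nat.card_eq_of_bijective _ hbij, Nat.card_fin]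

lemma isPreconnected_norm_preimage {E : Type*} [NormedAddCommGroup E] [NormedSpace ℝ E]
    (h : 1 < Module.rank ℝ E) {J : Set ℝ} (hJ : J.OrdConnected) (hJ0 : J ⊆ Ici 0) :
    IsPreconnected {x : E | ‖x‖ ∈ J} := by
  have himg : {x : E | ‖x‖ ∈ J} =
      (fun q : ℝ × E => q.1 • q.2) '' (J ×ˢ Metric.sphere (0 : E) 1) := by
    ext x
    constructor
    · intro hx
      rcases eq_or_ne x 0 with rfl | hx0
      · obtain ⟨e, he⟩ := (isConnected_sphere h (0 : E) zero_le_one).nonempty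
        exact ⟨(0, e), ⟨by simpa using hx, he⟩, by simp⟩
      · exact ⟨(‖x‖, ‖x‖⁻¹ • x), ⟨hx, by simp [norm_smul, hx0]⟩, by simp [smul_smul, hx0]⟩
    · rintro ⟨⟨r, e⟩, ⟨hr, he⟩, rfl⟩
      have he : ‖e‖ = 1 := by simpa using he
      have hr0 : 0 ≤ r := hJ0 hr
      simpa [norm_smul, he, abs_of_nonneg hr0] using hr
  rw [himg]
  exact (hJ.isPreconnected.prod (isPreconnected_sphere h 0 1)).image _
    (continuous_fst.smul continuous_snd).continuousOn

/-- If the zeros of a radial function in the unit ball are where an increasing angle `ψ(|x|)`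
crosses the odd multiples of `π/2`, then the nodal sets are counted by the final angle. -/
lemma nodalCount_eq {N m : ℕ} (hN : 2 ≤ N) {u : EuclideanSpace ℝ (Fin N) → ℝ}
    {ψ : ℝ → ℝ} (hψc : Continuous ψ) (hψ : StrictMonoOn ψ (Icc 0 1)) (hψ0 : ψ 0 = 0)
    (hψ1 : ψ 1 = zeroAngle m)
    (hu : ∀ x ∈ Metric.ball (0 : EuclideanSpace ℝ (Fin N)) 1,
      u x = 0 ↔ Real.cos (ψ ‖x‖) = 0) :
    nodalCount N u = m := by
  have hpi := Real.pi_pos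
  have hrank : 1 < Module.rank ℝ (EuclideanSpace ℝ (Fin N)) := by
    rw [← Module.finrank_eq_rank, finrank_euclideanSpace_fin]
    exact_mod_cast hN
  set X := {x : EuclideanSpace ℝ (Fin N) //
    x ∈ Metric.ball (0 : EuclideanSpace ℝ (Fin N)) 1 ∧ u x ≠ 0} with hX
  let φ : ℝ → ℝ := fun r => ψ r / Real.pi + 1 / 2
  have hφc : Continuous φ := by fun_prop
  have hφ : StrictMonoOn φ (Icc 0 1) := fun a ha b hb hab => by
    have := div_lt_div_of_pos_right (hψ ha hb hab) hpi
    simp only [φ]; linarith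
  have hφ0 : φ 0 = 1 / 2 := by simp [φ, hψ0]
  have hφ1 : φ 1 = m := by
    simp only [φ, hψ1, zeroAngle]; field_simp; ring
  have hnorm : ∀ x : X, 0 ≤ ‖x.1‖ ∧ ‖x.1‖ < 1 := fun x =>
    ⟨norm_nonneg _, by simpa using x.2.1⟩
  have hIcc : ∀ x : X, ‖x.1‖ ∈ Icc (0 : ℝ) 1 := fun x => ⟨(hnorm x).1, (hnorm x).2.le⟩
  have hge : ∀ x : X, 0 < φ ‖x.1‖ := fun x => by
    have := hφ.monotoneOn (left_mem_Icc.2 zero_le_one) (hIcc x) (hnorm x).1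
    linarith
  have hlt : ∀ x : X, φ ‖x.1‖ < m := fun x => by
    rw [← hφ1]; exact hφ (hIcc x) (right_mem_Icc.2 zero_le_one) (hnorm x).2
  have hnot : ∀ (x : X) (n : ℕ), φ ‖x.1‖ ≠ n := fun x n hn => by
    refine x.2.2 ((hu x.1 x.2.1).2 (Real.cos_eq_zero_iff.2 ⟨(n : ℤ) - 1, ?_⟩))
    have h1 : ψ ‖x.1‖ = (φ ‖x.1‖ - 1 / 2) * Real.pi := by simp only [φ]; field_simp; ring
    rw [h1, hn]; push_cast; ring
  let j : X → Fin m := fun x => ⟨⌊φ ‖x.1‖⌋₊, (Nat.floor_lt (hge x).le).2 (hlt x)⟩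
  have hj : ∀ (x : X) (i : Fin m), j x = i ↔ φ ‖x.1‖ ∈ Ioo (i : ℝ) (i + 1) := fun x i => by
    rw [Fin.ext_iff]
    simp only [j]
    rw [Nat.floor_eq_iff (hge x).le]
    exact ⟨fun h => ⟨lt_of_le_of_ne h.1 (hnot x i).symm, h.2⟩, fun h => ⟨h.1.le, h.2⟩⟩
  refine nat_card_connectedComponents_eq j ?_ ?_ ?_
  · refine continuous_discrete_rng.2 fun i => ?_
    have : j ⁻¹' {i} = (fun x : X => φ ‖x.1‖) ⁻¹' Ioo (i : ℝ) (i + 1) := by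
      ext x; exact hj x i
    rw [this]
    exact isOpen_Ioo.preimage (hφc.comp continuous_subtype_val.norm)
  · intro i
    have hi : (i : ℝ) + 1 ≤ m := by exact_mod_cast i.2
    have hi0 : (0 : ℝ) ≤ i := by positivity
    obtain ⟨r, hr, hri⟩ := intermediate_value_Icc zero_le_one hφc.continuousOn
      (show (i : ℝ) + 1 / 2 ∈ Icc (φ 0) (φ 1) from ⟨by rw [hφ0]; linarith, by rw [hφ1]; linarith⟩)
    have hr1 : r < 1 := lt_of_le_of_ne hr.2 (by rintro rfl; rw [hφ1] at hri; linarith)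
    obtain ⟨e, he⟩ := (isConnected_sphere hrank (0 : EuclideanSpace ℝ (Fin N))
      zero_le_one).nonempty
    have he : ‖e‖ = 1 := by simpa using he
    have hre : ‖r • e‖ = r := by rw [norm_smul, he, mul_one, Real.norm_of_nonneg hr.1]
    have hball : r • e ∈ Metric.ball (0 : EuclideanSpace ℝ (Fin N)) 1 := by
      rw [mem_ball_zero_iff, hre]; exact hr1
    have hψr : ψ r = i * Real.pi := by
      have : ψ r = (φ r - 1 / 2) * Real.pi := by simp only [φ]; field_simp; ring
      rw [this, hri]; ring
    refine ⟨⟨r • e, hball, fun h0 => ?_⟩, (hj _ i).2 ?_⟩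
    · rw [hu _ hball, hre, hψr] at h0
      have h1 := Real.sin_nat_mul_pi i
      have h2 := Real.sin_sq_add_cos_sq ((i : ℕ) * Real.pi)
      rw [h1, h0] at h2
      norm_num at h2
    · simp only [hre, hri]
      constructor <;> linarith
  · intro i
    refine (Topology.IsInducing.isPreconnected_image (f := (Subtype.val : X → _)) ⟨rfl⟩).1 ?_
    set J : Set ℝ := {r | 0 ≤ r ∧ r < 1 ∧ φ r ∈ Ioo (i : ℝ) (i + 1)} with hJ
    have himg : Subtype.val '' (j ⁻¹' {i}) = {x : EuclideanSpace ℝ (Fin N) | ‖x‖ ∈ J} := by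
      ext x
      constructor
      · rintro ⟨x, hx, rfl⟩
        exact ⟨(hnorm x).1, (hnorm x).2, (hj x i).1 hx⟩
      · rintro ⟨-, h1, h2⟩
        have hball : x ∈ Metric.ball (0 : EuclideanSpace ℝ (Fin N)) 1 := by simpa using h1
        refine ⟨⟨x, hball, fun h0 => ?_⟩, (hj _ i).2 h2, rfl⟩
        rw [hu x hball, Real.cos_eq_zero_iff] at h0
        obtain ⟨k, hk⟩ := h0
        have hφk : φ ‖x‖ = ((k + 1 : ℤ) : ℝ) := by
          simp only [φ, hk]; push_cast; field_simp; ring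
        rw [hφk] at h2
        have h3 : ((i : ℕ) : ℤ) < k + 1 := by exact_mod_cast h2.1
        have h4 : k + 1 < ((i : ℕ) : ℤ) + 1 := by exact_mod_cast h2.2
        omega
    rw [himg]
    refine isPreconnected_norm_preimage hrank ⟨?_⟩ fun r hr => hr.1
    rintro a ⟨ha0, ha1, ha⟩ b ⟨hb0, hb1, hb⟩ r ⟨har, hrb⟩
    have hr0 : 0 ≤ r := ha0.trans har
    have hr1 : r < 1 := hrb.trans_lt hb1
    exact ⟨hr0, hr1, ha.1.trans_le (hφ.monotoneOn ⟨ha0, ha1.le⟩ ⟨hr0, hr1.le⟩ har),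
      (hφ.monotoneOn ⟨hr0, hr1.le⟩ ⟨hb0, hb1.le⟩ hrb).trans_lt hb.2⟩

/-! ### The radial solutions of the Hénon problem -/

/-- The exponent `k` of the substitution `s = r^k` that removes the weight `|x|^α`. -/
noncomputable def henonExp (α : ℝ) : ℝ := (2 + α) / 2

/-- The dimension `M = 2 + (N-2)/k` in which the Hénon equation becomes the equation without
weight. -/
noncomputable def henonDim (N : ℕ) (α : ℝ) : ℝ := 2 + ((N : ℝ) - 2) / henonExp α

lemma henonExp_gt_one {α : ℝ} (hα : 0 < α) : 1 < henonExp α := by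
  rw [henonExp]; linarith

lemma henonDim_mul_henonExp {N : ℕ} {α : ℝ} (hα : 0 < α) :
    henonDim N α * henonExp α = N + α := by
  have := henonExp_gt_one hα
  rw [henonDim, add_mul, div_mul_cancel₀ _ (by linarith), henonExp]
  ring

lemma two_lt_henonDim {N : ℕ} (hN : 3 ≤ N) {α : ℝ} (hα : 0 < α) : 2 < henonDim N α := by
  have hN' : (3 : ℝ) ≤ N := by exact_mod_cast hN
  have : 0 < ((N : ℝ) - 2) / henonExp α :=
    div_pos (by linarith) (by linarith [henonExp_gt_one hα])
  rw [henonDim]; linarith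

lemma pos_of_henonThreshold_lt {N : ℕ} {p α : ℝ} (h : henonThreshold N p < α) : 0 < α :=
  (le_max_left _ _).trans_lt h

/-- The condition `α > α_p` says that `p` is subcritical in dimension `M`. -/
lemma henonDim_subcritical {N : ℕ} {p α : ℝ} (h : henonThreshold N p < α) :
    henonDim N α * (p - 1) < 2 * (p + 1) := by
  have hα := pos_of_henonThreshold_lt h
  have hk : 0 < henonExp α := by linarith [henonExp_gt_one hα]
  have h1 : (p * ((N : ℝ) - 2) - ((N : ℝ) + 2)) / 2 < α := (le_max_right _ _).trans_lt h
  refine lt_of_mul_lt_mul_right ?_ hk.le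
  rw [mul_right_comm, henonDim_mul_henonExp hα, henonExp]
  linarith

/-- The radial solution of the Hénon equation obtained by rescaling the solution of the initial
value problem in dimension `M`; `z > 0` is a free scaling parameter. -/
noncomputable def henonProfile (N : ℕ) (p α z r : ℝ) : ℝ :=
  (henonExp α * z) ^ (2 / (p - 1)) * emdenV p (henonDim N α) (z * r ^ henonExp α)

/-- The derivative of `henonProfile`. -/
noncomputable def henonProfileDeriv (N : ℕ) (p α z r : ℝ) : ℝ :=
  (henonExp α * z) ^ (2 / (p - 1)) * (henonExp α * z * r ^ (henonExp α - 1) *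
    emdenG p (henonDim N α) (z * r ^ henonExp α))

/-- The second derivative of `henonProfile`. -/
noncomputable def henonProfileDeriv2 (N : ℕ) (p α z r : ℝ) : ℝ :=
  -(((N : ℝ) - 1) / r) * henonProfileDeriv N p α z r - r ^ α * signedPow p (henonProfile N p α z r)

section Profile

variable {N : ℕ} {p α z : ℝ}

lemma isEmden_henonDim (hN : 3 ≤ N) (hp : 1 < p) (hα : 0 < α) :
    IsEmden (signedPow p) (henonDim N α) (emdenV p (henonDim N α)) (emdenG p (henonDim N α)) :=
  isEmden_emdenV hp (by linarith [two_lt_henonDim hN hα])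

lemma hasDerivAt_henonProfile (hN : 3 ≤ N) (hp : 1 < p) (hα : 0 < α) (hz : 0 < z) {r : ℝ}
    (hr : 0 < r) : HasDerivAt (henonProfile N p α z) (henonProfileDeriv N p α z r) r := by
  have h := isEmden_henonDim hN hp hα
  have h1 := (h.derivV _ (mul_pos hz (Real.rpow_pos_of_pos hr (henonExp α)))).comp r
    ((Real.hasDerivAt_rpow_const (p := henonExp α) (Or.inl hr.ne')).const_mul z)
  exact (h1.const_mul ((henonExp α * z) ^ (2 / (p - 1)))).congr_deriv (by
    rw [henonProfileDeriv]; ring)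

lemma hasDerivAt_henonProfileDeriv (hN : 3 ≤ N) (hp : 1 < p) (hα : 0 < α) (hz : 0 < z) {r : ℝ}
    (hr : 0 < r) :
    HasDerivAt (henonProfileDeriv N p α z) (henonProfileDeriv2 N p α z r) r := by
  have h := isEmden_henonDim hN hp hα
  set k := henonExp α with hk
  have hk1 : 1 < k := henonExp_gt_one hα
  set M := henonDim N α with hM
  set s := z * r ^ k with hs
  have hrk : 0 < r ^ k := Real.rpow_pos_of_pos hr k
  have hs0 : 0 < s := mul_pos hz hrk
  have hkz : 0 < k * z := by positivity
  set c := (k * z) ^ (2 / (p - 1)) with hc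
  have hc0 : 0 < c := Real.rpow_pos_of_pos hkz _
  -- the amplitude is chosen so that `c^(p-1) = (k z)^2`
  have hcp : c ^ p = c * (k * z) ^ 2 := by
    rw [show p = 1 + (p - 1) by ring, Real.rpow_add hc0, Real.rpow_one, hc, ← Real.rpow_mul hkz.le,
      div_mul_cancel₀ _ (by linarith), Real.rpow_two]
  have h1 := (h.derivG s hs0).comp r
    ((Real.hasDerivAt_rpow_const (p := k) (Or.inl hr.ne')).const_mul z)
  have h2 := ((((Real.hasDerivAt_rpow_const (p := k - 1) (Or.inl hr.ne')).const_mul (k * z)).mul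
    h1)).const_mul c
  refine h2.congr_deriv ?_
  have hα2 : α = 2 * k - 2 := by rw [hk, henonExp]; ring
  have e1 : r ^ (k - 1) = r ^ k / r := Real.rpow_sub_one hr.ne' k
  have e2 : r ^ (k - 1 - 1) = r ^ k / r / r := by rw [Real.rpow_sub_one hr.ne', e1]
  have e3 : r ^ α = r ^ k * r ^ k / r ^ 2 := by
    rw [hα2, Real.rpow_sub hr, Real.rpow_two, two_mul, Real.rpow_add hr]
  have hN2 : (N : ℝ) - 2 = (M - 2) * k := by
    have := henonDim_mul_henonExp (N := N) hα
    rw [← hM, ← hk] at this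
    linarith
  rw [henonProfileDeriv2, henonProfileDeriv, henonProfile, ← hk, ← hM, ← hs, ← hc,
    signedPow_smul hc0, hcp, e3, e1, show (N : ℝ) - 1 = (M - 2) * k + 1 by linarith]
  simp only [Function.comp_apply, ← hs, e2]
  rw [show (M - 1) / s = (M - 1) / (z * r ^ k) by rw [hs]]
  field_simp
  ring

lemma henonProfile_zero (hN : 3 ≤ N) (hp : 1 < p) (hα : 0 < α) :
    henonProfile N p α z 0 = (henonExp α * z) ^ (2 / (p - 1)) := by
  rw [henonProfile, Real.zero_rpow (by linarith [henonExp_gt_one hα]), mul_zero,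
    (isEmden_henonDim hN hp hα).V_zero, mul_one]

lemma continuousOn_henonProfile (hN : 3 ≤ N) (hp : 1 < p) (hα : 0 < α) (hz : 0 < z) :
    ContinuousOn (henonProfile N p α z) (Ici 0) := by
  have hc : Continuous fun r : ℝ => z * r ^ henonExp α :=
    continuous_const.mul (continuous_id.rpow_const fun _ =>
      Or.inr (by linarith [henonExp_gt_one hα]))
  exact continuousOn_const.mul ((isEmden_henonDim hN hp hα).contV.comp hc.continuousOn
    fun r hr => mem_Ici.2 (mul_nonneg hz.le (Real.rpow_nonneg hr _)))

lemma continuousOn_henonProfileDeriv (hN : 3 ≤ N) (hp : 1 < p) (hα : 0 < α) (hz : 0 < z) :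
    ContinuousOn (henonProfileDeriv N p α z) (Ici 0) := by
  have hk := henonExp_gt_one hα
  have hc : Continuous fun r : ℝ => z * r ^ henonExp α :=
    continuous_const.mul (continuous_id.rpow_const fun _ => Or.inr (by linarith))
  have hc' : Continuous fun r : ℝ => henonExp α * z * r ^ (henonExp α - 1) :=
    continuous_const.mul (continuous_id.rpow_const fun _ => Or.inr (by linarith))
  exact continuousOn_const.mul (hc'.continuousOn.mul
    ((isEmden_henonDim hN hp hα).contG.comp hc.continuousOn
      fun r hr => mem_Ici.2 (mul_nonneg hz.le (Real.rpow_nonneg hr _))))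

lemma henonProfileDeriv_zero (hα : 0 < α) : henonProfileDeriv N p α z 0 = 0 := by
  rw [henonProfileDeriv, Real.zero_rpow (by linarith [henonExp_gt_one hα] : henonExp α - 1 ≠ 0)]
  ring

lemma abs_henonProfile_le (hN : 3 ≤ N) (hp : 1 < p) (hα : 0 < α) (hz : 0 < z) {r : ℝ}
    (hr : 0 ≤ r) : |henonProfile N p α z r| ≤ (henonExp α * z) ^ (2 / (p - 1)) := by
  have hkz : 0 < henonExp α * z := mul_pos (by linarith [henonExp_gt_one hα]) hz
  rw [henonProfile, abs_mul, abs_of_pos (Real.rpow_pos_of_pos hkz _)]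
  exact mul_le_of_le_one_right (Real.rpow_pos_of_pos hkz _).le
    ((isEmden_henonDim hN hp hα).abs_V_le hp (by linarith [two_lt_henonDim hN hα])
      (mul_nonneg hz.le (Real.rpow_nonneg hr _)))

lemma tendsto_henonProfileDeriv_div (hN : 3 ≤ N) (hp : 1 < p) (hα : 0 < α) (hz : 0 < z) :
    Tendsto (fun r => henonProfileDeriv N p α z r / r) (𝓝[>] 0) (𝓝 0) := by
  set k := henonExp α with hk
  have hk1 : 1 < k := henonExp_gt_one hα
  set c := (k * z) ^ (2 / (p - 1)) with hc
  have hc0 : 0 < c := Real.rpow_pos_of_pos (by positivity) _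
  have hlim : Tendsto (fun r : ℝ => c * (k * z * z) * r ^ α) (𝓝[>] 0) (𝓝 0) := by
    have h1 : Continuous fun r : ℝ => c * (k * z * z) * r ^ α :=
      continuous_const.mul (continuous_id.rpow_const fun _ => Or.inr hα.le)
    have := h1.tendsto 0
    simp only [Real.zero_rpow hα.ne', mul_zero] at this
    exact this.mono_left nhdsWithin_le_nhds
  refine squeeze_zero_norm' ?_ hlim
  filter_upwards [self_mem_nhdsWithin] with r hr
  have hr : 0 < r := hr
  have hrk := Real.rpow_pos_of_pos hr k
  have hrk' := Real.rpow_pos_of_pos hr (k - 1)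
  have hg := (isEmden_henonDim hN hp hα).abs_G_le hp (by linarith [two_lt_henonDim hN hα])
    (mul_pos hz hrk).le
  have hα2 : α = (k - 1) + (k - 1) := by rw [hk, henonExp]; ring
  have e3 : r ^ α = r ^ (k - 1) * r ^ k / r := by
    rw [hα2, Real.rpow_add hr, Real.rpow_sub_one hr.ne', mul_div_assoc]
  rw [Real.norm_eq_abs, henonProfileDeriv, ← hk, ← hc, abs_div, abs_of_pos hr, abs_mul,
    abs_of_pos hc0, abs_mul, abs_of_pos (by positivity : 0 < k * z * r ^ (k - 1)), e3,
    ← mul_div_assoc]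
  gcongr ?_ / r
  calc c * (k * z * r ^ (k - 1) * |emdenG p (henonDim N α) (z * r ^ k)|)
      ≤ c * (k * z * r ^ (k - 1) * (z * r ^ k)) := by gcongr
    _ = _ := by ring

lemma continuousOn_henonProfileDeriv2 (hN : 3 ≤ N) (hp : 1 < p) (hα : 0 < α) (hz : 0 < z) :
    ContinuousOn (henonProfileDeriv2 N p α z) (Ioi 0) := by
  refine ContinuousOn.sub (ContinuousOn.mul ?_ ((continuousOn_henonProfileDeriv hN hp hα hz).mono
    Ioi_subset_Ici_self)) (ContinuousOn.mul ?_ ((continuous_signedPow hp).comp_continuousOn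
      ((continuousOn_henonProfile hN hp hα hz).mono Ioi_subset_Ici_self)))
  · exact (continuousOn_const.div continuousOn_id fun r hr => (mem_Ioi.1 hr).ne').neg
  · exact continuousOn_id.rpow_const fun _ _ => Or.inr hα.le

lemma tendsto_henonProfileDeriv2 (hN : 3 ≤ N) (hp : 1 < p) (hα : 0 < α) (hz : 0 < z) :
    Tendsto (henonProfileDeriv2 N p α z) (𝓝[>] 0) (𝓝 0) := by
  have h1 := (tendsto_henonProfileDeriv_div hN hp hα hz).const_mul (-((N : ℝ) - 1))
  have h2 : Tendsto (fun r : ℝ => r ^ α) (𝓝[>] 0) (𝓝 0) := by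
    have h1 : Continuous fun r : ℝ => r ^ α := continuous_id.rpow_const fun _ => Or.inr hα.le
    have := h1.tendsto 0
    simp only [Real.zero_rpow hα.ne'] at this
    exact this.mono_left nhdsWithin_le_nhds
  have h3 : Tendsto (fun r => signedPow p (henonProfile N p α z r)) (𝓝[>] 0)
      (𝓝 (signedPow p (henonProfile N p α z 0))) :=
    ((continuous_signedPow hp).tendsto _).comp
      (((continuousOn_henonProfile hN hp hα hz) 0 self_mem_Ici).mono_left
        (nhdsWithin_mono _ Ioi_subset_Ici_self))
  have h4 := h1.sub (h2.mul h3)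
  simp only [mul_zero, zero_mul, sub_zero] at h4
  refine h4.congr fun r => ?_
  rw [henonProfileDeriv2]
  ring

lemma contDiff_henonProfile (hN : 3 ≤ N) (hp : 1 < p) (hα : 0 < α) (hz : 0 < z) :
    ContDiff ℝ 2 (fun x : EuclideanSpace ℝ (Fin N) => henonProfile N p α z ‖x‖) ∧
      fderiv ℝ (fderiv ℝ fun x : EuclideanSpace ℝ (Fin N) => henonProfile N p α z ‖x‖) 0 = 0 :=
  contDiff_comp_norm (continuousOn_henonProfile hN hp hα hz 0 self_mem_Ici)
    (fun _ hr => hasDerivAt_henonProfile hN hp hα hz hr)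
    (fun _ hr => hasDerivAt_henonProfileDeriv hN hp hα hz hr)
    (continuousOn_henonProfileDeriv2 hN hp hα hz) (tendsto_henonProfileDeriv_div hN hp hα hz)
    (tendsto_henonProfileDeriv2 hN hp hα hz)

lemma henonProfile_equation (hN : 3 ≤ N) (hp : 1 < p) (hα : 0 < α) (hz : 0 < z)
    (x : EuclideanSpace ℝ (Fin N)) :
    -(Laplacian.laplacian (fun x : EuclideanSpace ℝ (Fin N) => henonProfile N p α z ‖x‖) x) =
      ‖x‖ ^ α * |henonProfile N p α z ‖x‖| ^ (p - 1) * henonProfile N p α z ‖x‖ := by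
  rcases eq_or_ne x 0 with rfl | hx
  · rw [InnerProductSpace.laplacian_eq_iteratedFDeriv_stdOrthonormalBasis]
    simp [iteratedFDeriv_two_apply, (contDiff_henonProfile hN hp hα hz).2,
      Real.zero_rpow hα.ne']
  · have hn : 0 < ‖x‖ := norm_pos_iff.2 hx
    rw [laplacian_comp_norm hx EventuallyEq.rfl
      ((lt_mem_nhds hn).mono fun r hr => hasDerivAt_henonProfile hN hp hα hz hr)
      (hasDerivAt_henonProfileDeriv hN hp hα hz hn), henonProfileDeriv2, signedPow,
      finrank_euclideanSpace_fin]
    ring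

/-- The zeros of a rescaled solution counted by the Prüfer angle. -/
lemma nodalCount_henonProfile (hN : 3 ≤ N) (hp : 1 < p) (hα : 0 < α) (hz : 0 < z) {m : ℕ}
    {u : EuclideanSpace ℝ (Fin N) → ℝ}
    (hu : ∀ x ∈ Metric.ball (0 : EuclideanSpace ℝ (Fin N)) 1, u x = henonProfile N p α z ‖x‖)
    (hm : pruferAngle p (henonDim N α) z = zeroAngle m) : nodalCount N u = m := by
  have hk := henonExp_gt_one hα
  have hM := two_lt_henonDim hN hα
  have hc : Continuous fun r : ℝ => (henonDim N α, z * r ^ henonExp α) :=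
    continuous_const.prodMk (continuous_const.mul
      (continuous_id.rpow_const fun _ => Or.inr (by linarith)))
  refine nodalCount_eq (by omega : 2 ≤ N) (ψ := fun r => pruferAngle p (henonDim N α) (z * r ^ henonExp α))
    ((continuous_pruferAngle hp).comp hc) ?_ ?_ ?_ ?_
  · intro a ha b hb hab
    exact strictMonoOn_pruferAngle hp hM.le
      (mem_Ici.2 (mul_nonneg hz.le (Real.rpow_nonneg ha.1 _)))
      (mem_Ici.2 (mul_nonneg hz.le (Real.rpow_nonneg hb.1 _)))
      (mul_lt_mul_of_pos_left (Real.rpow_lt_rpow ha.1 hab (by linarith)) hz)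
  · simp only [Real.zero_rpow (by linarith : henonExp α ≠ 0), mul_zero, pruferAngle_zero]
  · simpa using hm
  · intro x hx
    have hkz : 0 < henonExp α * z := mul_pos (by linarith) hz
    rw [hu x hx, henonProfile, mul_eq_zero, or_iff_right (Real.rpow_pos_of_pos hkz _).ne']
    exact emdenV_eq_zero_iff hp hM.le (mul_nonneg hz.le (Real.rpow_nonneg (norm_nonneg _) _))

end Profile

/-- The profile of the solution with `m` nodal sets. -/
noncomputable def nodalProfile (N : ℕ) (p : ℝ) (m : ℕ) (α r : ℝ) : ℝ :=
  henonProfile N p α (emdenZero p m (henonDim N α)) r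

lemma isRadialNodalSolution_nodalProfile {N : ℕ} (hN : 3 ≤ N) {p : ℝ} (hp : 1 < p) {m : ℕ}
    (hm : 1 ≤ m) {α : ℝ} (h : henonThreshold N p < α) :
    IsRadialNodalSolution N p α m fun x => nodalProfile N p m α ‖x‖ := by
  have hα := pos_of_henonThreshold_lt h
  have hM := two_lt_henonDim hN hα
  have hMp := henonDim_subcritical h
  have hz := emdenZero_pos p m (henonDim N α)
  refine ⟨(contDiff_henonProfile hN hp hα hz).1.contDiffOn, fun x _ y _ hxy => by simp only [hxy],
    fun x _ => henonProfile_equation hN hp hα hz x, fun x hx => ?_, ?_,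
    nodalCount_henonProfile hN hp hα hz (fun x _ => rfl) (pruferAngle_emdenZero hp hM.le hMp hm)⟩
  · have hx : ‖x‖ = 1 := by simpa using hx
    simp only [hx, nodalProfile, henonProfile, Real.one_rpow, mul_one,
      emdenV_emdenZero hp hM.le hMp hm, mul_zero]
  · simp only [norm_zero, nodalProfile, henonProfile_zero hN hp hα]
    exact Real.rpow_pos_of_pos (mul_pos (by linarith [henonExp_gt_one hα]) hz) _

/-! ### Uniqueness of the radial solution -/

/-- A solution on the closed ball is a rescaled solution of the initial value problem. -/
lemma IsRadialNodalSolution.eq_henonProfile {N : ℕ} (hN : 3 ≤ N) {p : ℝ} (hp : 1 < p) {m : ℕ}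
    {α : ℝ} (hα : 0 < α) {u : EuclideanSpace ℝ (Fin N) → ℝ} (hu : IsRadialNodalSolution N p α m u) :
    ∃ z > 0, ∀ x ∈ Metric.closedBall (0 : EuclideanSpace ℝ (Fin N)) 1,
      u x = henonProfile N p α z ‖x‖ := by
  have : NeZero N := ⟨by omega⟩
  have hk := henonExp_gt_one hα
  have hN' : (3 : ℝ) ≤ N := by exact_mod_cast hN
  set e : EuclideanSpace ℝ (Fin N) := EuclideanSpace.single 0 1 with he
  have hne : ‖e‖ = 1 := by simp [he]
  have hnorm : ∀ r : ℝ, ‖r • e‖ = |r| := fun r => by rw [norm_smul, hne, mul_one, Real.norm_eq_abs]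
  set U : ℝ → ℝ := fun r => u (r • e) with hU
  have hmaps : ∀ r ∈ Icc (-1 : ℝ) 1, r • e ∈ Metric.closedBall (0 : EuclideanSpace ℝ (Fin N)) 1 :=
    fun r hr => by rw [mem_closedBall_zero_iff, hnorm]; exact abs_le.2 hr
  have huU : ∀ x ∈ Metric.closedBall (0 : EuclideanSpace ℝ (Fin N)) 1, u x = U ‖x‖ := fun x hx => by
    refine hu.radial x hx _ (hmaps _ ?_) (by rw [hnorm, abs_norm])
    exact ⟨by linarith [norm_nonneg x], by simpa using hx⟩
  have hUc : ContDiffOn ℝ 2 U (Icc (-1) 1) :=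
    hu.contDiffOn.comp (contDiff_id.smul contDiff_const).contDiffOn hmaps
  have hUo : ContDiffOn ℝ (1 + 1) U (Ioo (-1) 1) := by
    rw [one_add_one_eq_two]; exact hUc.mono Ioo_subset_Icc_self
  rw [contDiffOn_succ_iff_deriv_of_isOpen isOpen_Ioo] at hUo
  obtain ⟨hU0, -, hU1⟩ := hUo
  have dU : ∀ r ∈ Ioo (-1 : ℝ) 1, HasDerivAt U (deriv U r) r := fun r hr =>
    (hU0.differentiableAt (isOpen_Ioo.mem_nhds hr)).hasDerivAt
  have dU1 : ∀ r ∈ Ioo (-1 : ℝ) 1, HasDerivAt (deriv U) (deriv (deriv U) r) r := fun r hr =>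
    ((hU1.differentiableOn one_ne_zero).differentiableAt (isOpen_Ioo.mem_nhds hr)).hasDerivAt
  have h0mem : (0 : ℝ) ∈ Ioo (-1 : ℝ) 1 := by norm_num
  -- the profile is even
  have hU10 : deriv U 0 = 0 := by
    have h1 : HasDerivAt (fun r => U (-r)) (-deriv U 0) 0 := by
      have h2 := dU 0 h0mem
      rw [← neg_zero] at h2
      exact (HasDerivAt.scomp (0 : ℝ) h2 (hasDerivAt_neg (0 : ℝ))).congr_deriv (by simp)
    have h3 : U =ᶠ[𝓝 0] fun r => U (-r) := by
      filter_upwards [isOpen_Ioo.mem_nhds h0mem] with r hr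
      refine hu.radial _ (hmaps _ ⟨hr.1.le, hr.2.le⟩) _ (hmaps _ ⟨?_, ?_⟩) (by simp [hnorm])
      · linarith [hr.2]
      · linarith [hr.1]
    have := (dU 0 h0mem).unique (h1.congr_of_eventuallyEq h3)
    linarith
  have hode : ∀ r ∈ Ioo (0 : ℝ) 1,
      deriv (deriv U) r = -(((N : ℝ) - 1) / r) * deriv U r - r ^ α * signedPow p (U r) := by
    intro r hr
    have hr' : ‖r • e‖ = r := by rw [hnorm, abs_of_pos hr.1]
    have hball : r • e ∈ Metric.ball (0 : EuclideanSpace ℝ (Fin N)) 1 := by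
      rw [mem_ball_zero_iff, hr']; exact hr.2
    have hne0 : r • e ≠ 0 := by rw [← norm_pos_iff, hr']; exact hr.1
    have h1 := laplacian_comp_norm (U := U) (U1 := deriv U) (a := deriv (deriv U) r) hne0
      (by filter_upwards [Metric.isOpen_ball.mem_nhds hball] with y hy using
            huU y (Metric.ball_subset_closedBall hy))
      (by rw [hr']
          filter_upwards [isOpen_Ioo.mem_nhds hr] with s hs
          exact dU s ⟨by linarith [hs.1], hs.2⟩)
      (by rw [hr']; exact dU1 r ⟨by linarith [hr.1], hr.2⟩)
    have h2 := hu.equation _ hball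
    rw [h1, hr', finrank_euclideanSpace_fin] at h2
    rw [signedPow]
    linear_combination -h2
  -- choose the scaling that matches the value at the origin
  set γ := u 0 with hγ
  have hγ0 : 0 < γ := hu.pos_zero
  set z := γ ^ ((p - 1) / 2) / henonExp α with hz
  have hz0 : 0 < z := div_pos (Real.rpow_pos_of_pos hγ0 _) (by linarith)
  have hamp : (henonExp α * z) ^ (2 / (p - 1)) = γ := by
    rw [hz, mul_div_cancel₀ _ (by linarith), ← Real.rpow_mul hγ0.le,
      show (p - 1) / 2 * (2 / (p - 1)) = 1 by
        have : p - 1 ≠ 0 := by linarith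
        field_simp, Real.rpow_one]
  set W := henonProfile N p α z with hW
  have hWc : ContinuousOn W (Ici 0) := continuousOn_henonProfile hN hp hα hz0
  have hUc' : ContinuousOn U (Icc (-1) 1) := hUc.continuousOn
  obtain ⟨B₀, hB₀⟩ := isCompact_Icc.exists_bound_of_continuousOn hUc'
  set B := max B₀ γ with hB
  set L := p * B ^ (p - 1) with hL
  have hB0 : 0 < B := hγ0.trans_le (le_max_right _ _)
  have hL0 : 0 ≤ L := mul_nonneg (by linarith) (Real.rpow_nonneg hB0.le _)
  have heq : ∀ r ∈ Ico (0 : ℝ) 1, U r = W r := by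
    intro S hS
    have key := damped_gronwall (D := fun r => U r - W r)
      (D1 := fun r => deriv U r - henonProfileDeriv N p α z r) (a := fun r => ((N : ℝ) - 1) / r)
      (e := fun r => -(r ^ α * (signedPow p (U r) - signedPow p (W r)))) (L := L) (ε := 0) (S := S)
      hL0 ?_ ?_ ?_ ?_ ?_ ?_ ?_ ?_ S (right_mem_Icc.2 hS.1)
    · have : (U S - W S) ^ 2 ≤ 0 := by
        nlinarith [sq_nonneg (deriv U S - henonProfileDeriv N p α z S)]
      have := pow_eq_zero_iff two_ne_zero |>.1 (le_antisymm this (sq_nonneg _))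
      linarith
    · refine (hUc'.mono fun x hx => ?_).sub (hWc.mono Icc_subset_Ici_self)
      exact ⟨by linarith [hx.1], by linarith [hx.2, hS.2]⟩
    · refine (hU1.continuousOn.mono fun x hx => ?_).sub
        ((continuousOn_henonProfileDeriv hN hp hα hz0).mono Icc_subset_Ici_self)
      exact ⟨by linarith [hx.1], by linarith [hx.2, hS.2]⟩
    · exact fun x hx => (dU x ⟨by linarith [hx.1], by linarith [hx.2, hS.2]⟩).sub
        (hasDerivAt_henonProfile hN hp hα hz0 hx.1)
    · intro x hx
      have hx1 : x < 1 := by linarith [hx.2, hS.2]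
      refine ((dU1 x ⟨by linarith [hx.1], hx1⟩).sub
        (hasDerivAt_henonProfileDeriv hN hp hα hz0 hx.1)).congr_deriv ?_
      rw [hode x ⟨hx.1, hx1⟩, henonProfileDeriv2]
      ring
    · exact fun x hx => div_nonneg (by linarith) hx.1.le
    · intro x hx
      have hx1 : x < 1 := by linarith [hx.2, hS.2]
      have b1 : |U x| ≤ B := (hB₀ x ⟨by linarith [hx.1], hx1.le⟩).trans (le_max_left _ _)
      have b2 : |W x| ≤ B :=
        ((abs_henonProfile_le hN hp hα hz0 hx.1.le).trans hamp.le).trans (le_max_right _ _)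
      have hxα : x ^ α ≤ 1 := Real.rpow_le_one hx.1.le hx1.le hα.le
      have hxα0 : 0 ≤ x ^ α := Real.rpow_nonneg hx.1.le _
      rw [abs_neg, abs_mul, abs_of_nonneg hxα0, add_zero]
      exact (mul_le_of_le_one_left (abs_nonneg _) hxα).trans (signedPow_lipschitz hp b1 b2)
    · simp only [hU, zero_smul, hW, henonProfile_zero hN hp hα, hamp, ← hγ, sub_self]
    · simp only [hU10, henonProfileDeriv_zero hα, sub_self]
  have heq' : ∀ r ∈ Icc (0 : ℝ) 1, U r = W r := by
    have hcl : closure (Ico (0 : ℝ) 1) = Icc 0 1 := closure_Ico zero_ne_one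
    have hEq : EqOn U W (Ico 0 1) := heq
    have := hEq.of_subset_closure (t := Icc 0 1)
      (hUc'.mono fun x hx => ⟨by linarith [hx.1], hx.2⟩) (hWc.mono Icc_subset_Ici_self)
      Ico_subset_Icc_self hcl.ge
    exact this
  exact ⟨z, hz0, fun x hx => by
    rw [huU x hx, heq' _ ⟨norm_nonneg _, by simpa using hx⟩]⟩

/-- On the closed ball there is only one radial solution with `m` nodal sets that is positive at
the origin. -/
lemma IsRadialNodalSolution.eq_nodalProfile {N : ℕ} (hN : 3 ≤ N) {p : ℝ} (hp : 1 < p) {m : ℕ}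
    {α : ℝ} (h : henonThreshold N p < α) {u : EuclideanSpace ℝ (Fin N) → ℝ}
    (hu : IsRadialNodalSolution N p α m u) :
    ∀ x ∈ Metric.closedBall (0 : EuclideanSpace ℝ (Fin N)) 1, u x = nodalProfile N p m α ‖x‖ := by
  have : NeZero N := ⟨by omega⟩
  have hα := pos_of_henonThreshold_lt h
  have hk := henonExp_gt_one hα
  have hM := two_lt_henonDim hN hα
  obtain ⟨z, hz, heq⟩ := hu.eq_henonProfile hN hp hα
  have hV : emdenV p (henonDim N α) z = 0 := by
    have he : (EuclideanSpace.single 0 1 : EuclideanSpace ℝ (Fin N)) ∈ Metric.sphere 0 1 := by simp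
    have h1 := heq _ (Metric.sphere_subset_closedBall he)
    have hne : ‖(EuclideanSpace.single 0 1 : EuclideanSpace ℝ (Fin N))‖ = 1 := by simp
    rw [hu.boundary _ he, hne, henonProfile, Real.one_rpow, mul_one] at h1
    exact (mul_eq_zero.1 h1.symm).resolve_left
      (Real.rpow_pos_of_pos (mul_pos (by linarith) hz) _).ne'
  rw [emdenV_eq_zero_iff hp hM.le hz.le, Real.cos_eq_zero_iff] at hV
  obtain ⟨l, hl⟩ := hV
  have hmono := strictMonoOn_pruferAngle hp hM.le
  have hpos := hmono self_mem_Ici (mem_Ici.2 hz.le) hz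
  rw [pruferAngle_zero, hl] at hpos
  have hl0 : 0 ≤ l := by
    by_contra hneg
    have : (l : ℝ) ≤ -1 := by exact_mod_cast (by omega : l ≤ -1)
    nlinarith [Real.pi_pos]
  obtain ⟨n, rfl⟩ := Int.eq_ofNat_of_zero_le hl0
  have hn : pruferAngle p (henonDim N α) z = zeroAngle (n + 1) := by
    rw [hl, zeroAngle]; push_cast; ring
  have hnm : n + 1 = m := by
    rw [← hu.nodal]
    exact (nodalCount_henonProfile hN hp hα hz
      (fun x hx => heq x (Metric.ball_subset_closedBall hx)) hn).symm
  rw [hnm] at hn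
  have hzz : z = emdenZero p m (henonDim N α) := by
    refine hmono.injOn (mem_Ici.2 hz.le) (mem_Ici.2 (emdenZero_pos p m _).le) ?_
    rw [hn, pruferAngle_emdenZero hp hM.le (henonDim_subcritical h) (by omega)]
  intro x hx
  rw [heq x hx, hzz, nodalProfile]

/-! ### The energy as a one-dimensional integral -/

/-- The derivative of `nodalProfile`. -/
noncomputable def nodalProfileDeriv (N : ℕ) (p : ℝ) (m : ℕ) (α r : ℝ) : ℝ :=
  henonProfileDeriv N p α (emdenZero p m (henonDim N α)) r

/-- The weight `r^(N-1) r^α` of the radial Hénon problem. -/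
noncomputable def henonWeight (N : ℕ) (α r : ℝ) : ℝ := r ^ (N - 1) * r ^ α

/-- The one-dimensional integral `∫₀¹ r^(N-1+α) |v|^(p+1)` of the solution with `m` nodal sets. -/
noncomputable def henonMass (N : ℕ) (p : ℝ) (m : ℕ) (α : ℝ) : ℝ :=
  ∫ r in (0 : ℝ)..1, henonWeight N α r * |nodalProfile N p m α r| ^ (p + 1)

lemma continuous_henonWeight (N : ℕ) {α : ℝ} (hα : 0 < α) : Continuous (henonWeight N α) :=
  (continuous_pow _).mul (continuous_id.rpow_const fun _ => Or.inr hα.le)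

lemma henonWeight_nonneg (N : ℕ) (α : ℝ) {r : ℝ} (hr : 0 ≤ r) : 0 ≤ henonWeight N α r :=
  mul_nonneg (pow_nonneg hr _) (Real.rpow_nonneg hr _)

lemma henonWeight_le_one (N : ℕ) {α r : ℝ} (hα : 0 < α) (hr : r ∈ Icc (0 : ℝ) 1) :
    henonWeight N α r ≤ 1 :=
  mul_le_one₀ (pow_le_one₀ hr.1 hr.2) (Real.rpow_nonneg hr.1 _)
    (Real.rpow_le_one hr.1 hr.2 hα.le)

lemma henonWeight_eq {N : ℕ} (hN : 3 ≤ N) {α r : ℝ} (hr : 0 < r) :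
    henonWeight N α r = r ^ ((N : ℝ) + α - 1) := by
  rw [henonWeight, ← Real.rpow_natCast, ← Real.rpow_add hr, Nat.cast_sub (by omega)]
  congr 1
  push_cast
  ring

section

variable {N : ℕ} {p α : ℝ} {m : ℕ}

lemma continuousOn_nodalProfile (hN : 3 ≤ N) (hp : 1 < p) (hα : 0 < α) :
    ContinuousOn (nodalProfile N p m α) (Ici 0) :=
  continuousOn_henonProfile hN hp hα (emdenZero_pos p m _)

lemma continuousOn_nodalProfileDeriv (hN : 3 ≤ N) (hp : 1 < p) (hα : 0 < α) :
    ContinuousOn (nodalProfileDeriv N p m α) (Ici 0) :=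
  continuousOn_henonProfileDeriv hN hp hα (emdenZero_pos p m _)

lemma hasDerivAt_nodalProfile (hN : 3 ≤ N) (hp : 1 < p) (hα : 0 < α) {r : ℝ} (hr : 0 < r) :
    HasDerivAt (nodalProfile N p m α) (nodalProfileDeriv N p m α r) r :=
  hasDerivAt_henonProfile hN hp hα (emdenZero_pos p m _) hr

/-- The equation in divergence form. -/
lemma hasDerivAt_nodalFlux (hN : 3 ≤ N) (hp : 1 < p) (hα : 0 < α) {r : ℝ} (hr : 0 < r) :
    HasDerivAt (fun r => r ^ (N - 1) * nodalProfileDeriv N p m α r)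
      (-(henonWeight N α r * signedPow p (nodalProfile N p m α r))) r := by
  refine ((hasDerivAt_pow (N - 1) r).mul (hasDerivAt_henonProfileDeriv hN hp hα
    (emdenZero_pos p m (henonDim N α)) hr)).congr_deriv ?_
  have e : r ^ (N - 1) = r ^ (N - 1 - 1) * r := by rw [← pow_succ]; congr 1; omega
  have e2 : ((N - 1 : ℕ) : ℝ) = (N : ℝ) - 1 := by
    rw [Nat.cast_sub (by omega)]; simp
  rw [henonProfileDeriv2, henonWeight, nodalProfile, e, e2]
  field_simp
  ring

lemma nodalProfile_one (hN : 3 ≤ N) (hp : 1 < p) (hm : 1 ≤ m) (h : henonThreshold N p < α) :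
    nodalProfile N p m α 1 = 0 := by
  rw [nodalProfile, henonProfile, Real.one_rpow, mul_one,
    emdenV_emdenZero hp (two_lt_henonDim hN (pos_of_henonThreshold_lt h)).le
      (henonDim_subcritical h) hm, mul_zero]

lemma nodalProfileDeriv_zero (hα : 0 < α) : nodalProfileDeriv N p m α 0 = 0 :=
  henonProfileDeriv_zero hα

/-- Green's identity: the solution for `α` tested with the solution for `β`. -/
lemma integral_deriv_mul_deriv (hN : 3 ≤ N) (hp : 1 < p) (hm : 1 ≤ m) {β : ℝ} (hα : 0 < α)
    (hβ : henonThreshold N p < β) :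
    ∫ r in (0 : ℝ)..1, r ^ (N - 1) * nodalProfileDeriv N p m α r * nodalProfileDeriv N p m β r =
      ∫ r in (0 : ℝ)..1, henonWeight N α r * signedPow p (nodalProfile N p m α r) *
        nodalProfile N p m β r := by
  have hβ0 := pos_of_henonThreshold_lt hβ
  have hIcc : Icc (0 : ℝ) 1 ⊆ Ici 0 := Icc_subset_Ici_self
  have c1 := (continuousOn_nodalProfile (m := m) hN hp hα).mono hIcc
  have c2 := (continuousOn_nodalProfileDeriv (m := m) hN hp hα).mono hIcc
  have c3 := (continuousOn_nodalProfile (m := m) hN hp hβ0).mono hIcc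
  have c4 := (continuousOn_nodalProfileDeriv (m := m) hN hp hβ0).mono hIcc
  have c5 := (continuous_henonWeight N hα).continuousOn (s := Icc (0 : ℝ) 1)
  have c6 := (continuous_signedPow hp).comp_continuousOn c1
  have i1 : IntervalIntegrable (fun r => r ^ (N - 1) * nodalProfileDeriv N p m α r *
      nodalProfileDeriv N p m β r) volume 0 1 := by
    refine ContinuousOn.intervalIntegrable ?_
    rw [uIcc_of_le zero_le_one]
    exact ((continuous_pow _).continuousOn.mul c2).mul c4
  have i2 : IntervalIntegrable (fun r => henonWeight N α r *
      signedPow p (nodalProfile N p m α r) * nodalProfile N p m β r) volume 0 1 := by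
    refine ContinuousOn.intervalIntegrable ?_
    rw [uIcc_of_le zero_le_one]
    exact (c5.mul c6).mul c3
  have key := intervalIntegral.integral_eq_sub_of_hasDerivAt_of_le (zero_le_one (α := ℝ))
    (((continuous_pow (N - 1)).continuousOn.mul c2).mul c3)
    (fun r hr => ((hasDerivAt_nodalFlux (m := m) hN hp hα hr.1).mul
      (hasDerivAt_nodalProfile (m := m) hN hp hβ0 hr.1)).congr_deriv (f' := _)
      (g' := r ^ (N - 1) * nodalProfileDeriv N p m α r * nodalProfileDeriv N p m β r -
        henonWeight N α r * signedPow p (nodalProfile N p m α r) * nodalProfile N p m β r)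
      (by ring)) (i1.sub i2)
  rw [intervalIntegral.integral_sub i1 i2] at key
  simp only [Pi.mul_apply, nodalProfile_one hN hp hm hβ, nodalProfileDeriv_zero hα, mul_zero,
    zero_mul, sub_zero] at key
  linarith

lemma henonMass_eq (hp : 1 < p) :
    henonMass N p m α = ∫ r in (0 : ℝ)..1, henonWeight N α r *
      signedPow p (nodalProfile N p m α r) * nodalProfile N p m α r := by
  rw [henonMass]
  refine intervalIntegral.integral_congr fun r _ => ?_
  rw [mul_assoc, signedPow_mul_self hp]

lemma integral_ball_comp_norm (hN : 3 ≤ N) (h : ℝ → ℝ) :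
    ∫ x in Metric.ball (0 : EuclideanSpace ℝ (Fin N)) 1, h ‖x‖ =
      N * volume.real (Metric.ball (0 : EuclideanSpace ℝ (Fin N)) 1) *
        ∫ r in (0 : ℝ)..1, r ^ (N - 1) * h r := by
  have : NeZero N := ⟨by omega⟩
  have : Nontrivial (EuclideanSpace ℝ (Fin N)) := by
    refine ⟨EuclideanSpace.single 0 1, 0, fun h => ?_⟩
    have := congrArg norm h
    simp at this
  have h1 := integral_fun_norm_addHaar (volume : Measure (EuclideanSpace ℝ (Fin N)))
    ((Iio (1 : ℝ)).indicator h)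
  have h2 : (fun x : EuclideanSpace ℝ (Fin N) => (Iio (1 : ℝ)).indicator h ‖x‖) =
      (Metric.ball (0 : EuclideanSpace ℝ (Fin N)) 1).indicator fun x => h ‖x‖ := by
    ext x
    simp [indicator]
  have h3 : (fun y : ℝ => y ^ (N - 1) • (Iio (1 : ℝ)).indicator h y) =
      (Iio (1 : ℝ)).indicator fun y => y ^ (N - 1) * h y := by
    ext y
    simp [indicator]
  rw [h2, integral_indicator measurableSet_ball, finrank_euclideanSpace_fin, h3,
    setIntegral_indicator measurableSet_Iio] at h1
  rw [h1, intervalIntegral.integral_of_le zero_le_one, integral_Ioc_eq_integral_Ioo,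
    Ioi_inter_Iio]
  simp [mul_assoc]

/-- The energy of every solution with `m` nodal sets. -/
lemma IsRadialNodalSolution.energy_eq (hN : 3 ≤ N) (hp : 1 < p) (hm : 1 ≤ m)
    (h : henonThreshold N p < α) {u : EuclideanSpace ℝ (Fin N) → ℝ}
    (hu : IsRadialNodalSolution N p α m u) :
    henonEnergy N p α u = N * volume.real (Metric.ball (0 : EuclideanSpace ℝ (Fin N)) 1) *
      ((1 / 2 - 1 / (p + 1)) * henonMass N p m α) := by
  have hα := pos_of_henonThreshold_lt h
  have : NeZero N := ⟨by omega⟩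
  have : Nontrivial (EuclideanSpace ℝ (Fin N)) := by
    refine ⟨EuclideanSpace.single 0 1, 0, fun h => ?_⟩
    have := congrArg norm h
    simp at this
  have heq := hu.eq_nodalProfile hN hp h
  have hball : ∀ x ∈ Metric.ball (0 : EuclideanSpace ℝ (Fin N)) 1,
      u x = nodalProfile N p m α ‖x‖ := fun x hx => heq x (Metric.ball_subset_closedBall hx)
  have hgrad : ∫ x in Metric.ball (0 : EuclideanSpace ℝ (Fin N)) 1, ‖gradient u x‖ ^ 2 =
      ∫ x in Metric.ball (0 : EuclideanSpace ℝ (Fin N)) 1, nodalProfileDeriv N p m α ‖x‖ ^ 2 := by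
    refine setIntegral_congr_ae measurableSet_ball ?_
    filter_upwards [compl_mem_ae_iff.2 (measure_singleton (0 : EuclideanSpace ℝ (Fin N)))]
      with x hx0 hx
    have hx0 : x ≠ 0 := hx0
    have hn : 0 < ‖x‖ := norm_pos_iff.2 hx0
    have hfd : HasFDerivAt u ((nodalProfileDeriv N p m α ‖x‖ / ‖x‖) • realInner _ x) x :=
      (hasFDerivAt_comp_norm hx0 (hasDerivAt_nodalProfile hN hp hα hn)).congr_of_eventuallyEq
        (by filter_upwards [Metric.isOpen_ball.mem_nhds hx] with y hy using hball y hy)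
    rw [gradient, LinearIsometryEquiv.norm_map, hfd.fderiv, norm_smul, norm_realInner_apply,
      norm_div, norm_norm, div_mul_cancel₀ _ hn.ne', Real.norm_eq_abs, sq_abs]
  have hpot : ∫ x in Metric.ball (0 : EuclideanSpace ℝ (Fin N)) 1, ‖x‖ ^ α * |u x| ^ (p + 1) =
      ∫ x in Metric.ball (0 : EuclideanSpace ℝ (Fin N)) 1,
        ‖x‖ ^ α * |nodalProfile N p m α ‖x‖| ^ (p + 1) :=
    setIntegral_congr_fun measurableSet_ball fun x hx => by simp only [hball x hx]
  have e1 : ∫ r in (0 : ℝ)..1, r ^ (N - 1) * nodalProfileDeriv N p m α r ^ 2 =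
      henonMass N p m α := by
    rw [henonMass_eq hp, ← integral_deriv_mul_deriv hN hp hm hα h]
    refine intervalIntegral.integral_congr fun r _ => ?_
    ring
  have e2 : ∫ r in (0 : ℝ)..1, r ^ (N - 1) * (r ^ α * |nodalProfile N p m α r| ^ (p + 1)) =
      henonMass N p m α := by
    rw [henonMass]
    refine intervalIntegral.integral_congr fun r _ => ?_
    simp only [henonWeight]
    ring
  rw [henonEnergy, hgrad, hpot,
    integral_ball_comp_norm hN fun r => nodalProfileDeriv N p m α r ^ 2,
    integral_ball_comp_norm hN fun r => r ^ α * |nodalProfile N p m α r| ^ (p + 1), e1, e2]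
  ring

lemma henonLevel_eq (hN : 3 ≤ N) (hp : 1 < p) (hm : 1 ≤ m) (h : henonThreshold N p < α) :
    henonLevel N p m α = N * volume.real (Metric.ball (0 : EuclideanSpace ℝ (Fin N)) 1) *
      ((1 / 2 - 1 / (p + 1)) * henonMass N p m α) := by
  have hex : ∃ u : EuclideanSpace ℝ (Fin N) → ℝ, IsRadialNodalSolution N p α m u :=
    ⟨_, isRadialNodalSolution_nodalProfile hN hp hm h⟩
  rw [henonLevel, dif_pos hex]
  exact hex.choose_spec.energy_eq hN hp hm h

end

/-! ### Two-sided bounds -/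

section

variable {N : ℕ} {p α : ℝ} {m : ℕ}

lemma continuousOn_massIntegrand (hN : 3 ≤ N) (hp : 1 < p) (hα : 0 < α) :
    ContinuousOn (fun r => henonWeight N α r * |nodalProfile N p m α r| ^ (p + 1)) (Ici 0) :=
  (continuous_henonWeight N hα).continuousOn.mul
    ((continuousOn_nodalProfile hN hp hα).abs.rpow_const fun _ _ => Or.inr (by linarith))

lemma integral_henonWeight (hN : 3 ≤ N) (hα : 0 < α) {t : ℝ} (ht : 0 ≤ t) :
    ∫ r in (0 : ℝ)..t, henonWeight N α r = t ^ ((N : ℝ) + α) / (N + α) := by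
  have hN' : (3 : ℝ) ≤ N := by exact_mod_cast hN
  have h1 : ∫ r in (0 : ℝ)..t, henonWeight N α r =
      ∫ r in (0 : ℝ)..t, r ^ ((N : ℝ) + α - 1) := by
    refine intervalIntegral.integral_congr_ae (ae_of_all _ fun r hr => ?_)
    rw [uIoc_of_le ht] at hr
    exact henonWeight_eq hN hr.1
  rw [h1, integral_rpow (Or.inl (by linarith)), sub_add_cancel, Real.zero_rpow (by linarith),
    sub_zero]

/-- The exponent bookkeeping behind the growth rate `k^((p+3)/(p-1))` of the energy. -/
lemma amplitude_rpow_div (hp : 1 < p) (hα : 0 < α) {z : ℝ} (hz : 0 < z) :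
    ((henonExp α * z) ^ (2 / (p - 1))) ^ (p + 1) / (N + α) =
      henonExp α ^ ((p + 3) / (p - 1)) * z ^ (2 * (p + 1) / (p - 1)) / henonDim N α := by
  have hk : 0 < henonExp α := by linarith [henonExp_gt_one hα]
  have hp1 : p - 1 ≠ 0 := by linarith
  rw [← henonDim_mul_henonExp hα, ← Real.rpow_mul (by positivity), Real.mul_rpow hk.le hz.le,
    show 2 / (p - 1) * (p + 1) = (p + 3) / (p - 1) + 1 by field_simp; ring,
    show 2 * (p + 1) / (p - 1) = (p + 3) / (p - 1) + 1 by field_simp; ring,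
    Real.rpow_add_one hk.ne']
  by_cases hM : henonDim N α = 0
  · simp [hM]
  · field_simp

lemma henonMass_le (hN : 3 ≤ N) (hp : 1 < p) (hα : 0 < α) :
    henonMass N p m α ≤ henonExp α ^ ((p + 3) / (p - 1)) *
      emdenZero p m (henonDim N α) ^ (2 * (p + 1) / (p - 1)) / henonDim N α := by
  have hz := emdenZero_pos p m (henonDim N α)
  rw [← amplitude_rpow_div hp hα hz, henonMass]
  set c := (henonExp α * emdenZero p m (henonDim N α)) ^ (2 / (p - 1))
  have h1 : ∫ r in (0 : ℝ)..1, henonWeight N α r * c ^ (p + 1) = c ^ (p + 1) / (N + α) := by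
    rw [intervalIntegral.integral_mul_const, integral_henonWeight hN hα zero_le_one,
      Real.one_rpow]
    ring
  rw [← h1]
  refine intervalIntegral.integral_mono_on zero_le_one ?_ ?_ fun r hr => ?_
  · refine ContinuousOn.intervalIntegrable ?_
    rw [uIcc_of_le zero_le_one]
    exact (continuousOn_massIntegrand hN hp hα).mono Icc_subset_Ici_self
  · exact ((continuous_henonWeight N hα).mul continuous_const).intervalIntegrable _ _
  · have h2 := henonWeight_nonneg N α hr.1
    have h3 : |nodalProfile N p m α r| ≤ c := abs_henonProfile_le hN hp hα hz hr.1
    gcongr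

lemma half_le_nodalProfile (hN : 3 ≤ N) (hp : 1 < p) (hα : 0 < α) {r : ℝ} (hr : 0 ≤ r)
    (hr1 : emdenZero p m (henonDim N α) * r ^ henonExp α ≤ 1) :
    (henonExp α * emdenZero p m (henonDim N α)) ^ (2 / (p - 1)) * (1 / 2) ≤
      nodalProfile N p m α r := by
  have hz := emdenZero_pos p m (henonDim N α)
  have hkz : 0 < henonExp α * emdenZero p m (henonDim N α) :=
    mul_pos (by linarith [henonExp_gt_one hα]) hz
  exact mul_le_mul_of_nonneg_left ((isEmden_henonDim hN hp hα).half_le_V hp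
    (by linarith [two_lt_henonDim hN hα])
    ⟨mul_nonneg hz.le (Real.rpow_nonneg hr _), hr1⟩) (Real.rpow_pos_of_pos hkz _).le

lemma le_henonMass (hN : 3 ≤ N) (hp : 1 < p) (hm : 1 ≤ m) (h : henonThreshold N p < α) :
    henonExp α ^ ((p + 3) / (p - 1)) * (1 / 2) ^ (p + 1) / henonDim N α ≤ henonMass N p m α := by
  have hα := pos_of_henonThreshold_lt h
  have hk := henonExp_gt_one hα
  have hM := two_lt_henonDim hN hα
  have hMp := henonDim_subcritical h
  have hz := emdenZero_pos p m (henonDim N α)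
  have hz1 := one_le_emdenZero hp hM.le hMp hm
  set k := henonExp α with hkdef
  set M := henonDim N α with hMdef
  set z := emdenZero p m M with hzdef
  set c := (k * z) ^ (2 / (p - 1)) with hc
  have hc0 : 0 < c := Real.rpow_pos_of_pos (by positivity) _
  -- the first radius up to which the profile exceeds half of its maximum
  set t := z ^ (-(1 / k)) with ht
  have ht0 : 0 < t := Real.rpow_pos_of_pos hz _
  have ht1 : t ≤ 1 := Real.rpow_le_one_of_one_le_of_nonpos hz1
    (neg_nonpos.2 (by positivity))
  have hint : IntervalIntegrable
      (fun r => henonWeight N α r * |nodalProfile N p m α r| ^ (p + 1)) volume 0 1 := by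
    refine ContinuousOn.intervalIntegrable ?_
    rw [uIcc_of_le zero_le_one]
    exact (continuousOn_massIntegrand hN hp hα).mono Icc_subset_Ici_self
  have hint' : IntervalIntegrable
      (fun r => henonWeight N α r * |nodalProfile N p m α r| ^ (p + 1)) volume 0 t := by
    refine hint.mono_set ?_
    rw [uIcc_of_le ht0.le, uIcc_of_le zero_le_one]
    exact Icc_subset_Icc_right ht1
  have h1 : ∫ r in (0 : ℝ)..t, henonWeight N α r * |nodalProfile N p m α r| ^ (p + 1) ≤
      henonMass N p m α := by
    refine intervalIntegral.integral_mono_interval le_rfl ht0.le ht1 ?_ hint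
    refine (ae_restrict_iff' measurableSet_Ioc).2 (ae_of_all _ fun r hr => ?_)
    exact mul_nonneg (henonWeight_nonneg N α hr.1.le) (Real.rpow_nonneg (abs_nonneg _) _)
  have h2 : ∫ r in (0 : ℝ)..t, henonWeight N α r * (c * (1 / 2)) ^ (p + 1) ≤
      ∫ r in (0 : ℝ)..t, henonWeight N α r * |nodalProfile N p m α r| ^ (p + 1) := by
    refine intervalIntegral.integral_mono_on ht0.le
      (((continuous_henonWeight N hα).mul continuous_const).intervalIntegrable _ _) hint'
      fun r hr => ?_
    have h3 := henonWeight_nonneg N α hr.1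
    have h4 : z * r ^ k ≤ 1 := by
      have : r ^ k ≤ t ^ k := Real.rpow_le_rpow hr.1 hr.2 (by linarith)
      rw [ht, ← Real.rpow_mul hz.le, show -(1 / k) * k = -1 by field_simp, Real.rpow_neg_one]
        at this
      calc z * r ^ k ≤ z * z⁻¹ := by gcongr
        _ = 1 := mul_inv_cancel₀ hz.ne'
    have h5 := half_le_nodalProfile (m := m) hN hp hα hr.1 h4
    have h6 : c * (1 / 2) ≤ |nodalProfile N p m α r| := h5.trans (le_abs_self _)
    gcongr
  refine le_trans ?_ (h2.trans h1)
  rw [intervalIntegral.integral_mul_const, integral_henonWeight hN hα ht0.le,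
    Real.mul_rpow hc0.le (by norm_num), div_mul_eq_mul_div]
  have e1 : t ^ ((N : ℝ) + α) = z ^ (-M) := by
    rw [ht, ← Real.rpow_mul hz.le, ← henonDim_mul_henonExp hα]
    rw [← hkdef, ← hMdef]
    congr 1
    field_simp
  have e2 := amplitude_rpow_div (N := N) hp hα hz
  rw [← hkdef, ← hMdef, ← hc] at e2
  have e3 : 1 ≤ z ^ (-M) * z ^ (2 * (p + 1) / (p - 1)) := by
    rw [← Real.rpow_add hz]
    refine Real.one_le_rpow hz1 ?_
    have : M ≤ 2 * (p + 1) / (p - 1) := by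
      rw [le_div_iff₀ (by linarith)]; exact hMp.le
    linarith
  have hk0 : 0 < k ^ ((p + 3) / (p - 1)) := Real.rpow_pos_of_pos (by linarith) _
  have hh : (0 : ℝ) < (1 / 2) ^ (p + 1) := Real.rpow_pos_of_pos (by norm_num) _
  calc k ^ ((p + 3) / (p - 1)) * (1 / 2) ^ (p + 1) / M
      ≤ k ^ ((p + 3) / (p - 1)) * (1 / 2) ^ (p + 1) / M *
          (z ^ (-M) * z ^ (2 * (p + 1) / (p - 1))) :=
        le_mul_of_one_le_right (by positivity) e3
    _ = z ^ (-M) * (1 / 2) ^ (p + 1) *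
          (k ^ ((p + 3) / (p - 1)) * z ^ (2 * (p + 1) / (p - 1)) / M) := by ring
    _ = _ := by rw [← e2, e1]; ring

lemma henonDim_le (hN : 3 ≤ N) (hα : 0 < α) : henonDim N α ≤ N := by
  have hN' : (3 : ℝ) ≤ N := by exact_mod_cast hN
  have : ((N : ℝ) - 2) / henonExp α ≤ N - 2 :=
    div_le_self (by linarith) (henonExp_gt_one hα).le
  rw [henonDim]; linarith

lemma henonDim_antitone (hN : 3 ≤ N) {β : ℝ} (hα : 0 < α) (hαβ : α ≤ β) :
    henonDim N β ≤ henonDim N α := by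
  have hN' : (3 : ℝ) ≤ N := by exact_mod_cast hN
  have hk := henonExp_gt_one hα
  have : henonExp α ≤ henonExp β := by simp only [henonExp]; linarith
  rw [henonDim, henonDim]
  have h0 : (0 : ℝ) ≤ N - 2 := by linarith
  gcongr

/-- Lower bound of the mass with a constant independent of `α`. -/
lemma exists_le_henonMass (hN : 3 ≤ N) (hp : 1 < p) (hm : 1 ≤ m) :
    ∃ c > 0, ∀ α, henonThreshold N p < α →
      c * ((α + N) / N) ^ ((p + 3) / (p - 1)) ≤ henonMass N p m α := by
  have hN' : (3 : ℝ) ≤ N := by exact_mod_cast hN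
  have hh : (0 : ℝ) < (1 / 2) ^ (p + 1) := Real.rpow_pos_of_pos (by norm_num) _
  have he : 0 ≤ (p + 3) / (p - 1) := div_nonneg (by linarith) (by linarith)
  refine ⟨(1 / 2) ^ (p + 1) / N, by positivity, fun α h => ?_⟩
  have hα := pos_of_henonThreshold_lt h
  have hk := henonExp_gt_one hα
  have hM := two_lt_henonDim hN hα
  have hMN := henonDim_le hN hα
  refine le_trans ?_ (le_henonMass hN hp hm h)
  have h1 : (α + N) / N ≤ henonExp α := by
    rw [div_le_iff₀ (by linarith), add_comm, ← henonDim_mul_henonExp hα, mul_comm]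
    gcongr
  have h2 : ((α + N) / N) ^ ((p + 3) / (p - 1)) ≤ henonExp α ^ ((p + 3) / (p - 1)) :=
    Real.rpow_le_rpow (by positivity) h1 he
  calc (1 / 2) ^ (p + 1) / N * ((α + N) / N) ^ ((p + 3) / (p - 1))
      ≤ (1 / 2) ^ (p + 1) / henonDim N α * henonExp α ^ ((p + 3) / (p - 1)) := by
        gcongr
    _ = _ := by ring

/-- Upper bound of the mass away from the threshold. The dimension `M` then ranges over a compact
subset of `[2, M_p)`, on which the `m`-th zero is bounded. -/
lemma exists_henonMass_le (hN : 3 ≤ N) (hp : 1 < p) (hm : 1 ≤ m) {α₀ : ℝ}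
    (h₀ : henonThreshold N p < α₀) :
    ∃ c > 0, ∀ α, α₀ ≤ α →
      henonMass N p m α ≤ c * ((α + N) / N) ^ ((p + 3) / (p - 1)) := by
  have hN' : (3 : ℝ) ≤ N := by exact_mod_cast hN
  have hα₀ := pos_of_henonThreshold_lt h₀
  have he : 0 ≤ (p + 3) / (p - 1) := div_nonneg (by linarith) (by linarith)
  have he' : 0 ≤ 2 * (p + 1) / (p - 1) := div_nonneg (by linarith) (by linarith)
  obtain ⟨Z, hZ⟩ := (isCompact_Icc (a := (2 : ℝ)) (b := henonDim N α₀)).exists_bound_of_continuousOn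
    ((continuousOn_emdenZero hp hm).mono fun M hM => ⟨hM.1, lt_of_le_of_lt
      (mul_le_mul_of_nonneg_right hM.2 (by linarith)) (henonDim_subcritical h₀)⟩)
  have hZ0 : 0 < Z := (emdenZero_pos p m 2).trans_le
    ((le_abs_self _).trans (hZ 2 ⟨le_rfl, (two_lt_henonDim hN hα₀).le⟩))
  refine ⟨((N : ℝ) / 2) ^ ((p + 3) / (p - 1)) * Z ^ (2 * (p + 1) / (p - 1)) / 2, by positivity,
    fun α hα' => ?_⟩
  have hα : 0 < α := by linarith
  have hk := henonExp_gt_one hα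
  have hM := two_lt_henonDim hN hα
  refine (henonMass_le hN hp hα).trans ?_
  have h1 : henonExp α ≤ (N : ℝ) / 2 * ((α + N) / N) := by
    rw [show (N : ℝ) / 2 * ((α + N) / N) = (N + α) / 2 by field_simp; ring, henonExp]
    linarith
  have h2 : henonExp α ^ ((p + 3) / (p - 1)) ≤
      ((N : ℝ) / 2) ^ ((p + 3) / (p - 1)) * ((α + N) / N) ^ ((p + 3) / (p - 1)) := by
    rw [← Real.mul_rpow (by positivity) (by positivity)]
    exact Real.rpow_le_rpow (by linarith) h1 he
  have h3 : emdenZero p m (henonDim N α) ^ (2 * (p + 1) / (p - 1)) ≤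
      Z ^ (2 * (p + 1) / (p - 1)) :=
    Real.rpow_le_rpow (emdenZero_pos p m _).le
      ((le_abs_self _).trans (hZ _ ⟨hM.le, henonDim_antitone hN hα₀ hα'⟩)) he'
  have h4 : 0 ≤ emdenZero p m (henonDim N α) ^ (2 * (p + 1) / (p - 1)) :=
    Real.rpow_nonneg (emdenZero_pos p m _).le _
  calc _ ≤ ((N : ℝ) / 2) ^ ((p + 3) / (p - 1)) * ((α + N) / N) ^ ((p + 3) / (p - 1)) *
        Z ^ (2 * (p + 1) / (p - 1)) / 2 := by gcongr
    _ = _ := by ring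

end

/-! ### Dependence on the weight exponent -/

lemma abs_rpow_sub_rpow_le {r a b : ℝ} (hr : r ∈ Icc (0 : ℝ) 1) (ha : 1 ≤ a) (hb : 1 ≤ b) :
    |r ^ a - r ^ b| ≤ |a - b| := by
  wlog hab : a ≤ b generalizing a b
  · rw [abs_sub_comm, abs_sub_comm a]
    exact this hb ha (le_of_not_ge hab)
  rcases hr.1.eq_or_lt with h0 | h0
  · rw [← h0, Real.zero_rpow (by linarith), Real.zero_rpow (by linarith)]
    simp
  have h1 : r ^ b = r ^ a * r ^ (b - a) := by rw [← Real.rpow_add h0]; congr 1; ring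
  have h2 : 1 + (b - a) * Real.log r ≤ r ^ (b - a) := by
    rw [Real.rpow_def_of_pos h0]
    linarith [Real.add_one_le_exp (Real.log r * (b - a))]
  have h3 : r ^ a ≤ r := by
    simpa using Real.rpow_le_rpow_of_exponent_ge h0 hr.2 ha
  have h4 := Real.one_sub_inv_le_log_of_pos h0
  have h5 : -1 ≤ r * Real.log r := by
    have h6 := mul_le_mul_of_nonneg_left h4 h0.le
    rw [mul_sub, mul_inv_cancel₀ h0.ne'] at h6
    linarith
  have h7 : Real.log r ≤ 0 := Real.log_nonpos hr.1 hr.2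
  have h8 : 0 < r ^ a := Real.rpow_pos_of_pos h0 _
  have h9 : r ^ b ≤ r ^ a := Real.rpow_le_rpow_of_exponent_ge h0 hr.2 hab
  rw [abs_of_nonneg (by linarith), abs_sub_comm, abs_of_nonneg (by linarith), h1]
  have h10 : r * Real.log r ≤ r ^ a * Real.log r := mul_le_mul_of_nonpos_right h3 h7
  nlinarith [mul_le_mul_of_nonneg_left h2 h8.le]

lemma IsEmden.abs_V_sub_le {p M : ℝ} {V G : ℝ → ℝ} (h : IsEmden (signedPow p) M V G) (hp : 1 < p)
    (hM : 1 ≤ M) {s t : ℝ} (hs : 0 ≤ s) (ht : 0 ≤ t) : |V s - V t| ≤ |s - t| := by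
  wlog hst : s < t generalizing s t
  · rcases (not_lt.1 hst).eq_or_lt with rfl | hlt
    · simp
    · rw [abs_sub_comm, abs_sub_comm s]
      exact this ht hs hlt
  obtain ⟨x, hx, e⟩ := exists_hasDerivAt_eq_slope V G hst
    (h.contV.mono fun x hx => mem_Ici.2 (hs.trans hx.1))
    fun x hx => h.derivV x (hs.trans_lt hx.1)
  rw [eq_div_iff (by linarith)] at e
  rw [abs_sub_comm, ← e, abs_mul, abs_sub_comm s]
  exact mul_le_of_le_one_left (abs_nonneg _) (h.abs_G_le_one hp hM (hs.trans hx.1.le))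

section

variable {N : ℕ} {p α : ℝ} {m : ℕ}

lemma hasDerivAt_henonExp (α : ℝ) : HasDerivAt henonExp (1 / 2) α :=
  ((hasDerivAt_id' α).const_add 2).div_const 2

lemma henonDim_isBigO (hα : 0 < α) :
    (fun β => henonDim N β - henonDim N α) =O[𝓝 α] fun β => β - α := by
  have h := ((hasDerivAt_const α ((N : ℝ) - 2)).div (hasDerivAt_henonExp α)
    (by linarith [henonExp_gt_one hα] : henonExp α ≠ 0)).const_add 2
  exact h.isBigO_sub

lemma tendsto_of_isBigO_sub {f : ℝ → ℝ} (h : (fun β => f β - f α) =O[𝓝 α] fun β => β - α) :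
    Tendsto f (𝓝 α) (𝓝 (f α)) := by
  have h1 : Tendsto (fun β => β - α) (𝓝 α) (𝓝 0) := by
    have := (by fun_prop : Continuous fun β : ℝ => β - α).tendsto α
    simpa using this
  have h2 := (h.trans_tendsto h1).add_const (f α)
  simpa using h2

lemma henonZero_isBigO (hN : 3 ≤ N) (hp : 1 < p) (hm : 1 ≤ m) (h : henonThreshold N p < α) :
    (fun β => emdenZero p m (henonDim N β) - emdenZero p m (henonDim N α)) =O[𝓝 α]
      fun β => β - α := by
  have hα := pos_of_henonThreshold_lt h
  have h1 := henonDim_isBigO (N := N) hα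
  exact ((emdenZero_isBigO hp (two_lt_henonDim hN hα) (henonDim_subcritical h) hm).comp_tendsto
    (tendsto_of_isBigO_sub h1)).trans h1

/-- The amplitude `u_α(0)` of the solution. -/
noncomputable def henonAmplitude (N : ℕ) (p : ℝ) (m : ℕ) (α : ℝ) : ℝ :=
  (henonExp α * emdenZero p m (henonDim N α)) ^ (2 / (p - 1))

lemma henonAmplitude_pos (hα : 0 < α) : 0 < henonAmplitude N p m α :=
  Real.rpow_pos_of_pos (mul_pos (by linarith [henonExp_gt_one hα]) (emdenZero_pos p m _)) _

lemma henonAmplitude_isBigO (hN : 3 ≤ N) (hp : 1 < p) (hm : 1 ≤ m) (h : henonThreshold N p < α) :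
    (fun β => henonAmplitude N p m β - henonAmplitude N p m α) =O[𝓝 α] fun β => β - α := by
  have hα := pos_of_henonThreshold_lt h
  have hz := henonZero_isBigO hN hp hm h
  have hk := (hasDerivAt_henonExp α).isBigO_sub
  have hzt := tendsto_of_isBigO_sub hz
  set z : ℝ → ℝ := fun β => emdenZero p m (henonDim N β) with hzdef
  have hkz : (fun β => henonExp β * z β - henonExp α * z α) =O[𝓝 α] fun β => β - α := by
    have e : (fun β => henonExp β * z β - henonExp α * z α) =
        fun β => (henonExp β - henonExp α) * z β + henonExp α * (z β - z α) := by
      ext β; ring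
    rw [e]
    refine IsBigO.add ?_ (hz.const_mul_left _)
    have := hk.mul (hzt.isBigO_one ℝ)
    simpa using this
  have hpos : 0 < henonExp α * z α :=
    mul_pos (by linarith [henonExp_gt_one hα]) (emdenZero_pos p m _)
  have h1 := (Real.hasDerivAt_rpow_const (p := 2 / (p - 1)) (Or.inl hpos.ne')).isBigO_sub
  exact (h1.comp_tendsto (tendsto_of_isBigO_sub (f := fun β => henonExp β * z β) hkz)).trans hkz

/-- The solutions depend on `α` in a pointwise Lipschitz way, uniformly in the radius. -/
lemma exists_abs_nodalProfile_sub_le (hN : 3 ≤ N) (hp : 1 < p) (hm : 1 ≤ m)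
    (h : henonThreshold N p < α) :
    ∃ C > 0, ∀ᶠ β in 𝓝 α, ∀ r ∈ Icc (0 : ℝ) 1,
      |nodalProfile N p m β r - nodalProfile N p m α r| ≤ C * |β - α| := by
  have hα := pos_of_henonThreshold_lt h
  have hM := two_lt_henonDim hN hα
  have hk := henonExp_gt_one hα
  have hE := isEmden_henonDim hN hp hα
  obtain ⟨Ca, hCa, ha⟩ := (henonAmplitude_isBigO hN hp hm h).exists_pos
  obtain ⟨Cz, hCz, hz⟩ := (henonZero_isBigO hN hp hm h).exists_pos
  obtain ⟨CM, hCM, hMO⟩ := (henonDim_isBigO (N := N) hα).exists_pos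
  have hzt := tendsto_of_isBigO_sub (f := fun β => emdenZero p m (henonDim N β))
    (henonZero_isBigO hN hp hm h)
  have hz0 := emdenZero_pos p m (henonDim N α)
  have hA := henonAmplitude_pos (N := N) (p := p) (m := m) hα
  set z := emdenZero p m (henonDim N α) with hzdef
  set A := henonAmplitude N p m α with hAdef
  set X := Real.exp ((p + 3) * (z + 1)) with hX
  have hX0 : 0 < X := Real.exp_pos _
  refine ⟨Ca + A * (CM * X + (Cz + z)), by positivity, ?_⟩
  filter_upwards [ha.bound, hz.bound, hMO.bound, hzt.eventually_lt_const (lt_add_one z),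
    lt_mem_nhds hα] with β b1 b2 b3 b4 hβ r hr
  simp only [Real.norm_eq_abs] at b1 b2 b3
  have hE' := isEmden_henonDim hN hp hβ
  have hkβ := henonExp_gt_one hβ
  have hMβ := two_lt_henonDim hN hβ
  have hzβ := emdenZero_pos p m (henonDim N β)
  set zβ := emdenZero p m (henonDim N β) with hzβdef
  set s := zβ * r ^ henonExp β with hs
  set t := z * r ^ henonExp α with ht
  have hrβ : r ^ henonExp β ≤ 1 := Real.rpow_le_one hr.1 hr.2 (by linarith)
  have hrβ0 : 0 ≤ r ^ henonExp β := Real.rpow_nonneg hr.1 _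
  have hs0 : 0 ≤ s := mul_nonneg hzβ.le hrβ0
  have ht0 : 0 ≤ t := mul_nonneg hz0.le (Real.rpow_nonneg hr.1 _)
  have hsz : s ≤ z + 1 := (mul_le_of_le_one_right hzβ.le hrβ).trans b4.le
  have hst : |s - t| ≤ (Cz + z) * |β - α| := by
    have e : s - t = (zβ - z) * r ^ henonExp β + z * (r ^ henonExp β - r ^ henonExp α) := by
      rw [hs, ht]; ring
    have h1 : |(zβ - z) * r ^ henonExp β| ≤ Cz * |β - α| := by
      rw [abs_mul, abs_of_nonneg hrβ0]
      exact (mul_le_of_le_one_right (abs_nonneg _) hrβ).trans b2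
    have h2 : |z * (r ^ henonExp β - r ^ henonExp α)| ≤ z * |β - α| := by
      rw [abs_mul, abs_of_pos hz0]
      have h3 := abs_rpow_sub_rpow_le hr hkβ.le hk.le
      have h4 : |henonExp β - henonExp α| ≤ |β - α| := by
        rw [show henonExp β - henonExp α = (β - α) * (1 / 2) by simp only [henonExp]; ring,
          abs_mul]
        exact mul_le_of_le_one_right (abs_nonneg _) (by norm_num)
      exact mul_le_mul_of_nonneg_left (h3.trans h4) hz0.le
    rw [e, add_mul]
    exact (abs_add_le _ _).trans (add_le_add h1 h2)
  have hV1 : |emdenV p (henonDim N β) s - emdenV p (henonDim N α) s| ≤ CM * X * |β - α| := by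
    have h1 := (hE.sub_le hE' hp (by linarith) (by linarith) hs0).1
    have h2 : Real.exp ((p + 3) * s) ≤ X := by
      rw [hX]; gcongr
    calc _ ≤ |henonDim N β - henonDim N α| * Real.exp ((p + 3) * s) := h1
      _ ≤ (CM * |β - α|) * X := by gcongr
      _ = _ := by ring
  have hV2 := (hE.abs_V_sub_le hp (by linarith) hs0 ht0).trans hst
  have hV3 := hE'.abs_V_le hp (by linarith) hs0
  have e : nodalProfile N p m β r - nodalProfile N p m α r =
      (henonAmplitude N p m β - A) * emdenV p (henonDim N β) s +
        A * ((emdenV p (henonDim N β) s - emdenV p (henonDim N α) s) +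
          (emdenV p (henonDim N α) s - emdenV p (henonDim N α) t)) := by
    simp only [nodalProfile, henonProfile, hAdef, henonAmplitude, hs, ht, hzβdef, hzdef]
    ring
  rw [e]
  refine (abs_add_le _ _).trans ?_
  rw [add_mul, mul_assoc A]
  refine add_le_add ?_ ?_
  · rw [abs_mul]
    exact (mul_le_of_le_one_right (abs_nonneg _) hV3).trans b1
  · rw [abs_mul, abs_of_pos hA, add_mul]
    exact mul_le_mul_of_nonneg_left ((abs_add_le _ _).trans (add_le_add hV1 hV2)) hA.le

/-- `∫ r^(N-1+γ) (1-r) F(v_γ)`, which bounds the growth rate of the energy from below. -/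
noncomputable def henonGrowth (N : ℕ) (p : ℝ) (m : ℕ) (γ : ℝ) : ℝ :=
  ∫ r in (0 : ℝ)..1, henonWeight N γ r * (1 - r) * powPrim p (nodalProfile N p m γ r)

lemma continuousOn_growthIntegrand (hN : 3 ≤ N) (hp : 1 < p) (hα : 0 < α) :
    ContinuousOn (fun r => henonWeight N α r * (1 - r) * powPrim p (nodalProfile N p m α r))
      (Icc 0 1) :=
  ((continuous_henonWeight N hα).continuousOn.mul (by fun_prop)).mul
    ((continuous_powPrim hp).comp_continuousOn
      ((continuousOn_nodalProfile hN hp hα).mono Icc_subset_Ici_self))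

lemma henonGrowth_pos (hN : 3 ≤ N) (hp : 1 < p) (hα : 0 < α) : 0 < henonGrowth N p m α := by
  have hz := emdenZero_pos p m (henonDim N α)
  have hk := henonExp_gt_one hα
  refine intervalIntegral.integral_pos zero_lt_one (continuousOn_growthIntegrand hN hp hα)
    (fun r hr => mul_nonneg (mul_nonneg (henonWeight_nonneg N α hr.1.le) (by linarith [hr.2]))
      (powPrim_nonneg hp _)) ?_
  set c := 1 / (1 + emdenZero p m (henonDim N α)) with hc
  have hc0 : 0 < c := by positivity
  have hc1 : c < 1 := by rw [hc, div_lt_one (by positivity)]; linarith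
  refine ⟨c, ⟨hc0.le, hc1.le⟩, ?_⟩
  have h1 : emdenZero p m (henonDim N α) * c ^ henonExp α ≤ 1 := by
    have h2 : c ^ henonExp α ≤ c := by
      simpa using Real.rpow_le_rpow_of_exponent_ge hc0 hc1.le hk.le
    calc _ ≤ emdenZero p m (henonDim N α) * c := by gcongr
      _ ≤ 1 := by rw [hc, mul_one_div, div_le_one (by positivity)]; linarith
  have h3 := half_le_nodalProfile (m := m) hN hp hα hc0.le h1
  have h4 := henonAmplitude_pos (N := N) (p := p) (m := m) hα
  rw [henonAmplitude] at h4
  have h5 : 0 < powPrim p (nodalProfile N p m α c) := powPrim_pos hp (by linarith)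
  have h6 : 0 < henonWeight N α c :=
    mul_pos (pow_pos hc0 _) (Real.rpow_pos_of_pos hc0 _)
  have : 0 < 1 - c := by linarith
  positivity

/-- The pointwise inequality behind the monotonicity. Subtracting half of Green's identity turns
the difference of the energy densities into the trapezoidal error plus a term that is linear in the
difference of the weights. -/
lemma energy_density_sub_ge {B D w w' x y q : ℝ} (hp : 1 < p) (hx : |x| ≤ B) (hy : |y| ≤ B)
    (hD : |x - y| ≤ D) (hw' : 0 ≤ w') (hww : w' ≤ w) (hw : w ≤ 1) (hq : q = x ∨ q = y) :
    (w - w') / 2 * powPrim p q - 2 * (p * B ^ (p - 1)) * D ^ 2 ≤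
      (w' * signedPow p x + w * signedPow p y) / 2 * (x - y) -
        (w' * powPrim p x - w * powPrim p y) := by
  set L := p * B ^ (p - 1) with hL
  have hB : 0 ≤ B := (abs_nonneg _).trans hx
  have hL0 : 0 ≤ L := mul_nonneg (by linarith) (Real.rpow_nonneg hB _)
  have hT := (abs_le.1 (trapezoid_error hp hx hy)).1
  have hl := signedPow_lipschitz hp hx hy
  have hDD : (x - y) ^ 2 ≤ D ^ 2 := by rw [← sq_abs]; gcongr
  have hf : (signedPow p x - signedPow p y) * (x - y) ≤ L * D ^ 2 := by
    calc _ ≤ |(signedPow p x - signedPow p y) * (x - y)| := le_abs_self _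
      _ = |signedPow p x - signedPow p y| * |x - y| := abs_mul _ _
      _ ≤ L * |x - y| * |x - y| := by gcongr
      _ = L * (x - y) ^ 2 := by rw [mul_assoc, ← sq, sq_abs]
      _ ≤ _ := by gcongr
  have hFx := powPrim_nonneg hp x
  have hFy := powPrim_nonneg hp y
  have hFq : powPrim p q ≤ powPrim p x + powPrim p y := by
    rcases hq with rfl | rfl <;> linarith
  set T := (signedPow p x + signedPow p y) / 2 * (x - y) - (powPrim p x - powPrim p y) with hTdef
  have e : (w' * signedPow p x + w * signedPow p y) / 2 * (x - y) -
        (w' * powPrim p x - w * powPrim p y) =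
      (w + w') / 2 * T + (w - w') / 2 *
        (powPrim p x + powPrim p y - (signedPow p x - signedPow p y) * (x - y) / 2) := by
    rw [hTdef]; ring
  rw [e]
  have hT' : -(L * D ^ 2) ≤ T := by nlinarith
  have hLD : 0 ≤ L * D ^ 2 := by positivity
  have t1 : -(L * D ^ 2) ≤ (w + w') / 2 * T := by nlinarith
  have t2 : (w - w') / 2 * powPrim p q - L * D ^ 2 ≤ (w - w') / 2 *
      (powPrim p x + powPrim p y - (signedPow p x - signedPow p y) * (x - y) / 2) := by
    nlinarith
  linarith

lemma henonWeight_sub_ge {β r : ℝ} (hαβ : α ≤ β) (hαβ' : β ≤ α + 1) (hr : r ∈ Icc (0 : ℝ) 1)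
    (hα : 0 < α) : (β - α) * (henonWeight N α r * (1 - r)) ≤
      henonWeight N α r - henonWeight N β r := by
  have h0 := henonWeight_nonneg N α hr.1
  have h1 : henonWeight N β r = henonWeight N α r * r ^ (β - α) := by
    rcases hr.1.eq_or_lt with h | h
    · rw [← h, henonWeight, henonWeight, Real.zero_rpow hα.ne', Real.zero_rpow (by linarith)]
      simp
    · rw [henonWeight, henonWeight, mul_assoc, ← Real.rpow_add h]
      congr 2; ring
  have h2 := rpow_one_add_le_one_add_mul_self (s := r - 1) (by linarith [hr.1])
    (p := β - α) (by linarith) (by linarith)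
  rw [add_sub_cancel] at h2
  rw [h1]
  nlinarith [mul_le_mul_of_nonneg_left h2 h0]

lemma henonWeight_antitone {β r : ℝ} (hαβ : α ≤ β) (hα : 0 < α) (hr : r ∈ Icc (0 : ℝ) 1) :
    henonWeight N β r ≤ henonWeight N α r := by
  refine mul_le_mul_of_nonneg_left ?_ (pow_nonneg hr.1 _)
  rcases hr.1.eq_or_lt with h | h
  · rw [← h, Real.zero_rpow hα.ne', Real.zero_rpow (by linarith)]
  · exact Real.rpow_le_rpow_of_exponent_ge h hr.2 hαβ

/-- Quantitative monotonicity: the energy grows at least linearly in `β - α`, up to a term that is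
quadratic in the distance of the solutions. -/
lemma henonMass_sub_ge (hN : 3 ≤ N) (hp : 1 < p) (hm : 1 ≤ m) {β γ B D : ℝ}
    (hα : henonThreshold N p < α) (hαβ : α ≤ β) (hαβ' : β ≤ α + 1) (hγ : γ = α ∨ γ = β)
    (hB : ∀ r ∈ Icc (0 : ℝ) 1, |nodalProfile N p m α r| ≤ B ∧ |nodalProfile N p m β r| ≤ B)
    (hD : ∀ r ∈ Icc (0 : ℝ) 1, |nodalProfile N p m β r - nodalProfile N p m α r| ≤ D) :
    (β - α) / 2 * henonGrowth N p m γ - 2 * (p * B ^ (p - 1)) * D ^ 2 ≤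
      (1 / 2 - 1 / (p + 1)) * (henonMass N p m β - henonMass N p m α) := by
  have hβ : henonThreshold N p < β := hα.trans_le hαβ
  have hα0 := pos_of_henonThreshold_lt hα
  have hβ0 := pos_of_henonThreshold_lt hβ
  have hγ0 : 0 < γ := by rcases hγ with rfl | rfl <;> assumption
  set v := nodalProfile N p m α with hv
  set u := nodalProfile N p m β with hu
  have cv : ContinuousOn v (Icc 0 1) :=
    (continuousOn_nodalProfile hN hp hα0).mono Icc_subset_Ici_self
  have cu : ContinuousOn u (Icc 0 1) :=
    (continuousOn_nodalProfile hN hp hβ0).mono Icc_subset_Ici_self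
  have cwα := (continuous_henonWeight N hα0).continuousOn (s := Icc (0 : ℝ) 1)
  have cwβ := (continuous_henonWeight N hβ0).continuousOn (s := Icc (0 : ℝ) 1)
  have cfv := (continuous_signedPow hp).comp_continuousOn cv
  have cfu := (continuous_signedPow hp).comp_continuousOn cu
  have ii : ∀ {f : ℝ → ℝ}, ContinuousOn f (Icc 0 1) → IntervalIntegrable f volume 0 1 := fun h =>
    ContinuousOn.intervalIntegrable (by rwa [uIcc_of_le zero_le_one])
  have green : ∫ r in (0 : ℝ)..1, henonWeight N α r * signedPow p (v r) * u r =
      ∫ r in (0 : ℝ)..1, henonWeight N β r * signedPow p (u r) * v r := by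
    rw [hv, hu, ← integral_deriv_mul_deriv hN hp hm hα0 hβ,
      ← integral_deriv_mul_deriv hN hp hm hβ0 hα]
    refine intervalIntegral.integral_congr fun r _ => ?_
    ring
  have i1 : IntervalIntegrable (fun r => henonWeight N β r * signedPow p (u r) * u r) volume 0 1 :=
    ii ((cwβ.mul cfu).mul cu)
  have i2 : IntervalIntegrable (fun r => henonWeight N α r * signedPow p (v r) * v r) volume 0 1 :=
    ii ((cwα.mul cfv).mul cv)
  have i3 : IntervalIntegrable (fun r => henonWeight N α r * signedPow p (v r) * u r) volume 0 1 :=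
    ii ((cwα.mul cfv).mul cu)
  have i4 : IntervalIntegrable (fun r => henonWeight N β r * signedPow p (u r) * v r) volume 0 1 :=
    ii ((cwβ.mul cfu).mul cv)
  have e1 : (1 / 2 - 1 / (p + 1)) * (henonMass N p m β - henonMass N p m α) =
      ∫ r in (0 : ℝ)..1,
        ((henonWeight N β r * signedPow p (u r) + henonWeight N α r * signedPow p (v r)) / 2 *
          (u r - v r) - (henonWeight N β r * powPrim p (u r) -
            henonWeight N α r * powPrim p (v r))) := by
    have e2 : ∀ r, (henonWeight N β r * signedPow p (u r) + henonWeight N α r * signedPow p (v r)) /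
        2 * (u r - v r) - (henonWeight N β r * powPrim p (u r) -
          henonWeight N α r * powPrim p (v r)) =
        (1 / 2 - 1 / (p + 1)) * (henonWeight N β r * signedPow p (u r) * u r -
          henonWeight N α r * signedPow p (v r) * v r) +
        1 / 2 * (henonWeight N α r * signedPow p (v r) * u r -
          henonWeight N β r * signedPow p (u r) * v r) := fun r => by
      have h1 := signedPow_mul_self_eq hp (u r)
      have h2 := signedPow_mul_self_eq hp (v r)
      have hp1 : p + 1 ≠ 0 := by linarith
      have h3 : powPrim p (u r) = signedPow p (u r) * u r / (p + 1) := by rw [h1]; field_simp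
      have h4 : powPrim p (v r) = signedPow p (v r) * v r / (p + 1) := by rw [h2]; field_simp
      rw [h3, h4]; ring
    simp only [e2]
    rw [intervalIntegral.integral_add ((i1.sub i2).const_mul _) ((i3.sub i4).const_mul _),
      intervalIntegral.integral_const_mul, intervalIntegral.integral_const_mul,
      intervalIntegral.integral_sub i1 i2, intervalIntegral.integral_sub i3 i4, green, sub_self,
      mul_zero, add_zero, henonMass_eq hp, henonMass_eq hp]
  have e3 : (β - α) / 2 * henonGrowth N p m γ - 2 * (p * B ^ (p - 1)) * D ^ 2 =
      ∫ r in (0 : ℝ)..1, ((β - α) / 2 * (henonWeight N γ r * (1 - r) *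
        powPrim p (nodalProfile N p m γ r)) - 2 * (p * B ^ (p - 1)) * D ^ 2) := by
    rw [intervalIntegral.integral_sub ((ii (continuousOn_growthIntegrand hN hp hγ0)).const_mul _)
      (continuous_const.intervalIntegrable _ _), intervalIntegral.integral_const_mul, henonGrowth]
    simp
  rw [e1, e3]
  refine intervalIntegral.integral_mono_on zero_le_one
    (((ii (continuousOn_growthIntegrand hN hp hγ0)).const_mul _).sub
      (continuous_const.intervalIntegrable _ _)) (ii ?_) fun r hr => ?_
  · exact ((((cwβ.mul cfu).add (cwα.mul cfv)).div_const 2).mul (cu.sub cv)).sub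
      ((cwβ.mul ((continuous_powPrim hp).comp_continuousOn cu)).sub
        (cwα.mul ((continuous_powPrim hp).comp_continuousOn cv)))
  · have hq : nodalProfile N p m γ r = u r ∨ nodalProfile N p m γ r = v r := by
      rcases hγ with rfl | rfl
      · exact Or.inr rfl
      · exact Or.inl rfl
    refine le_trans ?_ (energy_density_sub_ge hp (hB r hr).2 (hB r hr).1 (hD r hr)
      (henonWeight_nonneg N β hr.1) (henonWeight_antitone hαβ hα0 hr)
      (henonWeight_le_one N hα0 hr) hq)
    have h1 := henonWeight_sub_ge (N := N) hαβ hαβ' hr hα0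
    have h2 : henonWeight N γ r ≤ henonWeight N α r := by
      rcases hγ with rfl | rfl
      · exact le_rfl
      · exact henonWeight_antitone hαβ hα0 hr
    have h3 : (β - α) * (henonWeight N γ r * (1 - r)) ≤
        (β - α) * (henonWeight N α r * (1 - r)) := by
      have : 0 ≤ 1 - r := by linarith [hr.2]
      have : 0 ≤ β - α := by linarith
      gcongr
    have h4 := powPrim_nonneg hp (nodalProfile N p m γ r)
    have h5 := mul_le_mul_of_nonneg_right (h3.trans h1) h4
    linarith

end

/-- A function that increases strictly through each point of a half-line increases strictly. -/
lemma strictMonoOn_of_eventually {g : ℝ → ℝ} {a : ℝ}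
    (h : ∀ x, a < x → ∀ᶠ y in 𝓝 x, (x < y → g x < g y) ∧ (y < x → g y < g x)) :
    StrictMonoOn g (Ioi a) := by
  intro x hx y _ hxy
  set S : Set ℝ := {t | t ∈ Icc x y ∧ ∀ s ∈ Ioc x t, g x < g s} with hS
  have hxS : x ∈ S := ⟨left_mem_Icc.2 hxy.le, fun s hs => absurd hs.1 (not_lt.2 hs.2)⟩
  have hbdd : BddAbove S := ⟨y, fun t ht => ht.1.2⟩
  set σ := sSup S with hσ
  have hxσ : x ≤ σ := le_csSup hbdd hxS
  have hσy : σ ≤ y := csSup_le ⟨x, hxS⟩ fun t ht => ht.1.2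
  obtain ⟨ε, hε, hloc⟩ := Metric.eventually_nhds_iff.1 (h σ (lt_of_lt_of_le hx hxσ))
  have hσS : ∀ s ∈ Ioc x σ, g x < g s := by
    intro s hs
    rcases hs.2.lt_or_eq with hlt | hsσ
    · obtain ⟨t, ht, hst⟩ := exists_lt_of_lt_csSup ⟨x, hxS⟩ hlt
      exact ht.2 s ⟨hs.1, hst.le⟩
    · have hxs : x < σ := hsσ ▸ hs.1
      rw [hsσ]
      obtain ⟨t, ht, hst⟩ := exists_lt_of_lt_csSup ⟨x, hxS⟩
        (max_lt hxs (by linarith : σ - ε < σ))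
      have hxt : x < t := (le_max_left _ _).trans_lt hst
      have hεt : σ - ε < t := (le_max_right _ _).trans_lt hst
      rcases (le_csSup hbdd ht).lt_or_eq with hlt | heq
      · refine (ht.2 t ⟨hxt, le_rfl⟩).trans ((hloc ?_).2 hlt)
        rw [Real.dist_eq, abs_lt]; constructor <;> linarith
      · exact ht.2 _ ⟨hxs, heq.ge⟩
  rcases hσy.lt_or_eq with hlt | heq
  · exfalso
    have hmem : min y (σ + ε / 2) ∈ S := by
      refine ⟨⟨le_min hxy.le (by linarith), min_le_left _ _⟩, fun s hs => ?_⟩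
      rcases le_or_gt s σ with hsσ | hsσ
      · exact hσS s ⟨hs.1, hsσ⟩
      · have h1 : g σ < g s := by
          refine (hloc ?_).1 hsσ
          have := hs.2.trans (min_le_right _ _)
          rw [Real.dist_eq, abs_lt]; constructor <;> linarith
        rcases hxσ.lt_or_eq with h2 | h2
        · exact (hσS σ ⟨h2, le_rfl⟩).trans h1
        · rwa [h2]
    have := le_csSup hbdd hmem
    rcases min_choice y (σ + ε / 2) with h1 | h1 <;> rw [h1] at this <;> linarith
  · exact hσS y ⟨hxy, heq.ge⟩

/-! ### Strict monotonicity of the level -/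

lemma strictMonoOn_henonMass {N : ℕ} (hN : 3 ≤ N) {p : ℝ} (hp : 1 < p) {m : ℕ} (hm : 1 ≤ m) :
    StrictMonoOn (henonMass N p m) (Ioi (henonThreshold N p)) := by
  refine strictMonoOn_of_eventually fun x hx => ?_
  have hx0 := pos_of_henonThreshold_lt hx
  obtain ⟨C, hC, hlip⟩ := exists_abs_nodalProfile_sub_le hN hp hm hx
  have hamp := tendsto_of_isBigO_sub (henonAmplitude_isBigO hN hp hm hx)
  have hJ := henonGrowth_pos (m := m) hN hp hx0
  set J := henonGrowth N p m x
  set B := henonAmplitude N p m x + 1 with hB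
  have hB0 : 0 < B := by
    have := henonAmplitude_pos (N := N) (p := p) (m := m) hx0
    linarith
  set L := p * B ^ (p - 1) with hL
  have hL0 : 0 < L := mul_pos (by linarith) (Real.rpow_pos_of_pos hB0 _)
  have hc : 0 < 1 / 2 - 1 / (p + 1) := by
    have : 1 / (p + 1) < 1 / 2 := one_div_lt_one_div_of_lt (by norm_num) (by linarith)
    linarith
  have hclose : ∀ᶠ y in 𝓝 x, |y - x| < min 1 (J / (4 * (L * C ^ 2))) := by
    have := Metric.ball_mem_nhds x (lt_min one_pos (by positivity : 0 < J / (4 * (L * C ^ 2))))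
    filter_upwards [this] with y hy using by rwa [Metric.mem_ball, Real.dist_eq] at hy
  filter_upwards [hlip, hamp.eventually_lt_const (lt_add_one _), lt_mem_nhds hx, hclose]
    with y hlipy hampy hy hyx
  have hy0 := pos_of_henonThreshold_lt hy
  have hBx : ∀ r ∈ Icc (0 : ℝ) 1, |nodalProfile N p m x r| ≤ B := fun r hr =>
    (abs_henonProfile_le hN hp hx0 (emdenZero_pos p m _) hr.1).trans
      (by rw [hB, henonAmplitude]; linarith)
  have hBy : ∀ r ∈ Icc (0 : ℝ) 1, |nodalProfile N p m y r| ≤ B := fun r hr =>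
    (abs_henonProfile_le hN hp hy0 (emdenZero_pos p m _) hr.1).trans hampy.le
  have h1 := hyx.trans_le (min_le_left _ _)
  have h2 : |y - x| * (4 * (L * C ^ 2)) < J := by
    rw [← lt_div_iff₀ (by positivity)]
    exact hyx.trans_le (min_le_right _ _)
  have hpos : ∀ d, 0 < d → |y - x| = d → 0 < d / 2 * J - 2 * L * (C * |y - x|) ^ 2 := by
    rintro d hd h
    rw [h] at h2 ⊢
    nlinarith
  constructor
  · intro hxy
    have h := henonMass_sub_ge hN hp hm hx hxy.le (by linarith [le_abs_self (y - x)])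
      (Or.inl rfl) (fun r hr => ⟨hBx r hr, hBy r hr⟩) hlipy
    have := (hpos (y - x) (by linarith) (abs_of_pos (by linarith))).trans_le h
    linarith [pos_of_mul_pos_right this hc.le]
  · intro hyx'
    have h := henonMass_sub_ge hN hp hm hy hyx'.le (by linarith [neg_abs_le (y - x)])
      (Or.inr rfl) (fun r hr => ⟨hBy r hr, hBx r hr⟩)
      (fun r hr => by rw [abs_sub_comm]; exact hlipy r hr)
    have := (hpos (x - y) (by linarith) (by rw [abs_of_neg (by linarith)]; ring)).trans_le h
    linarith [pos_of_mul_pos_right this hc.le]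

theorem proposition2p2 (N : ℕ) (hN : 3 ≤ N) (p : ℝ) (hp : 1 < p) (m : ℕ) (hm : 1 ≤ m) :
    -- the level is well defined: a solution exists and the level is the energy of any of them
    (∀ α : ℝ, henonThreshold N p < α →
      (∃ u : EuclideanSpace ℝ (Fin N) → ℝ, IsRadialNodalSolution N p α m u) ∧
      ∀ u : EuclideanSpace ℝ (Fin N) → ℝ, IsRadialNodalSolution N p α m u →
        henonEnergy N p α u = henonLevel N p m α) ∧
    (∃ C₁ C₂ : ℝ, 0 < C₁ ∧ 0 < C₂ ∧ ∀ α : ℝ, henonThreshold N p < α →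
      C₁ * ((α + (N : ℝ)) / (N : ℝ)) ^ ((p + 3) / (p - 1)) ≤ henonLevel N p m α ∧
      henonLevel N p m α ≤ C₂ * ((α + (N : ℝ)) / (N : ℝ)) ^ ((p + 3) / (p - 1))) ∧
    StrictMonoOn (fun α : ℝ => henonLevel N p m α) (Set.Ioi (henonThreshold N p)) := by
  have hN' : (3 : ℝ) ≤ N := by exact_mod_cast hN
  obtain ⟨ω, hω0, hlevel⟩ : ∃ ω > 0, ∀ α, henonThreshold N p < α →
      henonLevel N p m α = ω * henonMass N p m α := by
    refine ⟨N * volume.real (Metric.ball (0 : EuclideanSpace ℝ (Fin N)) 1) *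
      (1 / 2 - 1 / (p + 1)), ?_, fun α h => by rw [henonLevel_eq hN hp hm h]; ring⟩
    have h1 : 1 / (p + 1) < 1 / 2 := one_div_lt_one_div_of_lt (by norm_num) (by linarith)
    have h2 : 0 < volume.real (Metric.ball (0 : EuclideanSpace ℝ (Fin N)) 1) :=
      ENNReal.toReal_pos (Metric.measure_ball_pos _ _ one_pos).ne' measure_ball_lt_top.ne
    have h3 : 0 < 1 / 2 - 1 / (p + 1) := by linarith
    positivity
  have hmono := strictMonoOn_henonMass hN hp hm
  refine ⟨fun α h => ⟨⟨_, isRadialNodalSolution_nodalProfile hN hp hm h⟩, fun u hu => ?_⟩, ?_, ?_⟩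
  · rw [hu.energy_eq hN hp hm h, henonLevel_eq hN hp hm h]
  · obtain ⟨c₁, hc₁, hlow⟩ := exists_le_henonMass hN hp hm
    set α₀ := henonThreshold N p + 1
    have h₀ : henonThreshold N p < α₀ := lt_add_one _
    obtain ⟨c₂, hc₂, hup⟩ := exists_henonMass_le hN hp hm h₀
    have hα₀ := pos_of_henonThreshold_lt h₀
    have he : 0 ≤ (p + 3) / (p - 1) := div_nonneg (by linarith) (by linarith)
    have hone : ∀ α : ℝ, 0 < α → 1 ≤ ((α + N) / N) ^ ((p + 3) / (p - 1)) := fun α hα =>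
      Real.one_le_rpow (by rw [le_div_iff₀ (by linarith)]; linarith) he
    set K := ((α₀ + N) / N) ^ ((p + 3) / (p - 1))
    have hK : 1 ≤ K := hone α₀ hα₀
    refine ⟨ω * c₁, ω * (c₂ * K), by positivity, by positivity, fun α h => ?_⟩
    have hα := hone α (pos_of_henonThreshold_lt h)
    rw [hlevel α h, mul_assoc, mul_assoc]
    refine ⟨mul_le_mul_of_nonneg_left (hlow α h) hω0.le, mul_le_mul_of_nonneg_left ?_ hω0.le⟩
    rcases le_or_gt α₀ α with hle | hlt
    · refine (hup α hle).trans ?_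
      gcongr
      exact le_mul_of_one_le_right hc₂.le hK
    -- near the threshold the upper bound follows from monotonicity
    · calc henonMass N p m α ≤ henonMass N p m α₀ := (hmono h h₀ hlt).le
        _ ≤ c₂ * K := hup α₀ le_rfl
        _ ≤ c₂ * K * _ := le_mul_of_one_le_right (by positivity) hα
  · intro α hα β hβ hαβ
    simp only
    rw [hlevel α hα, hlevel β hβ]
    exact mul_lt_mul_of_pos_left (hmono hα hβ hαβ) hω0
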